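/- Let $\lambda\in C^1([0,1]\times[0,\infty))$ with $\lambda>0$, let $T>0$, $p\in[1,\infty)$, $y_d\in L^\infty(0,T)$, and let $\rho_0\in L^\infty_+(0,1)$. Here $L^\infty_+(0,L)$ denotes the set of $f\in L^\infty(0,L)$ with $f\ge 0$ almost everywhere. For $u\in L^\infty_+(0,T)$ consider the Cauchy problem $$\rho_t(t,x)+\big(\rho(t,x)\lambda(x,W(t))\big)_x=0,\qquad \rho(0,x)=\rho_0(x),\qquad \rho(t,0)\lambda(0,W(t))=u(t),$$ for $t\in[0,T]$, $x\in[0,1]$, with $W(t)=\int_0^1\rho(t,x)\,dx$. A weak solution is a function $\rho\in C^0([0,T];L^1(0,1))\cap L^\infty((0,T)\times(0,1))$ with $W(t)\ge 0$ for all $t\in[0,T]$ (so that $\lambda(x,W(t))$ is defined) such that, for every $\tau\in[0,T]$ and every $\varphi\in C^1([0,\tau]\times[0,1])$ with $\varphi(\tau,\cdot)=0$ on $[0,1]$ and $\varphi(\cdot,1)=0$ on $[0,\tau]$, $$\int_0^\tau\!\!\int_0^1\rho\,\big(\varphi_t+\lambda(x,W(t))\varphi_x\big)\,dx\,dt+\int_0^\tau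 u(t)\varphi(t,0)\,dt+\int_0^1\rho_0(x)\varphi(0,x)\,dx=0 .$$ Then for every $u\in L^\infty_+(0,T)$ the Cauchy problem has a unique weak solution $\rho$; it has a representative in $C^0([0,1];L^q(0,T))$ for all $q\in[1,\infty)$, so that the out-flux $y(t)=\rho(t,1)\lambda(1,W(t))$ is well defined for almost every $t\in(0,T)$. Moreover the functional $$J_p(u)=\|u\|_{L^\infty(0,T)}^2+\|y-y_d\|_{L^p(0,T)}^2,\qquad u\in L^\infty_+(0,T),$$ where $y$ is the out-flux corresponding to $u$, attains its infimum: there is $u^\infty\in L^\infty_+(0,T)$ with $J_p(u^\infty)=\inf_{u\in L^\infty_+(0,T)}J_p(u)$. -/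

import Mathlib

open MeasureTheory Set Filter Topology

namespace NonlocalConservationLaw

/-- `L^∞₊(0,L)`: essentially bounded, a.e. nonnegative functions on `(0,L)`. -/
def LInftyPos (L : ℝ) : Set (ℝ → ℝ) :=
  {f | MemLp f ⊤ (volume.restrict (Ioo 0 L)) ∧ ∀ᵐ x ∂(volume.restrict (Ioo 0 L)), 0 ≤ f x}

/-- `f ∈ C⁰([0,A]; L^p(0,B))`: each section `f a` is in `L^p(0,B)`, and `a ↦ f a` is
continuous on `[0,A]` for the `L^p(0,B)` norm. -/
def ContinuousIntoLp (p : ENNReal) (A B : ℝ) (f : ℝ → ℝ → ℝ) : Prop :=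
  (∀ a ∈ Icc 0 A, MemLp (f a) p (volume.restrict (Ioo 0 B))) ∧
  ∀ a₀ ∈ Icc 0 A,
    Tendsto (fun a => eLpNorm (fun b => f a b - f a₀ b) p (volume.restrict (Ioo 0 B)))
      (𝓝[Icc 0 A] a₀) (𝓝 0)

/-- The total mass `W(t) = ∫₀¹ ρ(t,x) dx`. -/
noncomputable def mass (ρ : ℝ → ℝ → ℝ) (t : ℝ) : ℝ := ∫ x in (0 : ℝ)..1, ρ t x

/-- Weak solutions `ρ ∈ C⁰([0,T]; L¹(0,1)) ∩ L^∞((0,T)×(0,1))` of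
`ρ_t + (ρ vel(x,W(t)))_x = 0`, `ρ(0,x) = ρ₀(x)`, `ρ(t,0) vel(0,W(t)) = u(t)`,
where `W = mass ρ`. The velocity is only given on `[0,1] × [0,∞)`, so `W` has to take its
values in `[0,∞)` for the equation to make sense. -/
structure IsWeakSolution (vel : ℝ → ℝ → ℝ) (T : ℝ) (ρ₀ u : ℝ → ℝ) (ρ : ℝ → ℝ → ℝ) : Prop where
  continuous_L1 : ContinuousIntoLp 1 T 1 ρ
  bounded : MemLp (Function.uncurry ρ) ⊤ (volume.restrict (Ioo 0 T ×ˢ Ioo 0 1))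
  mass_nonneg : ∀ t ∈ Icc 0 T, 0 ≤ mass ρ t
  weak : ∀ τ ∈ Icc 0 T, ∀ φ : ℝ → ℝ → ℝ,
    ContDiffOn ℝ 1 (Function.uncurry φ) (Icc 0 τ ×ˢ Icc 0 1) →
    (∀ x ∈ Icc (0 : ℝ) 1, φ τ x = 0) →
    (∀ t ∈ Icc 0 τ, φ t 1 = 0) →
    (∫ t in (0 : ℝ)..τ, ∫ x in (0 : ℝ)..1,
        ρ t x * (deriv (fun s => φ s x) t + vel x (mass ρ t) * deriv (fun z => φ t z) x))
      + (∫ t in (0 : ℝ)..τ, u t * φ t 0)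
      + (∫ x in (0 : ℝ)..1, ρ₀ x * φ 0 x) = 0

/-- `y(t) = ρ(t,1) vel(1,W(t))` for a.e. `t ∈ (0,T)`. The value `ρ(·,1)` is that of the
representative `r` of `ρ` which lies in `C⁰([0,1]; L^p(0,T))` for all `p ∈ [1,∞)`. -/
def IsOutflux (vel : ℝ → ℝ → ℝ) (T : ℝ) (ρ : ℝ → ℝ → ℝ) (y : ℝ → ℝ) : Prop :=
  ∃ r : ℝ → ℝ → ℝ,
    Function.uncurry r =ᵐ[volume.restrict (Ioo 0 T ×ˢ Ioo 0 1)] Function.uncurry ρ ∧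
    (∀ p : ENNReal, 1 ≤ p → p ≠ ⊤ → ContinuousIntoLp p 1 T (fun x t => r t x)) ∧
    y =ᵐ[volume.restrict (Ioo 0 T)] fun t => r t 1 * vel 1 (mass ρ t)

/-- The out-flux corresponding to the in-flux `u` and the initial data `ρ₀`
(it is unique up to null sets, and an arbitrary representative is taken). -/
noncomputable def outflux (vel : ℝ → ℝ → ℝ) (T : ℝ) (ρ₀ u : ℝ → ℝ) : ℝ → ℝ :=
  Classical.epsilon fun y => ∃ ρ, IsWeakSolution vel T ρ₀ u ρ ∧ IsOutflux vel T ρ y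

/-- The cost `J_p(u) = ‖u‖²_{L^∞(0,T)} + ‖y - y_d‖²_{L^p(0,T)}`. -/
noncomputable def cost (vel : ℝ → ℝ → ℝ) (T : ℝ) (ρ₀ : ℝ → ℝ) (p : ENNReal) (yd u : ℝ → ℝ) : ℝ :=
  (eLpNorm u ⊤ (volume.restrict (Ioo 0 T))).toReal ^ 2 +
    (eLpNorm (fun t => outflux vel T ρ₀ u t - yd t) p (volume.restrict (Ioo 0 T))).toReal ^ 2

end NonlocalConservationLaw

/-!
The solution is constructed along characteristics. Once the mass `W` is known, the speed
`vel x (W t)` is a known positive, Lipschitz function of `x`, and the density is transported by its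
flow. A particle is named by its *label* `z`, its position at time `0` for the flow of a speed
continued as a constant in `x` to the left of the origin: labels in `(0,1)` belong to the initial
data, negative labels to particles that enter through `x = 0` at the time `entryTime z`. Counting
the particles that are in `[0,1]` at time `t` turns the conservation law into the single scalar
equation `W t = massMap a U R W t`, in which the data occur only through the primitives `U` of the
in-flux and `R` of the initial density. Since `U` and `R` are Lipschitz and the flow depends on `W`
through `∫₀ᵗ |W - V|`, the mass equation is solved by iterating a map that contracts after finitely
many steps (`IsSpeed.exists_massMap_fixed`), and its solution depends continuously, in the uniform
norm, on the primitive of the in-flux (`IsSpeed.abs_sub_le_of_massMap_fixed`). The total mass is at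
most that of the data, so `vel` may be frozen outside a compact set beforehand (`clampSpeed`).

Existence: the transported density is a weak solution
(`IsSpeed.weak_transported`, `isWeakSolution_transported`). It is a continuous function of `t` with
values in `L^p(0,1)`, and of `x` with values in `L^p(0,T)`, because it composes one `L^p` function
of the label with a continuous family of maps that contract distances by at most a fixed factor
(`continuousIntoLp_comp_mul`).

Uniqueness: testing the equation with smooth cutoffs that move along a characteristic shows that,
for any weak solution, the mass to the left of the characteristic is the initial mass to the left of
its label plus the in-flux after its entry time (`IsWeakSolution.integral_left_of_flow`). Hence the
total mass solves the mass equation (`IsWeakSolution.mass_eq_massMap`) and is determined by the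
data, and then so is the solution itself (`IsWeakSolution.unique`).

Optimal control: conservation of mass gives `∫₀ᵗ y = R 1 + U t - W t` for the out-flux `y`
(`IsSpeed.integral_outflux`). Along a minimizing sequence the primitives of the controls are
equi-Lipschitz, so a subsequence converges uniformly, to the primitive of a control whose norm is at
most the limit of the norms (`exists_subseq_tendsto_primitive`). The masses then converge uniformly,
hence so do the primitives of the out-fluxes, and the out-fluxes, being uniformly bounded, converge
weakly (`IsResponse.tendsto_integral_mul_sub`). Weak lower semicontinuity of the `L^p` norm
(`eLpNorm_le_of_tendsto_integral_mul`) shows that the limit control is optimal.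
-/

namespace NonlocalConservationLaw

/-! ### The speed frozen outside a compact set -/

/-- A velocity field `a x w` on all of `ℝ × ℝ` that is bounded between positive constants, globally
Lipschitz, constant in `x` to the left of `0`, and `C¹` in `x` away from the points `0` and `1`. -/
structure IsSpeed (a : ℝ → ℝ → ℝ) (m Λ K : ℝ) : Prop where
  m_pos : 0 < m
  K_pos : 0 < K
  lower : ∀ x w, m ≤ a x w
  upper : ∀ x w, a x w ≤ Λ
  lip : ∀ x x' w w', |a x w - a x' w'| ≤ K * |x - x'| + K * |w - w'|
  const_left : ∀ x ≤ 0, ∀ w, a x w = a 0 w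
  contDiffAt : ∀ w x, x ≠ 0 → x ≠ 1 → ContDiffAt ℝ 1 (fun x => a x w) x

/-- The velocity field frozen outside `[0,1] × [0,M]`. -/
noncomputable def clampSpeed (vel : ℝ → ℝ → ℝ) (M : ℝ) (x w : ℝ) : ℝ :=
  vel (max 0 (min 1 x)) (max 0 (min M w))

lemma clampSpeed_of_mem (vel : ℝ → ℝ → ℝ) {M x w : ℝ} (hx : x ∈ Icc (0 : ℝ) 1)
    (hw : w ∈ Icc 0 M) : clampSpeed vel M x w = vel x w := by
  rw [clampSpeed, min_eq_right hx.2, max_eq_right hx.1, min_eq_right hw.2, max_eq_right hw.1]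

lemma abs_clamp_sub_clamp_le (b x y : ℝ) :
    |max 0 (min b x) - max 0 (min b y)| ≤ |x - y| := by
  rw [max_comm 0, max_comm 0, min_comm b, min_comm b]
  exact (abs_sup_sub_sup_le_abs _ _ _).trans (abs_inf_sub_inf_le_abs _ _ _)

lemma exists_isSpeed_clampSpeed {vel : ℝ → ℝ → ℝ}
    (hvel : ContDiffOn ℝ 1 (Function.uncurry vel) (Icc 0 1 ×ˢ Ici 0))
    (hpos : ∀ x ∈ Icc (0 : ℝ) 1, ∀ W ∈ Ici (0 : ℝ), 0 < vel x W) {M : ℝ} (hM : 0 ≤ M) :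
    ∃ m Λ K, IsSpeed (clampSpeed vel M) m Λ K := by
  have hsub : Icc (0 : ℝ) 1 ×ˢ Icc 0 M ⊆ Icc (0 : ℝ) 1 ×ˢ Ici 0 :=
    prod_mono le_rfl Icc_subset_Ici_self
  have hc : IsCompact (Icc (0 : ℝ) 1 ×ˢ Icc 0 M) := isCompact_Icc.prod isCompact_Icc
  have hne : (Icc (0 : ℝ) 1 ×ˢ Icc 0 M).Nonempty := ⟨(0, 0), by simp [hM]⟩
  have hcl : ∀ b : ℝ, 0 ≤ b → ∀ x, max 0 (min b x) ∈ Icc 0 b := fun b hb x =>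
    ⟨le_max_left _ _, max_le hb (min_le_left _ _)⟩
  have hmem : ∀ x w : ℝ, (max 0 (min 1 x), max 0 (min M w)) ∈ Icc (0 : ℝ) 1 ×ˢ Icc 0 M :=
    fun x w => ⟨hcl 1 zero_le_one x, hcl M hM w⟩
  obtain ⟨K, hK⟩ := (hvel.mono hsub).exists_lipschitzOnWith one_ne_zero
    ((convex_Icc 0 1).prod (convex_Icc 0 M)) hc
  obtain ⟨p, hp, hpmin⟩ := hc.exists_isMinOn hne (hvel.continuousOn.mono hsub)
  obtain ⟨q, hq, hqmax⟩ := hc.exists_isMaxOn hne (hvel.continuousOn.mono hsub)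
  -- `K + 1` instead of `K`, since the Lipschitz constant of a speed is required to be positive
  refine ⟨vel p.1 p.2, vel q.1 q.2, K + 1, hpos _ hp.1 _ hp.2.1, by positivity,
    fun x w => isMinOn_iff.1 hpmin _ (hmem x w), fun x w => isMaxOn_iff.1 hqmax _ (hmem x w),
    fun x x' w w' => ?_, fun x hx w => ?_, fun w x hx0 hx1 => ?_⟩
  · have h1 := hK.dist_le_mul _ (hmem x w) _ (hmem x' w')
    rw [Real.dist_eq, Prod.dist_eq] at h1
    have h2 := abs_clamp_sub_clamp_le 1 x x'
    have h3 := abs_clamp_sub_clamp_le M w w'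
    have h4 : max (dist (max 0 (min 1 x)) (max 0 (min 1 x')))
        (dist (max 0 (min M w)) (max 0 (min M w'))) ≤ |x - x'| + |w - w'| := by
      rw [Real.dist_eq, Real.dist_eq]
      exact max_le (by linarith [abs_nonneg (w - w')]) (by linarith [abs_nonneg (x - x')])
    calc _ ≤ (K : ℝ) * (|x - x'| + |w - w'|) := h1.trans (by gcongr)
      _ ≤ _ := by linarith [abs_nonneg (w - w'), abs_nonneg (x - x')]
  · simp only [clampSpeed]
    rw [max_eq_left (min_le_of_right_le hx), min_eq_right zero_le_one, max_self]
  · have hw' := hcl M hM w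
    rcases lt_or_gt_of_ne hx0 with h | h
    · refine (contDiffAt_const (c := clampSpeed vel M 0 w)).congr_of_eventuallyEq ?_
      filter_upwards [Iio_mem_nhds h] with y hy
      simp only [clampSpeed]
      rw [max_eq_left (min_le_of_right_le (le_of_lt hy)), min_eq_right zero_le_one, max_self]
    rcases lt_or_gt_of_ne hx1 with h' | h'
    · have h1 : ContDiffOn ℝ 1 (fun y => vel y (max 0 (min M w))) (Icc 0 1) :=
        hvel.comp (f := fun y : ℝ => (y, max 0 (min M w))) (by fun_prop)
          (fun y hy => ⟨hy, hw'.1⟩)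
      refine (h1.contDiffAt (Icc_mem_nhds h h')).congr_of_eventuallyEq ?_
      filter_upwards [Icc_mem_nhds h h'] with y hy
      simp only [clampSpeed]
      rw [min_eq_right hy.2, max_eq_right hy.1]
    · refine (contDiffAt_const (c := clampSpeed vel M 1 w)).congr_of_eventuallyEq ?_
      filter_upwards [Ioi_mem_nhds h'] with y hy
      simp only [clampSpeed]
      rw [min_eq_left (le_of_lt hy), min_self]

namespace IsSpeed

variable {a : ℝ → ℝ → ℝ} {m Λ K : ℝ}

lemma pos (h : IsSpeed a m Λ K) (x w : ℝ) : 0 < a x w := h.m_pos.trans_le (h.lower x w)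

lemma upper_pos (h : IsSpeed a m Λ K) : 0 < Λ := (h.pos 0 0).trans_le (h.upper 0 0)

lemma lip_left (h : IsSpeed a m Λ K) (x x' w : ℝ) : |a x w - a x' w| ≤ K * |x - x'| := by
  simpa using h.lip x x' w w

lemma continuous (h : IsSpeed a m Λ K) : Continuous (Function.uncurry a) := by
  rw [continuous_iff_continuousAt]
  intro p
  rw [ContinuousAt, tendsto_iff_norm_sub_tendsto_zero]
  refine squeeze_zero (g := fun q : ℝ × ℝ => K * |q.1 - p.1| + K * |q.2 - p.2|)
    (fun _ => norm_nonneg _) (fun q => h.lip _ _ _ _) ?_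
  have : Continuous fun q : ℝ × ℝ => K * |q.1 - p.1| + K * |q.2 - p.2| := by fun_prop
  simpa using this.tendsto p

lemma continuous_comp (h : IsSpeed a m Λ K) {α : Type*} [TopologicalSpace α] {f g : α → ℝ}
    (hf : Continuous f) (hg : Continuous g) : Continuous fun s => a (f s) (g s) :=
  h.continuous.comp (hf.prodMk hg)

lemma lipschitzWith (h : IsSpeed a m Λ K) (w : ℝ) : LipschitzWith K.toNNReal fun x => a x w :=
  LipschitzWith.of_dist_le_mul fun x y => by
    rw [Real.dist_eq, Real.dist_eq, Real.coe_toNNReal _ h.K_pos.le]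
    exact h.lip_left x y w

lemma abs_deriv_le (h : IsSpeed a m Λ K) (x w : ℝ) : |deriv (fun x => a x w) x| ≤ K := by
  have := norm_deriv_le_of_lipschitz (x₀ := x) (h.lipschitzWith w)
  rwa [Real.coe_toNNReal _ h.K_pos.le] at this

lemma measurable_deriv (h : IsSpeed a m Λ K) :
    Measurable fun q : ℝ × ℝ => deriv (fun x => a x q.2) q.1 := by
  have h1 : Continuous (Function.uncurry fun w x => a x w) :=
    h.continuous.comp (continuous_snd.prodMk continuous_fst)
  exact (measurable_deriv_with_param h1).comp measurable_swap

/-! ### The characteristic flow -/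

lemma exists_solution (h : IsSpeed a m Λ K) {W : ℝ → ℝ} (hW : Continuous W) (z : ℝ) :
    ∃ ξ : ℝ → ℝ, ξ 0 = z ∧ ∀ t, HasDerivAt ξ (a (ξ t) (W t)) t := by
  -- solutions on the intervals `(-(n+1), n+1)`, which agree on overlaps, are patched together
  have key : ∀ n : ℕ, ∃ ξ : ℝ → ℝ, ξ 0 = z ∧
      ∀ t ∈ Ioo (-(n + 1) : ℝ) (n + 1), HasDerivAt ξ (a (ξ t) (W t)) t := by
    intro n
    have h0 : (0 : ℝ) ∈ Icc (-(n + 1) : ℝ) (n + 1) := by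
      constructor <;> linarith [n.cast_nonneg (α := ℝ)]
    have hP : IsPicardLindelof (fun t x => a x (W t)) (⟨0, h0⟩ : Icc (-(n + 1) : ℝ) (n + 1)) z
        (Λ.toNNReal * (n + 1)) 0 Λ.toNNReal K.toNNReal := by
      refine ⟨fun t _ => (h.lipschitzWith _).lipschitzOnWith, fun x _ =>
        (h.continuous_comp continuous_const hW).continuousOn, fun t _ x _ => ?_, ?_⟩
      · rw [Real.norm_eq_abs, abs_of_pos (h.pos _ _), Real.coe_toNNReal _ h.upper_pos.le]
        exact h.upper _ _
      · simp
    obtain ⟨ξ, hξ0, hξ⟩ := hP.exists_eq_forall_mem_Icc_hasDerivWithinAt₀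
    exact ⟨ξ, hξ0, fun t ht => (hξ t (Ioo_subset_Icc_self ht)).hasDerivAt (Icc_mem_nhds ht.1 ht.2)⟩
  choose α hα0 hα using key
  have huniq : ∀ n k : ℕ, n ≤ k → ∀ t ∈ Ioo (-(n + 1) : ℝ) (n + 1), α k t = α n t := by
    intro n k hnk t ht
    have hnk' : (n : ℝ) ≤ k := by exact_mod_cast hnk
    refine ODE_solution_unique_of_mem_Ioo (v := fun t x => a x (W t)) (s := fun _ => univ)
      (K := K.toNNReal) (t₀ := 0) (fun t _ => (h.lipschitzWith _).lipschitzOnWith)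
      ?_ (fun t ht => ⟨hα k t ⟨by linarith [ht.1], by linarith [ht.2]⟩, trivial⟩)
      (fun t ht => ⟨hα n t ht, trivial⟩) (by rw [hα0, hα0]) ht
    constructor <;> linarith [n.cast_nonneg (α := ℝ)]
  refine ⟨fun t => α ⌈|t|⌉₊ t, hα0 _, fun t => ?_⟩
  have hev : (fun t => α ⌈|t|⌉₊ t) =ᶠ[𝓝 t] α ⌈|t|⌉₊ := by
    have hlt : |t| < (⌈|t|⌉₊ : ℝ) + 1 := by linarith [Nat.le_ceil |t|]
    filter_upwards [(continuous_abs.tendsto t).eventually_lt_const hlt] with s hs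
    have hs' : s ∈ Ioo (-(⌈|s|⌉₊ + 1) : ℝ) (⌈|s|⌉₊ + 1) := by
      have := abs_le.1 (Nat.le_ceil |s|)
      constructor <;> linarith
    have hs'' := abs_lt.1 hs
    rcases le_total ⌈|t|⌉₊ ⌈|s|⌉₊ with hle | hle
    · exact huniq _ _ hle s ⟨by linarith, by linarith⟩
    · exact (huniq _ _ hle s hs').symm
  have ht' : t ∈ Ioo (-(⌈|t|⌉₊ + 1) : ℝ) (⌈|t|⌉₊ + 1) := by
    have := abs_le.1 (Nat.le_ceil |t|)
    constructor <;> linarith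
  exact (hα _ t ht').congr_of_eventuallyEq hev

end IsSpeed

/-- The forward flow: `flow a W t z` is the position at time `t` of the characteristic
`ξ' = a(ξ, W(t))` that starts from `z` at time `0`. It is defined by choice among the solutions. -/
noncomputable def flow (a : ℝ → ℝ → ℝ) (W : ℝ → ℝ) (t z : ℝ) : ℝ :=
  Classical.epsilon (fun ξ : ℝ → ℝ => ξ 0 = z ∧ ∀ t, HasDerivAt ξ (a (ξ t) (W t)) t) t

namespace IsSpeed

variable {a : ℝ → ℝ → ℝ} {m Λ K : ℝ} {W : ℝ → ℝ}

lemma flow_zero (h : IsSpeed a m Λ K) (hW : Continuous W) (z : ℝ) : flow a W 0 z = z :=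
  (Classical.epsilon_spec (h.exists_solution hW z)).1

lemma hasDerivAt_flow (h : IsSpeed a m Λ K) (hW : Continuous W) (t z : ℝ) :
    HasDerivAt (fun t => flow a W t z) (a (flow a W t z) (W t)) t :=
  (Classical.epsilon_spec (h.exists_solution hW z)).2 t

lemma continuous_flow_left (h : IsSpeed a m Λ K) (hW : Continuous W) (z : ℝ) :
    Continuous fun t => flow a W t z :=
  continuous_iff_continuousAt.2 fun t => (h.hasDerivAt_flow hW t z).continuousAt

/-- Two curves on `[0,t]` with `|ξ' - η'| ≤ K |ξ - η|` drift apart at rate at most `K`. -/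
lemma _root_.abs_sub_le_exp_mul_of_deriv {ξ η ξ' η' : ℝ → ℝ} {K t : ℝ} (ht : 0 ≤ t)
    (hξ : ∀ s ∈ Icc 0 t, HasDerivAt ξ (ξ' s) s) (hη : ∀ s ∈ Icc 0 t, HasDerivAt η (η' s) s)
    (hK : ∀ s ∈ Icc 0 t, |ξ' s - η' s| ≤ K * |ξ s - η s|) :
    |ξ t - η t| ≤ Real.exp (K * t) * |ξ 0 - η 0| := by
  have hd : ∀ s ∈ Icc 0 t, HasDerivAt (fun s => ξ s - η s) (ξ' s - η' s) s :=
    fun s hs => (hξ s hs).sub (hη s hs)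
  have := norm_le_gronwallBound_of_norm_deriv_right_le (f := fun s => ξ s - η s)
    (f' := fun s => ξ' s - η' s) (δ := |ξ 0 - η 0|) (K := K) (ε := 0) (a := 0) (b := t)
    (fun s hs => (hd s hs).continuousAt.continuousWithinAt)
    (fun s hs => (hd s (Ico_subset_Icc_self hs)).hasDerivWithinAt) le_rfl
    (fun s hs => by simpa using hK s (Ico_subset_Icc_self hs)) t (right_mem_Icc.2 ht)
  rw [gronwallBound_ε0, sub_zero, mul_comm] at this
  exact this

/-- The flow moves two characteristics apart, or together, at rate at most `K`. -/
lemma flow_sub_sq (h : IsSpeed a m Λ K) (hW : Continuous W) (z z' : ℝ) :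
    Monotone (fun t => (flow a W t z - flow a W t z') ^ 2 * Real.exp (2 * K * t)) ∧
    Antitone (fun t => (flow a W t z - flow a W t z') ^ 2 * Real.exp (-(2 * K * t))) := by
  have hd : ∀ t, HasDerivAt (fun t => (flow a W t z - flow a W t z'))
      (a (flow a W t z) (W t) - a (flow a W t z') (W t)) t :=
    fun t => (h.hasDerivAt_flow hW t z).sub (h.hasDerivAt_flow hW t z')
  have hb : ∀ t, |(a (flow a W t z) (W t) - a (flow a W t z') (W t)) *
      (flow a W t z - flow a W t z')| ≤ K * (flow a W t z - flow a W t z') ^ 2 := fun t => by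
    rw [abs_mul, ← sq_abs (flow a W t z - flow a W t z'), sq, ← mul_assoc]
    gcongr
    exact h.lip_left _ _ _
  constructor
  · refine monotone_of_hasDerivAt_nonneg (f' := fun t => 2 * ((a (flow a W t z) (W t) -
      a (flow a W t z') (W t)) * (flow a W t z - flow a W t z') +
      K * (flow a W t z - flow a W t z') ^ 2) * Real.exp (2 * K * t)) (fun t => ?_) fun t => ?_
    · have he : HasDerivAt (fun t => Real.exp (2 * K * t)) (Real.exp (2 * K * t) * (2 * K)) t := by
        simpa using ((hasDerivAt_id t).const_mul (2 * K)).exp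
      refine (((hd t).pow 2).mul he).congr_deriv ?_
      simp only [Nat.cast_ofNat, Pi.pow_apply, Nat.add_one_sub_one, pow_one]
      ring
    · have := neg_le_of_abs_le (hb t)
      have : 0 ≤ ((a (flow a W t z) (W t) - a (flow a W t z') (W t)) *
        (flow a W t z - flow a W t z') + K * (flow a W t z - flow a W t z') ^ 2) := by linarith
      simp only [Pi.zero_apply]
      positivity
  · refine antitone_of_hasDerivAt_nonpos (f' := fun t => -(2 * (-((a (flow a W t z) (W t) -
      a (flow a W t z') (W t)) * (flow a W t z - flow a W t z')) +
      K * (flow a W t z - flow a W t z') ^ 2) * Real.exp (-(2 * K * t)))) (fun t => ?_) fun t => ?_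
    · have he : HasDerivAt (fun t => Real.exp (-(2 * K * t)))
          (Real.exp (-(2 * K * t)) * (-(2 * K))) t := by
        simpa using ((hasDerivAt_id t).const_mul (2 * K)).neg.exp
      refine (((hd t).pow 2).mul he).congr_deriv ?_
      simp only [Nat.cast_ofNat, Pi.pow_apply, Nat.add_one_sub_one, pow_one]
      ring
    · have := le_of_abs_le (hb t)
      have : 0 ≤ (-((a (flow a W t z) (W t) - a (flow a W t z') (W t)) *
        (flow a W t z - flow a W t z')) + K * (flow a W t z - flow a W t z') ^ 2) := by linarith
      simp only [Pi.zero_apply, Left.neg_nonpos_iff]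
      positivity

lemma abs_flow_sub_le (h : IsSpeed a m Λ K) (hW : Continuous W) (t z z' : ℝ) :
    |flow a W t z - flow a W t z'| ≤ Real.exp (K * |t|) * |z - z'| := by
  obtain ⟨h1, h2⟩ := h.flow_sub_sq hW z z'
  rw [← abs_of_pos (Real.exp_pos (K * |t|)), ← abs_mul, ← sq_le_sq, mul_pow, ← Real.exp_nat_mul]
  rcases le_total 0 t with ht | ht
  · have := h2 ht
    simp only [h.flow_zero hW, mul_zero, neg_zero, Real.exp_zero, mul_one] at this
    rw [Real.exp_neg, ← div_eq_mul_inv, div_le_iff₀ (Real.exp_pos _)] at this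
    rw [abs_of_nonneg ht, mul_comm]
    convert this using 3
    push_cast
    ring
  · have := h1 ht
    simp only [h.flow_zero hW, mul_zero, Real.exp_zero, mul_one] at this
    rw [← le_div_iff₀ (Real.exp_pos _), div_eq_mul_inv, ← Real.exp_neg] at this
    rw [abs_of_nonpos ht, mul_comm]
    convert this using 3
    push_cast
    ring

lemma abs_sub_le_flow (h : IsSpeed a m Λ K) (hW : Continuous W) (t z z' : ℝ) :
    |z - z'| ≤ Real.exp (K * |t|) * |flow a W t z - flow a W t z'| := by
  obtain ⟨h1, h2⟩ := h.flow_sub_sq hW z z'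
  rw [← abs_of_pos (Real.exp_pos (K * |t|)), ← abs_mul, ← sq_le_sq, mul_pow, ← Real.exp_nat_mul]
  rcases le_total 0 t with ht | ht
  · have := h1 ht
    simp only [h.flow_zero hW, mul_zero, Real.exp_zero, mul_one] at this
    rw [abs_of_nonneg ht, mul_comm]
    convert this using 3
    push_cast
    ring
  · have := h2 ht
    simp only [h.flow_zero hW, mul_zero, neg_zero, Real.exp_zero, mul_one] at this
    rw [abs_of_nonpos ht, mul_comm]
    convert this using 3
    push_cast
    ring

lemma strictMono_flow (h : IsSpeed a m Λ K) (hW : Continuous W) (t : ℝ) :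
    StrictMono (flow a W t) := by
  intro z z' hz
  by_contra! hle
  have hc : Continuous fun s => flow a W s z' - flow a W s z :=
    (h.continuous_flow_left hW z').sub (h.continuous_flow_left hW z)
  obtain ⟨s, hs⟩ := mem_range_of_exists_le_of_exists_ge hc (c := 0) ⟨t, by linarith⟩
    ⟨0, by rw [h.flow_zero hW, h.flow_zero hW]; linarith⟩
  have h1 := h.abs_sub_le_flow hW s z' z
  have hs' : flow a W s z' - flow a W s z = 0 := hs
  rw [hs', abs_zero, mul_zero] at h1
  have := abs_pos.2 (sub_ne_zero.2 hz.ne')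
  linarith

lemma mul_sub_le_flow_sub (h : IsSpeed a m Λ K) (hW : Continuous W) (z : ℝ) {t t' : ℝ}
    (ht : t ≤ t') : m * (t' - t) ≤ flow a W t' z - flow a W t z :=
  mul_sub_le_image_sub_of_le_deriv (fun s => (h.hasDerivAt_flow hW s z).differentiableAt)
    (fun s => by rw [(h.hasDerivAt_flow hW s z).deriv]; exact h.lower _ _) ht

lemma flow_sub_le_mul_sub (h : IsSpeed a m Λ K) (hW : Continuous W) (z : ℝ) {t t' : ℝ}
    (ht : t ≤ t') : flow a W t' z - flow a W t z ≤ Λ * (t' - t) :=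
  image_sub_le_mul_sub_of_deriv_le (fun s => (h.hasDerivAt_flow hW s z).differentiableAt)
    (fun s => by rw [(h.hasDerivAt_flow hW s z).deriv]; exact h.upper _ _) ht

lemma abs_flow_sub_flow_le (h : IsSpeed a m Λ K) (hW : Continuous W) (z t t' : ℝ) :
    |flow a W t z - flow a W t' z| ≤ Λ * |t - t'| := by
  wlog ht : t' ≤ t generalizing t t'
  · rw [abs_sub_comm, abs_sub_comm t]
    exact this t' t (le_of_not_ge ht)
  have h1 := h.mul_sub_le_flow_sub hW z ht
  have h2 := h.flow_sub_le_mul_sub hW z ht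
  have : 0 ≤ m * (t - t') := mul_nonneg h.m_pos.le (sub_nonneg.2 ht)
  rwa [abs_of_nonneg (this.trans h1), abs_of_nonneg (sub_nonneg.2 ht)]

lemma strictMono_flow_left (h : IsSpeed a m Λ K) (hW : Continuous W) (z : ℝ) :
    StrictMono fun t => flow a W t z := fun t t' ht => by
  have h1 := h.mul_sub_le_flow_sub hW z ht.le
  have : 0 < m * (t' - t) := mul_pos h.m_pos (sub_pos.2 ht)
  simp only
  linarith

lemma continuous_flow (h : IsSpeed a m Λ K) (hW : Continuous W) :
    Continuous (Function.uncurry (flow a W)) := by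
  rw [continuous_iff_continuousAt]
  rintro ⟨t₀, z₀⟩
  rw [ContinuousAt, tendsto_iff_norm_sub_tendsto_zero]
  refine squeeze_zero (g := fun q : ℝ × ℝ => Real.exp (K * |q.1|) * |q.2 - z₀| + Λ * |q.1 - t₀|)
    (fun _ => norm_nonneg _) (fun q => ?_) ?_
  · calc |flow a W q.1 q.2 - flow a W t₀ z₀|
        ≤ |flow a W q.1 q.2 - flow a W q.1 z₀| + |flow a W q.1 z₀ - flow a W t₀ z₀| :=
          abs_sub_le _ _ _
      _ ≤ _ := add_le_add (h.abs_flow_sub_le hW _ _ _) (h.abs_flow_sub_flow_le hW _ _ _)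
  · have : Continuous fun q : ℝ × ℝ => Real.exp (K * |q.1|) * |q.2 - z₀| + Λ * |q.1 - t₀| := by
      fun_prop
    simpa using this.tendsto (t₀, z₀)

lemma continuous_flow_right (h : IsSpeed a m Λ K) (hW : Continuous W) (t : ℝ) :
    Continuous (flow a W t) :=
  (h.continuous_flow hW).comp (continuous_const.prodMk continuous_id)

lemma surjective_flow (h : IsSpeed a m Λ K) (hW : Continuous W) (t : ℝ) :
    Function.Surjective (flow a W t) := by
  have hb : ∀ z, |flow a W t z - z| ≤ Λ * |t| := fun z => by
    simpa [h.flow_zero hW] using h.abs_flow_sub_flow_le hW z t 0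
  refine (h.continuous_flow_right hW t).surjective ?_ ?_
  · exact tendsto_atTop_mono (fun z => by simp only [id]; linarith [(abs_le.1 (hb z)).1])
      (tendsto_atTop_add_const_right _ (-(Λ * |t|)) tendsto_id)
  · exact tendsto_atBot_mono (fun z => by simp only [id]; linarith [(abs_le.1 (hb z)).2])
      (tendsto_atBot_add_const_right _ (Λ * |t|) tendsto_id)

end IsSpeed

/-- The label of the point `(t,x)`: the position at time `0` of the characteristic through it,
that is, the inverse of the flow at time `t`. -/
noncomputable def label (a : ℝ → ℝ → ℝ) (W : ℝ → ℝ) (t x : ℝ) : ℝ :=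
  Function.invFun (flow a W t) x

namespace IsSpeed

variable {a : ℝ → ℝ → ℝ} {m Λ K : ℝ} {W : ℝ → ℝ}

@[simp] lemma flow_label (h : IsSpeed a m Λ K) (hW : Continuous W) (t x : ℝ) :
    flow a W t (label a W t x) = x :=
  Function.rightInverse_invFun (h.surjective_flow hW t) x

@[simp] lemma label_flow (h : IsSpeed a m Λ K) (hW : Continuous W) (t z : ℝ) :
    label a W t (flow a W t z) = z :=
  Function.leftInverse_invFun (h.strictMono_flow hW t).injective z

lemma label_zero (h : IsSpeed a m Λ K) (hW : Continuous W) (x : ℝ) : label a W 0 x = x := by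
  conv_lhs => rw [← h.flow_zero hW x]
  exact h.label_flow hW 0 x

lemma label_lt_iff (h : IsSpeed a m Λ K) (hW : Continuous W) {t x z : ℝ} :
    label a W t x < z ↔ x < flow a W t z := by
  rw [← (h.strictMono_flow hW t).lt_iff_lt, h.flow_label hW]

lemma lt_label_iff (h : IsSpeed a m Λ K) (hW : Continuous W) {t x z : ℝ} :
    z < label a W t x ↔ flow a W t z < x := by
  rw [← (h.strictMono_flow hW t).lt_iff_lt, h.flow_label hW]

lemma strictMono_label (h : IsSpeed a m Λ K) (hW : Continuous W) (t : ℝ) :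
    StrictMono (label a W t) := fun x y hxy => by
  rwa [h.label_lt_iff hW, h.flow_label hW]

lemma strictAnti_label (h : IsSpeed a m Λ K) (hW : Continuous W) (x : ℝ) :
    StrictAnti fun t => label a W t x := fun t t' ht => by
  simp only
  rw [h.label_lt_iff hW]
  calc x = flow a W t (label a W t x) := (h.flow_label hW t x).symm
    _ < _ := h.strictMono_flow_left hW _ ht

lemma continuous_label (h : IsSpeed a m Λ K) (hW : Continuous W) :
    Continuous (Function.uncurry (label a W)) := by
  rw [continuous_iff_continuousAt]
  rintro ⟨t₀, x₀⟩
  rw [ContinuousAt, tendsto_iff_norm_sub_tendsto_zero]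
  refine squeeze_zero (g := fun q : ℝ × ℝ =>
    Real.exp (K * |q.1|) * |q.2 - flow a W q.1 (label a W t₀ x₀)|)
    (fun _ => norm_nonneg _) (fun q => ?_) ?_
  · have := h.abs_sub_le_flow hW q.1 (label a W q.1 q.2) (label a W t₀ x₀)
    rwa [h.flow_label hW] at this
  · have : Continuous fun q : ℝ × ℝ =>
        Real.exp (K * |q.1|) * |q.2 - flow a W q.1 (label a W t₀ x₀)| := by
      have := (h.continuous_flow_left hW (label a W t₀ x₀)).comp (continuous_fst (X := ℝ) (Y := ℝ))
      simp only [Function.comp_def] at this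
      fun_prop
    simpa [h.flow_label hW] using this.tendsto (t₀, x₀)

lemma continuous_label_comp (h : IsSpeed a m Λ K) (hW : Continuous W) {α : Type*}
    [TopologicalSpace α] {f g : α → ℝ} (hf : Continuous f) (hg : Continuous g) :
    Continuous fun s => label a W (f s) (g s) :=
  (h.continuous_label hW).comp (hf.prodMk hg)

lemma abs_sub_le_label (h : IsSpeed a m Λ K) (hW : Continuous W) (t x y : ℝ) :
    |x - y| ≤ Real.exp (K * |t|) * |label a W t x - label a W t y| := by
  simpa [h.flow_label hW] using h.abs_flow_sub_le hW t (label a W t x) (label a W t y)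

lemma abs_sub_time_le_label (h : IsSpeed a m Λ K) (hW : Continuous W) {T t t' : ℝ} (x : ℝ)
    (ht : t ∈ Icc 0 T) (ht' : t' ∈ Icc 0 T) :
    m * |t - t'| ≤ Real.exp (K * T) * |label a W t x - label a W t' x| := by
  wlog hle : t' ≤ t generalizing t t'
  · rw [abs_sub_comm, abs_sub_comm (label a W t x)]
    exact this ht' ht (le_of_not_ge hle)
  have h1 := h.mul_sub_le_flow_sub hW (label a W t' x) hle
  have h2 := h.abs_flow_sub_le hW t (label a W t' x) (label a W t x)
  rw [h.flow_label hW] at h1 h2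
  rw [abs_of_nonneg (sub_nonneg.2 hle), abs_sub_comm (label a W t x)]
  calc _ ≤ flow a W t (label a W t' x) - x := h1
    _ ≤ _ := le_abs_self _
    _ ≤ _ := h2
    _ ≤ _ := by
      rw [abs_of_nonneg ht.1]
      have := h.K_pos
      gcongr
      exact ht.2

end IsSpeed

/-- The derivative of the flow with respect to the starting point, in exponential form. -/
noncomputable def flowDeriv (a : ℝ → ℝ → ℝ) (W : ℝ → ℝ) (t z : ℝ) : ℝ :=
  Real.exp (∫ s in (0 : ℝ)..t, deriv (fun x => a x (W s)) (flow a W s z))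

namespace IsSpeed

variable {a : ℝ → ℝ → ℝ} {m Λ K : ℝ} {W : ℝ → ℝ}

lemma flowDeriv_pos (t z : ℝ) : 0 < flowDeriv a W t z := Real.exp_pos _

lemma measurable_deriv_flow (h : IsSpeed a m Λ K) (hW : Continuous W) (z : ℝ) :
    Measurable fun s => deriv (fun x => a x (W s)) (flow a W s z) :=
  h.measurable_deriv.comp
    ((h.continuous_flow_left hW z).measurable.prodMk hW.measurable)

/-- A characteristic meets the two points where the speed may fail to be `C¹` only at two times. -/
lemma ae_flow_ne (h : IsSpeed a m Λ K) (hW : Continuous W) (z : ℝ) :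
    ∀ᵐ s, flow a W s z ≠ 0 ∧ flow a W s z ≠ 1 := by
  have hf : ∀ c, ∀ᵐ s, flow a W s z ≠ c := fun c => by
    have : {s | flow a W s z = c}.Subsingleton := fun s hs s' hs' =>
      (h.strictMono_flow_left hW z).injective (hs.trans hs'.symm)
    rw [ae_iff]
    simpa using this.measure_zero volume
  exact (hf 0).and (hf 1)

lemma exp_neg_le_flowDeriv (h : IsSpeed a m Λ K) (t z : ℝ) :
    Real.exp (-(K * |t|)) ≤ flowDeriv a W t z := by
  refine Real.exp_le_exp.2 (neg_le_of_abs_le ?_)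
  have := intervalIntegral.norm_integral_le_of_norm_le_const (a := 0) (b := t) (C := K)
    (f := fun s => deriv (fun x => a x (W s)) (flow a W s z)) (fun s _ => h.abs_deriv_le _ _)
  simpa using this

lemma continuous_flowDeriv (h : IsSpeed a m Λ K) (hW : Continuous W) :
    Continuous (Function.uncurry (flowDeriv a W)) := by
  refine Real.continuous_exp.comp (continuous_iff_continuousAt.2 ?_)
  rintro ⟨t₀, z₀⟩
  have := intervalIntegral.continuousAt_parametric_primitive_of_dominated (μ := volume)
    (F := fun z s => deriv (fun x => a x (W s)) (flow a W s z)) (fun _ => K)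
    (-(|t₀| + 1)) (|t₀| + 1) (a₀ := 0) (b₀ := t₀) (x₀ := z₀)
    (fun z => (h.measurable_deriv_flow hW z).aestronglyMeasurable)
    (Eventually.of_forall fun z => ae_of_all _ fun s => h.abs_deriv_le _ _) (by simp)
    (ae_restrict_of_ae ?_) ⟨by linarith [abs_nonneg t₀], by linarith [abs_nonneg t₀]⟩
    ⟨by linarith [neg_abs_le t₀], by linarith [le_abs_self t₀]⟩ (by simp)
  · exact ContinuousAt.comp (f := Prod.swap) (x := (t₀, z₀)) this continuous_swap.continuousAt
  · filter_upwards [h.ae_flow_ne hW z₀] with s hs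
    have h1 : ContinuousAt (deriv fun x => a x (W s)) (flow a W s z₀) :=
      ((h.contDiffAt (W s) _ hs.1 hs.2).derivWithin (m := 0) (by simp)).continuousAt
    exact h1.comp (f := fun z => flow a W s z) (h.continuous_flow_right hW s).continuousAt

lemma continuous_flowDeriv_comp (h : IsSpeed a m Λ K) (hW : Continuous W) {α : Type*}
    [TopologicalSpace α] {f g : α → ℝ} (hf : Continuous f) (hg : Continuous g) :
    Continuous fun s => flowDeriv a W (f s) (g s) :=
  (h.continuous_flowDeriv hW).comp (hf.prodMk hg)

/-- The exponential formula for the flow: the difference quotient in the starting point solves a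
scalar linear equation whose coefficient is the difference quotient of the speed, and the latter
converges as the two starting points merge. -/
lemma hasDerivAt_flow_right (h : IsSpeed a m Λ K) (hW : Continuous W) (t z : ℝ) :
    HasDerivAt (flow a W t) (flowDeriv a W t z) z := by
  set c : ℝ → ℝ → ℝ := fun z' s =>
    (a (flow a W s z') (W s) - a (flow a W s z) (W s)) / (flow a W s z' - flow a W s z) with hc
  have hne : ∀ z' ≠ z, ∀ s, flow a W s z' - flow a W s z ≠ 0 := fun z' hz' s =>
    sub_ne_zero.2 fun he => hz' ((h.strictMono_flow hW s).injective he)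
  have hcc : ∀ z' ≠ z, Continuous (c z') := fun z' hz' =>
    ((h.continuous_comp (h.continuous_flow_left hW z') hW).sub
      (h.continuous_comp (h.continuous_flow_left hW z) hW)).div
      ((h.continuous_flow_left hW z').sub (h.continuous_flow_left hW z)) (hne z' hz')
  have hcb : ∀ z' ≠ z, ∀ s, |c z' s| ≤ K := fun z' hz' s => by
    rw [hc]
    simp only
    rw [abs_div, div_le_iff₀ (abs_pos.2 (hne z' hz' s))]
    exact h.lip_left _ _ _
  have hslope : ∀ z' ≠ z, slope (flow a W t) z z' = Real.exp (∫ s in (0 : ℝ)..t, c z' s) := by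
    intro z' hz'
    have hd : ∀ s, HasDerivAt (fun s => (flow a W s z' - flow a W s z) *
        Real.exp (-∫ r in (0 : ℝ)..s, c z' r)) 0 s := fun s => by
      have h1 := (h.hasDerivAt_flow hW s z').sub (h.hasDerivAt_flow hW s z)
      have h2 := ((hcc z' hz').integral_hasStrictDerivAt 0 s).hasDerivAt.neg.exp
      refine (h1.mul h2).congr_deriv ?_
      have : c z' s * (flow a W s z' - flow a W s z) =
        a (flow a W s z') (W s) - a (flow a W s z) (W s) := div_mul_cancel₀ _ (hne z' hz' s)
      simp only [Pi.sub_apply, Pi.neg_apply]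
      rw [← this]
      ring
    have h3 := is_const_of_deriv_eq_zero (fun s => (hd s).differentiableAt)
      (fun s => (hd s).deriv) t 0
    simp only [h.flow_zero hW, intervalIntegral.integral_same, neg_zero, Real.exp_zero,
      mul_one] at h3
    rw [slope_def_field, ← h3, Real.exp_neg]
    have h4 : flow a W t z' - flow a W t z ≠ 0 := hne z' hz' t
    field_simp
  rw [hasDerivAt_iff_tendsto_slope]
  refine Tendsto.congr' (f₁ := fun z' => Real.exp (∫ s in (0 : ℝ)..t, c z' s)) ?_ ?_
  · filter_upwards [self_mem_nhdsWithin] with z' hz' using (hslope z' hz').symm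
  refine (Real.continuous_exp.tendsto _).comp ?_
  refine intervalIntegral.tendsto_integral_filter_of_dominated_convergence (fun _ => K) ?_ ?_
    (by simp) ?_
  · filter_upwards [self_mem_nhdsWithin] with z' hz' using (hcc z' hz').aestronglyMeasurable
  · filter_upwards [self_mem_nhdsWithin] with z' hz' using ae_of_all _ fun s _ => hcb z' hz' s
  · filter_upwards [h.ae_flow_ne hW z] with s hs _
    have h1 := ((h.contDiffAt (W s) _ hs.1 hs.2).differentiableAt one_ne_zero).hasDerivAt
    have h2 := (hasDerivAt_iff_tendsto_slope.1 h1).comp (f := fun z' => flow a W s z')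
      (x := 𝓝[≠] z) (tendsto_nhdsWithin_of_tendsto_nhds_of_eventually_within _
        ((h.continuous_flow_right hW s).continuousAt.tendsto.mono_left nhdsWithin_le_nhds) ?_)
    · refine h2.congr fun z' => ?_
      simp only [Function.comp, slope_def_field, hc]
    · filter_upwards [self_mem_nhdsWithin] with z' hz'
      exact sub_ne_zero.1 (hne z' hz' s)

/-- Labels at a fixed position decrease in time, at the rate at which characteristics cross it. -/
lemma hasDerivAt_label_left (h : IsSpeed a m Λ K) (hW : Continuous W) (t x : ℝ) :
    HasDerivAt (fun t => label a W t x) (-(a x (W t) / flowDeriv a W t (label a W t x))) t := by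
  have hmv : ∀ t', ∃ ζ ∈ uIcc (label a W t x) (label a W t' x),
      x - flow a W t' (label a W t x) =
        flowDeriv a W t' ζ * (label a W t' x - label a W t x) := by
    intro t'
    have key : ∀ z z' : ℝ, z < z' → ∃ ζ ∈ Icc z z', flow a W t' z' - flow a W t' z =
        flowDeriv a W t' ζ * (z' - z) := fun z z' hz => by
      obtain ⟨ζ, hζ, he⟩ := exists_hasDerivAt_eq_slope (flow a W t') (flowDeriv a W t') hz
        (h.continuous_flow_right hW t').continuousOn fun y _ => h.hasDerivAt_flow_right hW t' y
      refine ⟨ζ, Ioo_subset_Icc_self hζ, ?_⟩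
      rw [he]
      have : z' - z ≠ 0 := (sub_pos.2 hz).ne'
      field_simp
    rcases lt_trichotomy (label a W t x) (label a W t' x) with hlt | heq | hlt
    · obtain ⟨ζ, hζ, he⟩ := key _ _ hlt
      rw [h.flow_label hW] at he
      exact ⟨ζ, by rwa [uIcc_of_le hlt.le], he⟩
    · refine ⟨label a W t x, left_mem_uIcc, ?_⟩
      rw [heq, h.flow_label hW]
      ring
    · obtain ⟨ζ, hζ, he⟩ := key _ _ hlt
      rw [h.flow_label hW] at he
      exact ⟨ζ, by rwa [uIcc_of_ge hlt.le], by linarith⟩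
  choose ζ hζ hζe using hmv
  have hζt : Tendsto ζ (𝓝 t) (𝓝 (label a W t x)) := by
    have hc : Tendsto (fun t' => label a W t' x) (𝓝 t) (𝓝 (label a W t x)) :=
      (h.continuous_label_comp hW continuous_id continuous_const).tendsto t
    have h1 : Tendsto (fun t' => |label a W t' x - label a W t x|) (𝓝 t) (𝓝 0) := by
      simpa using (hc.sub_const (label a W t x)).abs
    rw [tendsto_iff_norm_sub_tendsto_zero]
    refine squeeze_zero (fun _ => norm_nonneg _) (fun t' => ?_) h1
    exact abs_sub_left_of_mem_uIcc (hζ t')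
  rw [hasDerivAt_iff_tendsto_slope]
  have h1 := (hasDerivAt_iff_tendsto_slope.1 (h.hasDerivAt_flow hW t (label a W t x)))
  rw [h.flow_label hW] at h1
  have h2 : Tendsto (fun t' => flowDeriv a W t' (ζ t')) (𝓝[≠] t)
      (𝓝 (flowDeriv a W t (label a W t x))) :=
    ((h.continuous_flowDeriv hW).tendsto (t, label a W t x)).comp
      ((tendsto_id.prodMk_nhds hζt).mono_left nhdsWithin_le_nhds)
  refine ((h1.div h2 (flowDeriv_pos _ _).ne').neg).congr fun t' => ?_
  have h3 := hζe t'
  have h4 := (flowDeriv_pos (a := a) (W := W) t' (ζ t')).ne'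
  simp only [Pi.div_apply, slope_def_field, h.flow_label hW]
  have h5 : flow a W t' (label a W t x) - x =
      -(flowDeriv a W t' (ζ t') * (label a W t' x - label a W t x)) := by linarith
  rw [h5]
  field_simp

end IsSpeed

/-! ### The time at which a characteristic enters the domain -/

/-- The distance covered up to time `t` by characteristics that are still to the left of `0`. -/
noncomputable def inflowShift (a : ℝ → ℝ → ℝ) (W : ℝ → ℝ) (t : ℝ) : ℝ :=
  ∫ s in (0 : ℝ)..t, a 0 (W s)

/-- The time at which the characteristic with label `z` enters `[0,∞)`; it is `0` for `z ≥ 0`. -/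
noncomputable def entryTime (a : ℝ → ℝ → ℝ) (W : ℝ → ℝ) (z : ℝ) : ℝ :=
  Function.invFun (inflowShift a W) (max (-z) 0)

namespace IsSpeed

variable {a : ℝ → ℝ → ℝ} {m Λ K : ℝ} {W : ℝ → ℝ}

lemma inflowShift_zero : inflowShift a W 0 = 0 := intervalIntegral.integral_same

lemma hasDerivAt_inflowShift (h : IsSpeed a m Λ K) (hW : Continuous W) (t : ℝ) :
    HasDerivAt (inflowShift a W) (a 0 (W t)) t :=
  ((h.continuous_comp continuous_const hW).integral_hasStrictDerivAt 0 t).hasDerivAt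

lemma continuous_inflowShift (h : IsSpeed a m Λ K) (hW : Continuous W) :
    Continuous (inflowShift a W) :=
  continuous_iff_continuousAt.2 fun t => (h.hasDerivAt_inflowShift hW t).continuousAt

lemma mul_sub_le_inflowShift_sub (h : IsSpeed a m Λ K) (hW : Continuous W) {t t' : ℝ}
    (ht : t ≤ t') : m * (t' - t) ≤ inflowShift a W t' - inflowShift a W t :=
  mul_sub_le_image_sub_of_le_deriv (fun s => (h.hasDerivAt_inflowShift hW s).differentiableAt)
    (fun s => by rw [(h.hasDerivAt_inflowShift hW s).deriv]; exact h.lower _ _) ht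

lemma mul_abs_sub_le_inflowShift (h : IsSpeed a m Λ K) (hW : Continuous W) (t t' : ℝ) :
    m * |t - t'| ≤ |inflowShift a W t - inflowShift a W t'| := by
  wlog ht : t' ≤ t generalizing t t'
  · rw [abs_sub_comm, abs_sub_comm (inflowShift a W t)]
    exact this t' t (le_of_not_ge ht)
  rw [abs_of_nonneg (sub_nonneg.2 ht)]
  exact (h.mul_sub_le_inflowShift_sub hW ht).trans (le_abs_self _)

lemma strictMono_inflowShift (h : IsSpeed a m Λ K) (hW : Continuous W) :
    StrictMono (inflowShift a W) := fun t t' ht => by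
  have h1 := h.mul_sub_le_inflowShift_sub hW ht.le
  have : 0 < m * (t' - t) := mul_pos h.m_pos (sub_pos.2 ht)
  linarith

lemma surjective_inflowShift (h : IsSpeed a m Λ K) (hW : Continuous W) :
    Function.Surjective (inflowShift a W) := by
  refine (h.continuous_inflowShift hW).surjective ?_ ?_
  · refine tendsto_atTop_mono' atTop ?_ (tendsto_id.const_mul_atTop h.m_pos)
    filter_upwards [eventually_ge_atTop 0] with t ht
    simpa [inflowShift_zero] using h.mul_sub_le_inflowShift_sub hW ht
  · refine tendsto_atBot_mono' atBot ?_ (tendsto_id.const_mul_atBot h.m_pos)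
    filter_upwards [eventually_le_atBot 0] with t ht
    simpa [inflowShift_zero] using h.mul_sub_le_inflowShift_sub hW ht

lemma inflowShift_nonneg (h : IsSpeed a m Λ K) (hW : Continuous W) {t : ℝ} (ht : 0 ≤ t) :
    0 ≤ inflowShift a W t := by
  simpa [inflowShift_zero] using (h.strictMono_inflowShift hW).monotone ht

lemma inflowShift_entryTime (h : IsSpeed a m Λ K) (hW : Continuous W) (z : ℝ) :
    inflowShift a W (entryTime a W z) = max (-z) 0 :=
  Function.rightInverse_invFun (h.surjective_inflowShift hW) _

lemma entryTime_nonneg (h : IsSpeed a m Λ K) (hW : Continuous W) (z : ℝ) :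
    0 ≤ entryTime a W z := by
  rw [← (h.strictMono_inflowShift hW).le_iff_le, h.inflowShift_entryTime hW, inflowShift_zero]
  exact le_max_right _ _

lemma entryTime_of_nonneg (h : IsSpeed a m Λ K) (hW : Continuous W) {z : ℝ} (hz : 0 ≤ z) :
    entryTime a W z = 0 := by
  apply (h.strictMono_inflowShift hW).injective
  rw [h.inflowShift_entryTime hW, inflowShift_zero, max_eq_right (by linarith)]

lemma entryTime_neg_inflowShift (h : IsSpeed a m Λ K) (hW : Continuous W) {t : ℝ} (ht : 0 ≤ t) :
    entryTime a W (-inflowShift a W t) = t := by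
  apply (h.strictMono_inflowShift hW).injective
  rw [h.inflowShift_entryTime hW, neg_neg, max_eq_left (h.inflowShift_nonneg hW ht)]

lemma continuous_entryTime (h : IsSpeed a m Λ K) (hW : Continuous W) :
    Continuous (entryTime a W) := by
  refine (LipschitzWith.of_dist_le_mul (K := (m⁻¹).toNNReal) fun z z' => ?_).continuous
  rw [Real.coe_toNNReal _ (inv_pos.2 h.m_pos).le, Real.dist_eq, Real.dist_eq,
    le_inv_mul_iff₀ h.m_pos]
  refine (h.mul_abs_sub_le_inflowShift hW _ _).trans ?_
  rw [h.inflowShift_entryTime hW, h.inflowShift_entryTime hW]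
  refine (abs_sup_sub_sup_le_abs _ _ _).trans (le_of_eq ?_)
  rw [neg_sub_neg, abs_sub_comm]

lemma flow_eq_add_of_nonpos (h : IsSpeed a m Λ K) (hW : Continuous W) {t z : ℝ} (ht : 0 ≤ t)
    (hz : z + inflowShift a W t ≤ 0) : flow a W t z = z + inflowShift a W t := by
  have := abs_sub_le_exp_mul_of_deriv (ξ := fun s => flow a W s z)
    (η := fun s => z + inflowShift a W s) (K := K) ht (fun s _ => h.hasDerivAt_flow hW s z)
    (fun s _ => (h.hasDerivAt_inflowShift hW s).const_add z) fun s hs => ?_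
  · simpa [h.flow_zero hW, inflowShift_zero, sub_eq_zero] using this
  · have h1 : z + inflowShift a W s ≤ 0 := by
      linarith [(h.strictMono_inflowShift hW).monotone hs.2]
    rw [← h.const_left _ h1]
    exact h.lip_left _ _ _

lemma flow_neg_inflowShift (h : IsSpeed a m Λ K) (hW : Continuous W) {t : ℝ} (ht : 0 ≤ t) :
    flow a W t (-inflowShift a W t) = 0 := by
  rw [h.flow_eq_add_of_nonpos hW ht (by simp)]
  simp

lemma label_zero_right (h : IsSpeed a m Λ K) (hW : Continuous W) {t : ℝ} (ht : 0 ≤ t) :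
    label a W t 0 = -inflowShift a W t := by
  rw [← h.flow_neg_inflowShift hW ht, h.label_flow hW]

lemma flow_entryTime (h : IsSpeed a m Λ K) (hW : Continuous W) (z : ℝ) :
    flow a W (entryTime a W z) z = max z 0 := by
  rcases le_total 0 z with hz | hz
  · rw [h.entryTime_of_nonneg hW hz, h.flow_zero hW, max_eq_left hz]
  · have h1 : inflowShift a W (entryTime a W z) = -z := by
      rw [h.inflowShift_entryTime hW, max_eq_left (by linarith)]
    rw [h.flow_eq_add_of_nonpos hW (h.entryTime_nonneg hW z) (by rw [h1]; simp), h1,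
      max_eq_right hz]
    simp

lemma entryTime_lt_iff (h : IsSpeed a m Λ K) (hW : Continuous W) {t z : ℝ} (ht : 0 < t) :
    entryTime a W z < t ↔ 0 < flow a W t z := by
  rw [← h.label_lt_iff hW, h.label_zero_right hW ht.le, ← (h.strictMono_inflowShift hW).lt_iff_lt,
    h.inflowShift_entryTime hW, max_lt_iff]
  have : 0 < inflowShift a W t := by
    simpa [inflowShift_zero] using h.strictMono_inflowShift hW ht
  constructor
  · rintro ⟨h1, -⟩
    linarith
  · exact fun h1 => ⟨by linarith, this⟩

lemma entryTime_le_of_flow_nonneg (h : IsSpeed a m Λ K) (hW : Continuous W) {t z : ℝ}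
    (ht : 0 ≤ t) (hz : 0 ≤ flow a W t z) : entryTime a W z ≤ t := by
  by_contra! hlt
  have h1 := h.strictMono_flow_left hW z hlt
  simp only [h.flow_entryTime hW] at h1
  rcases le_total 0 z with hz0 | hz0
  · rw [h.entryTime_of_nonneg hW hz0] at hlt
    linarith
  · rw [max_eq_right hz0] at h1
    linarith

end IsSpeed

/-! ### Dependence of the characteristics on the mass -/

/-- Grönwall's inequality in integral form. -/
lemma le_mul_exp_of_le_add_integral {v : ℝ → ℝ} {c k T : ℝ} (hv : Continuous v) (hk : 0 ≤ k)
    (hvT : ∀ t ∈ Icc 0 T, v t ≤ c + k * ∫ s in (0 : ℝ)..t, v s) :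
    ∀ t ∈ Icc 0 T, v t ≤ c * Real.exp (k * t) := by
  intro t ht
  have hd : ∀ s, HasDerivAt (fun s => (c + k * ∫ r in (0 : ℝ)..s, v r) * Real.exp (-(k * s)))
      (k * (v s - (c + k * ∫ r in (0 : ℝ)..s, v r)) * Real.exp (-(k * s))) s := fun s => by
    have h1 := (((hv.integral_hasStrictDerivAt 0 s).hasDerivAt).const_mul k).const_add c
    have h2 : HasDerivAt (fun s => Real.exp (-(k * s))) (Real.exp (-(k * s)) * -k) s := by
      simpa using ((hasDerivAt_id s).const_mul k).neg.exp
    refine (h1.mul h2).congr_deriv ?_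
    ring
  have hanti : AntitoneOn (fun s => (c + k * ∫ r in (0 : ℝ)..s, v r) * Real.exp (-(k * s)))
      (Icc 0 T) := by
    refine antitoneOn_of_deriv_nonpos (convex_Icc 0 T)
      (fun s _ => (hd s).continuousAt.continuousWithinAt)
      (fun s _ => (hd s).differentiableAt.differentiableWithinAt) fun s hs => ?_
    rw [(hd s).deriv]
    have := hvT s (interior_subset hs)
    exact mul_nonpos_of_nonpos_of_nonneg
      (mul_nonpos_of_nonneg_of_nonpos hk (by linarith)) (Real.exp_pos _).le
  have h1 := hanti (left_mem_Icc.2 (ht.1.trans ht.2)) ht ht.1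
  simp only [intervalIntegral.integral_same, mul_zero, add_zero, neg_zero, Real.exp_zero,
    mul_one] at h1
  rw [Real.exp_neg, ← div_eq_mul_inv, div_le_iff₀ (Real.exp_pos _)] at h1
  exact (hvT t ht).trans h1

namespace IsSpeed

variable {a : ℝ → ℝ → ℝ} {m Λ K : ℝ} {W V : ℝ → ℝ}

lemma integral_abs_sub_mono (hW : Continuous W) (hV : Continuous V) {s t : ℝ} (hs : 0 ≤ s)
    (hst : s ≤ t) : ∫ r in (0 : ℝ)..s, |W r - V r| ≤ ∫ r in (0 : ℝ)..t, |W r - V r| :=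
  intervalIntegral.integral_mono_interval le_rfl hs hst
    (ae_of_all _ fun _ => abs_nonneg _) ((hW.sub hV).abs.intervalIntegrable _ _)

/-- Two characteristics with the same label, for two masses: Grönwall's inequality. -/
lemma abs_flow_sub_flow_of_mass_le (h : IsSpeed a m Λ K) (hW : Continuous W) (hV : Continuous V)
    {t : ℝ} (ht : 0 ≤ t) (z : ℝ) :
    |flow a W t z - flow a V t z| ≤
      K * (∫ s in (0 : ℝ)..t, |W s - V s|) * Real.exp (K * t) := by
  have hcW := h.continuous_comp (h.continuous_flow_left hW z) hW
  have hcV := h.continuous_comp (h.continuous_flow_left hV z) hV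
  have hcD : Continuous fun s => |flow a W s z - flow a V s z| :=
    ((h.continuous_flow_left hW z).sub (h.continuous_flow_left hV z)).abs
  have hcM : Continuous fun s => |W s - V s| := (hW.sub hV).abs
  refine le_mul_exp_of_le_add_integral hcD h.K_pos.le (fun s hs => ?_) t ⟨ht, le_rfl⟩
  have h1 : flow a W s z - flow a V s z =
      ∫ r in (0 : ℝ)..s, (a (flow a W r z) (W r) - a (flow a V r z) (V r)) := by
    rw [intervalIntegral.integral_eq_sub_of_hasDerivAt
      (f := fun r => flow a W r z - flow a V r z)
      (fun r _ => (h.hasDerivAt_flow hW r z).sub (h.hasDerivAt_flow hV r z))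
      ((hcW.sub hcV).intervalIntegrable _ _)]
    simp [h.flow_zero hW, h.flow_zero hV]
  calc |flow a W s z - flow a V s z|
      ≤ ∫ r in (0 : ℝ)..s, |a (flow a W r z) (W r) - a (flow a V r z) (V r)| := by
        rw [h1]
        exact intervalIntegral.abs_integral_le_integral_abs hs.1
    _ ≤ ∫ r in (0 : ℝ)..s, (K * |flow a W r z - flow a V r z| + K * |W r - V r|) :=
        intervalIntegral.integral_mono_on hs.1 ((hcW.sub hcV).abs.intervalIntegrable _ _)
          (((hcD.const_mul K).add (hcM.const_mul K)).intervalIntegrable _ _)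
          fun r _ => h.lip _ _ _ _
    _ = K * (∫ r in (0 : ℝ)..s, |W r - V r|) +
          K * ∫ r in (0 : ℝ)..s, |flow a W r z - flow a V r z| := by
        rw [intervalIntegral.integral_add ((hcD.const_mul K).intervalIntegrable _ _)
          ((hcM.const_mul K).intervalIntegrable _ _), intervalIntegral.integral_const_mul,
          intervalIntegral.integral_const_mul, add_comm]
    _ ≤ _ := by
        have := h.K_pos
        have := integral_abs_sub_mono hW hV hs.1 hs.2
        gcongr

lemma abs_label_sub_label_le (h : IsSpeed a m Λ K) (hW : Continuous W) (hV : Continuous V)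
    {T t : ℝ} (ht : t ∈ Icc 0 T) (x : ℝ) :
    |label a W t x - label a V t x| ≤
      K * Real.exp (2 * K * T) * ∫ s in (0 : ℝ)..t, |W s - V s| := by
  have h1 := h.abs_sub_le_flow hW t (label a W t x) (label a V t x)
  have h2 := h.abs_flow_sub_flow_of_mass_le hW hV ht.1 (label a V t x)
  rw [h.flow_label hW, abs_of_nonneg ht.1] at h1
  rw [h.flow_label hV, abs_sub_comm] at h2
  have hI : 0 ≤ ∫ s in (0 : ℝ)..t, |W s - V s| :=
    intervalIntegral.integral_nonneg ht.1 fun _ _ => abs_nonneg _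
  have hK := h.K_pos
  calc _ ≤ Real.exp (K * t) * (K * (∫ s in (0 : ℝ)..t, |W s - V s|) * Real.exp (K * t)) :=
        h1.trans (by gcongr)
    _ = K * Real.exp (2 * K * t) * ∫ s in (0 : ℝ)..t, |W s - V s| := by
        rw [show 2 * K * t = K * t + K * t by ring, Real.exp_add]
        ring
    _ ≤ _ := by
        have := ht.2
        gcongr

lemma abs_entryTime_sub_entryTime_le (h : IsSpeed a m Λ K) (hW : Continuous W)
    (hV : Continuous V) {t z z' : ℝ} (hz' : entryTime a V z' ≤ t) :
    |entryTime a W z - entryTime a V z'| ≤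
      m⁻¹ * (|z - z'| + K * ∫ s in (0 : ℝ)..t, |W s - V s|) := by
  rw [le_inv_mul_iff₀ h.m_pos]
  refine (h.mul_abs_sub_le_inflowShift hW _ _).trans ?_
  set s := entryTime a V z' with hs
  have hs0 : 0 ≤ s := h.entryTime_nonneg hV z'
  have h1 : |inflowShift a W (entryTime a W z) - inflowShift a V s| ≤ |z - z'| := by
    rw [h.inflowShift_entryTime hW, hs, h.inflowShift_entryTime hV]
    refine (abs_sup_sub_sup_le_abs _ _ _).trans (le_of_eq ?_)
    rw [neg_sub_neg, abs_sub_comm]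
  have hcW := h.continuous_comp (continuous_const (y := (0 : ℝ))) hW
  have hcV := h.continuous_comp (continuous_const (y := (0 : ℝ))) hV
  have h2 : |inflowShift a V s - inflowShift a W s| ≤ K * ∫ r in (0 : ℝ)..t, |W r - V r| := by
    rw [inflowShift, inflowShift, ← intervalIntegral.integral_sub
      (hcV.intervalIntegrable _ _) (hcW.intervalIntegrable _ _)]
    calc _ ≤ ∫ r in (0 : ℝ)..s, |a 0 (V r) - a 0 (W r)| :=
          intervalIntegral.abs_integral_le_integral_abs hs0
      _ ≤ ∫ r in (0 : ℝ)..s, K * |W r - V r| := by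
          refine intervalIntegral.integral_mono_on hs0 ((hcV.sub hcW).abs.intervalIntegrable _ _)
            (((hW.sub hV).abs.const_mul K).intervalIntegrable _ _) fun r _ => ?_
          have := h.lip 0 0 (V r) (W r)
          rw [abs_sub_comm (W r)]
          simpa using this
      _ ≤ _ := by
          rw [intervalIntegral.integral_const_mul]
          have := h.K_pos
          have := integral_abs_sub_mono hW hV hs0 hz'
          gcongr
  exact (abs_sub_le _ (inflowShift a V s) _).trans (add_le_add h1 h2)

end IsSpeed

/-! ### The fixed point equation for the mass -/

/-- The mass at time `t` that the data transport into `[0,1]` when the speed is driven by `W`. The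
arguments `U` and `R` are the primitives of the in-flux and of the initial density: the total
in-flux `U t`, minus the part of it that has left, plus the part of the initial mass that has not
left. Both parts are read off the label of the characteristic that leaves at time `t`. -/
noncomputable def massMap (a : ℝ → ℝ → ℝ) (U R W : ℝ → ℝ) (t : ℝ) : ℝ :=
  U t - U (entryTime a W (label a W t 1)) + R (max (label a W t 1) 0)

/-- A Lipschitz constant for `massMap` with respect to the `L¹` distance of the driving masses. -/
noncomputable def massConst (m K T L B : ℝ) : ℝ :=
  L * (m⁻¹ * (K * Real.exp (2 * K * T) + K)) + B * (K * Real.exp (2 * K * T))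

namespace IsSpeed

variable {a : ℝ → ℝ → ℝ} {m Λ K : ℝ} {U V W R : ℝ → ℝ} {T L B : ℝ}

lemma massConst_nonneg (h : IsSpeed a m Λ K) (hL : 0 ≤ L) (hB : 0 ≤ B) :
    0 ≤ massConst m K T L B := by
  have := h.m_pos
  have := h.K_pos
  unfold massConst
  positivity

lemma entryTime_label_one_mem (h : IsSpeed a m Λ K) (hW : Continuous W) {x t : ℝ} (hx : 0 ≤ x)
    (ht : 0 ≤ t) : entryTime a W (label a W t x) ∈ Icc 0 t :=
  ⟨h.entryTime_nonneg hW _, h.entryTime_le_of_flow_nonneg hW ht (by rwa [h.flow_label hW])⟩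

lemma abs_massMap_sub_le (h : IsSpeed a m Λ K) (hW : Continuous W) (hV : Continuous V)
    (hL : 0 ≤ L) (hB : 0 ≤ B) (hU : ∀ s t, |U s - U t| ≤ L * |s - t|)
    (hR : ∀ s t, |R s - R t| ≤ B * |s - t|) {t : ℝ} (ht : t ∈ Icc 0 T) :
    |massMap a U R W t - massMap a U R V t| ≤
      massConst m K T L B * ∫ s in (0 : ℝ)..t, |W s - V s| := by
  have h1 := h.abs_label_sub_label_le hW hV ht 1
  have h2 := h.abs_entryTime_sub_entryTime_le hW hV (z := label a W t 1)
    (h.entryTime_label_one_mem hV zero_le_one ht.1).2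
  have h3 := hU (entryTime a W (label a W t 1)) (entryTime a V (label a V t 1))
  have h4 := hR (max (label a W t 1) 0) (max (label a V t 1) 0)
  have h5 := abs_sup_sub_sup_le_abs (label a W t 1) (label a V t 1) 0
  have hm := h.m_pos
  set I := ∫ s in (0 : ℝ)..t, |W s - V s|
  have h6 : |entryTime a W (label a W t 1) - entryTime a V (label a V t 1)| ≤
      m⁻¹ * (K * Real.exp (2 * K * T) * I + K * I) := h2.trans (by gcongr)
  calc |massMap a U R W t - massMap a U R V t|
      = |(R (max (label a W t 1) 0) - R (max (label a V t 1) 0)) -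
        (U (entryTime a W (label a W t 1)) - U (entryTime a V (label a V t 1)))| := by
        simp only [massMap]
        ring_nf
    _ ≤ _ := abs_sub _ _
    _ ≤ B * (K * Real.exp (2 * K * T) * I) +
        L * (m⁻¹ * (K * Real.exp (2 * K * T) * I + K * I)) := by
        refine add_le_add (h4.trans ?_) (h3.trans ?_)
        · exact mul_le_mul_of_nonneg_left (h5.trans h1) hB
        · gcongr
    _ = _ := by
        rw [massConst]
        ring

lemma continuous_massMap (h : IsSpeed a m Λ K) (hW : Continuous W) (hU : Continuous U)
    (hR : Continuous R) : Continuous (massMap a U R W) := by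
  have hl : Continuous fun t => label a W t 1 :=
    h.continuous_label_comp hW continuous_id continuous_const
  have he := (h.continuous_entryTime hW).comp hl
  simp only [Function.comp_def] at he
  unfold massMap
  fun_prop

lemma _root_.continuous_of_abs_sub_le {f : ℝ → ℝ} {C : ℝ} (hC : 0 ≤ C)
    (hf : ∀ s t, |f s - f t| ≤ C * |s - t|) : Continuous f :=
  (LipschitzWith.of_dist_le_mul (K := C.toNNReal) fun s t => by
    rw [Real.coe_toNNReal _ hC]
    exact hf s t).continuous

/-- Solutions of the fixed point equation depend continuously on the primitive of the in-flux, in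
the uniform norm. -/
lemma abs_sub_le_of_massMap_fixed (h : IsSpeed a m Λ K) (hW : Continuous W) (hV : Continuous V)
    (hL : 0 ≤ L) (hB : 0 ≤ B) {U' : ℝ → ℝ} {ε : ℝ}
    (hU : ∀ s t, |U s - U t| ≤ L * |s - t|) (hR : ∀ s t, |R s - R t| ≤ B * |s - t|)
    (hUU' : ∀ t ∈ Icc 0 T, |U t - U' t| ≤ ε)
    (hWfix : ∀ t ∈ Icc 0 T, W t = massMap a U R W t)
    (hVfix : ∀ t ∈ Icc 0 T, V t = massMap a U' R V t) :
    ∀ t ∈ Icc 0 T, |W t - V t| ≤ 2 * ε * Real.exp (massConst m K T L B * t) := by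
  refine le_mul_exp_of_le_add_integral (hW.sub hV).abs (h.massConst_nonneg hL hB) fun t ht => ?_
  have h1 := h.abs_massMap_sub_le hW hV hL hB hU hR ht
  have h2 := h.entryTime_label_one_mem hV zero_le_one ht.1
  have h3 := hUU' t ht
  have h4 := hUU' _ ⟨h2.1, h2.2.trans ht.2⟩
  have h5 : W t - V t = (massMap a U R W t - massMap a U R V t) + ((U t - U' t) -
      (U (entryTime a V (label a V t 1)) - U' (entryTime a V (label a V t 1)))) := by
    rw [hWfix t ht, hVfix t ht]
    simp only [massMap]
    ring
  rw [h5]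
  have h6 := abs_add_le (massMap a U R W t - massMap a U R V t) ((U t - U' t) -
      (U (entryTime a V (label a V t 1)) - U' (entryTime a V (label a V t 1))))
  have h7 := abs_sub (U t - U' t)
      (U (entryTime a V (label a V t 1)) - U' (entryTime a V (label a V t 1)))
  linarith

/-- The mass equation is of Volterra type, so that an iterate of the map is a contraction. -/
lemma exists_massMap_fixed (h : IsSpeed a m Λ K) (hT : 0 ≤ T) (hL : 0 ≤ L) (hB : 0 ≤ B)
    (hU : ∀ s t, |U s - U t| ≤ L * |s - t|) (hR : ∀ s t, |R s - R t| ≤ B * |s - t|) :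
    ∃ W, Continuous W ∧ ∀ t ∈ Icc 0 T, W t = massMap a U R W t := by
  have hUc := continuous_of_abs_sub_le hL hU
  have hRc := continuous_of_abs_sub_le hB hR
  set C := massConst m K T L B with hCdef
  have hC : 0 ≤ C := h.massConst_nonneg hL hB
  let ext : C(Icc 0 T, ℝ) → ℝ → ℝ := fun w => IccExtend hT w
  have hext : ∀ w, Continuous (ext w) := fun w => w.continuous.Icc_extend'
  let f : C(Icc 0 T, ℝ) → C(Icc 0 T, ℝ) := fun w =>
    ⟨fun t => massMap a U R (ext w) t,
      (h.continuous_massMap (hext w) hUc hRc).comp continuous_subtype_val⟩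
  have hextf : ∀ w, ∀ t ∈ Icc 0 T, ext (f w) t = massMap a U R (ext w) t := fun w t ht =>
    IccExtend_of_mem hT _ ht
  -- the Volterra estimate for the iterates
  have hiter : ∀ (w v : C(Icc 0 T, ℝ)) (n : ℕ), ∀ t ∈ Icc 0 T,
      |ext (f^[n] w) t - ext (f^[n] v) t| ≤ (C * t) ^ n / n.factorial * dist w v := by
    intro w v n
    induction n with
    | zero =>
      intro t ht
      simp only [Function.iterate_zero, id, pow_zero, Nat.factorial_zero, Nat.cast_one, div_one,
        one_mul]
      have := ContinuousMap.dist_apply_le_dist (f := w) (g := v) ⟨t, ht⟩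
      rw [Real.dist_eq] at this
      simp only [ext]
      rwa [IccExtend_of_mem hT _ ht, IccExtend_of_mem hT _ ht]
    | succ n ih =>
      intro t ht
      rw [Function.iterate_succ_apply', Function.iterate_succ_apply', hextf _ t ht, hextf _ t ht]
      have hp : Continuous fun s => (C * s) ^ n / n.factorial * dist w v := by fun_prop
      calc _ ≤ C * ∫ s in (0 : ℝ)..t, |ext (f^[n] w) s - ext (f^[n] v) s| :=
            h.abs_massMap_sub_le (hext _) (hext _) hL hB hU hR ht
        _ ≤ C * ∫ s in (0 : ℝ)..t, (C * s) ^ n / n.factorial * dist w v := by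
            gcongr
            exact intervalIntegral.integral_mono_on ht.1
              (((hext _).sub (hext _)).abs.intervalIntegrable _ _) (hp.intervalIntegrable _ _)
              fun s hs => ih s ⟨hs.1, hs.2.trans ht.2⟩
        _ = _ := by
            have h1 : ∀ s, (C * s) ^ n / n.factorial * dist w v =
                (C ^ n / n.factorial * dist w v) * s ^ n := fun s => by
              rw [mul_pow]
              ring
            simp only [h1]
            rw [intervalIntegral.integral_const_mul, integral_pow, Nat.factorial_succ]
            push_cast
            have : ((n : ℝ) + 1) ≠ 0 := by positivity
            have : (n.factorial : ℝ) ≠ 0 := by positivity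
            field_simp
            ring
  obtain ⟨n, hn⟩ := ((FloorSemiring.tendsto_pow_div_factorial_atTop (C * T)).eventually_lt_const
    (show (0 : ℝ) < 1 / 2 by norm_num)).exists
  have hcontr : ContractingWith (1 / 2) f^[n] := by
    refine ⟨by norm_num, LipschitzWith.of_dist_le_mul fun w v => ?_⟩
    rw [ContinuousMap.dist_le (by positivity)]
    intro t
    have h1 := hiter w v n t t.2
    simp only [ext, IccExtend_val] at h1
    rw [Real.dist_eq]
    refine h1.trans (mul_le_mul_of_nonneg_right ?_ dist_nonneg)
    have h0 := t.2.1
    calc (C * t) ^ n / n.factorial ≤ (C * T) ^ n / n.factorial := by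
          gcongr
          exact t.2.2
      _ ≤ _ := by simpa using hn.le
  have hfix := hcontr.isFixedPt_fixedPoint_iterate
  refine ⟨ext (ContractingWith.fixedPoint _ hcontr), hext _, fun t ht => ?_⟩
  rw [← hextf _ t ht, hfix.eq]

end IsSpeed

/-! ### Bounded data and their primitives -/

/-- A Borel representative, with everywhere valid bounds and vanishing off `(0,L)`, of a function in
`LInftyPos L`. -/
structure IsData (L B : ℝ) (f : ℝ → ℝ) : Prop where
  measurable : Measurable f
  nonneg : ∀ x, 0 ≤ f x
  le_bound : ∀ x, f x ≤ B
  eq_zero : ∀ x, x ∉ Ioo 0 L → f x = 0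

lemma exists_isData {L : ℝ} {f : ℝ → ℝ} (hf : f ∈ LInftyPos L) {B : ℝ}
    (hB : (eLpNorm f ⊤ (volume.restrict (Ioo 0 L))).toReal ≤ B) :
    ∃ g, IsData L B g ∧ g =ᵐ[volume.restrict (Ioo 0 L)] f := by
  obtain ⟨hf1, hf2⟩ := hf
  have hB0 : 0 ≤ B := ENNReal.toReal_nonneg.trans hB
  have hfm := hf1.1
  refine ⟨(Ioo 0 L).indicator fun x => max 0 (min B (hfm.mk f x)), ⟨?_, ?_, ?_, ?_⟩, ?_⟩
  · have : Measurable (hfm.mk f) := hfm.stronglyMeasurable_mk.measurable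
    exact (measurable_const.max (measurable_const.min this)).indicator measurableSet_Ioo
  · exact fun x => indicator_nonneg (fun _ _ => le_max_left _ _) x
  · exact fun x => indicator_le' (fun _ _ => max_le hB0 (min_le_left _ _)) (fun _ _ => hB0) x
  · exact fun x hx => indicator_of_notMem hx _
  · have hb : ∀ᵐ x ∂(volume.restrict (Ioo 0 L)), ‖f x‖ₑ ≤ ENNReal.ofReal B := by
      have h1 : eLpNorm f ⊤ (volume.restrict (Ioo 0 L)) ≤ ENNReal.ofReal B :=
        (ENNReal.le_ofReal_iff_toReal_le hf1.2.ne hB0).2 hB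
      rw [eLpNorm_exponent_top] at h1
      filter_upwards [ae_le_eLpNormEssSup (f := f) (μ := volume.restrict (Ioo 0 L))] with x hx
      exact hx.trans h1
    filter_upwards [hfm.ae_eq_mk, hf2, hb, ae_restrict_mem measurableSet_Ioo] with x h1 h2 h3 h4
    rw [indicator_of_mem h4, ← h1]
    have h5 : f x ≤ B := by
      rw [Real.enorm_eq_ofReal h2] at h3
      exact (ENNReal.ofReal_le_ofReal_iff hB0).1 h3
    rw [min_eq_right h5, max_eq_right h2]

namespace IsData

variable {L B : ℝ} {f : ℝ → ℝ}

lemma bound_nonneg (h : IsData L B f) : 0 ≤ B := (h.nonneg 0).trans (h.le_bound 0)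

lemma abs_le (h : IsData L B f) (x : ℝ) : |f x| ≤ B := by
  rw [abs_of_nonneg (h.nonneg x)]
  exact h.le_bound x

lemma intervalIntegrable (h : IsData L B f) (x y : ℝ) : IntervalIntegrable f volume x y :=
  (intervalIntegrable_const (c := B)).mono_fun' h.measurable.aestronglyMeasurable
    (ae_of_all _ fun x => h.abs_le x)

/-- The primitive of a datum is Lipschitz. -/
lemma abs_primitive_sub_le (h : IsData L B f) (s t : ℝ) :
    |(∫ r in (0 : ℝ)..s, f r) - ∫ r in (0 : ℝ)..t, f r| ≤ B * |s - t| := by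
  rw [intervalIntegral.integral_interval_sub_left (h.intervalIntegrable _ _)
    (h.intervalIntegrable _ _)]
  exact intervalIntegral.norm_integral_le_of_norm_le_const (f := f) fun x _ => h.abs_le x

lemma primitive_nonneg (h : IsData L B f) {t : ℝ} (ht : 0 ≤ t) :
    0 ≤ ∫ r in (0 : ℝ)..t, f r :=
  intervalIntegral.integral_nonneg ht fun x _ => h.nonneg x

lemma primitive_mono (h : IsData L B f) {s t : ℝ} (ht : s ≤ t) :
    ∫ r in (0 : ℝ)..s, f r ≤ ∫ r in (0 : ℝ)..t, f r := by
  rw [← sub_nonneg, intervalIntegral.integral_interval_sub_left (h.intervalIntegrable _ _)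
    (h.intervalIntegrable _ _)]
  exact intervalIntegral.integral_nonneg ht fun x _ => h.nonneg x

end IsData

/-- Iterated integrals over a rectangle as integrals over the product. -/
lemma integral_integral_eq_setIntegral_prod {s t : ℝ} (hs : 0 ≤ s) (ht : 0 ≤ t)
    {F : ℝ → ℝ → ℝ} (hF : IntegrableOn (Function.uncurry F) (Ioo 0 s ×ˢ Ioo 0 t)) :
    ∫ x in (0 : ℝ)..s, ∫ y in (0 : ℝ)..t, F x y =
      ∫ q in Ioo 0 s ×ˢ Ioo 0 t, Function.uncurry F q := by
  rw [Measure.volume_eq_prod, setIntegral_prod _ hF, intervalIntegral.integral_of_le hs,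
    integral_Ioc_eq_integral_Ioo]
  congr 1 with x
  rw [intervalIntegral.integral_of_le ht, integral_Ioc_eq_integral_Ioo]
  rfl

/-- Weak solutions only depend on the data up to null sets. -/
lemma IsWeakSolution.congr_data {vel : ℝ → ℝ → ℝ} {T : ℝ} {ρ₀ ρ₀' u u' : ℝ → ℝ}
    {ρ : ℝ → ℝ → ℝ} (h : IsWeakSolution vel T ρ₀ u ρ)
    (hρ : ρ₀ =ᵐ[volume.restrict (Ioo 0 1)] ρ₀') (hu : u =ᵐ[volume.restrict (Ioo 0 T)] u') :
    IsWeakSolution vel T ρ₀' u' ρ := by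
  refine ⟨h.continuous_L1, h.bounded, h.mass_nonneg, fun τ hτ φ h1 h2 h3 => ?_⟩
  refine (congrArg₂ _ (congrArg₂ _ rfl ?_) ?_).trans (h.weak τ hτ φ h1 h2 h3)
  · rw [intervalIntegral.integral_of_le hτ.1, intervalIntegral.integral_of_le hτ.1,
      integral_Ioc_eq_integral_Ioo, integral_Ioc_eq_integral_Ioo]
    refine integral_congr_ae ?_
    filter_upwards [ae_restrict_of_ae_restrict_of_subset (Ioo_subset_Ioo_right hτ.2) hu] with t ht
    rw [ht]
  · rw [intervalIntegral.integral_of_le zero_le_one, intervalIntegral.integral_of_le zero_le_one,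
      integral_Ioc_eq_integral_Ioo, integral_Ioc_eq_integral_Ioo]
    refine integral_congr_ae ?_
    filter_upwards [hρ] with x hx
    rw [hx]

/-! ### Conservation of mass along characteristics -/

/-- A smooth step that is `1` on `(-∞,-1]` and `0` on `[0,∞)`. -/
noncomputable def cutoff (y : ℝ) : ℝ := Real.smoothTransition (-y)

lemma contDiff_cutoff : ContDiff ℝ 1 cutoff :=
  (Real.smoothTransition.contDiff (n := 1)).comp contDiff_neg

lemma cutoff_of_nonneg {y : ℝ} (hy : 0 ≤ y) : cutoff y = 0 :=
  Real.smoothTransition.zero_of_nonpos (by linarith)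

lemma cutoff_of_le {y : ℝ} (hy : y ≤ -1) : cutoff y = 1 :=
  Real.smoothTransition.one_of_one_le (by linarith)

lemma abs_cutoff_le (y : ℝ) : |cutoff y| ≤ 1 := by
  rw [cutoff, abs_of_nonneg (Real.smoothTransition.nonneg _)]
  exact Real.smoothTransition.le_one _

lemma hasDerivAt_cutoff (y : ℝ) : HasDerivAt cutoff (deriv cutoff y) y :=
  (contDiff_cutoff.differentiable one_ne_zero y).hasDerivAt

lemma deriv_cutoff_of_lt_abs {y : ℝ} (hy : 1 < |y|) : deriv cutoff y = 0 := by
  rcases lt_abs.1 hy with h | h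
  · have : cutoff =ᶠ[𝓝 y] fun _ => 0 := by
      filter_upwards [Ioi_mem_nhds (show 0 < y by linarith)] with x hx
      exact cutoff_of_nonneg (le_of_lt hx)
    rw [this.deriv_eq, deriv_const]
  · have : cutoff =ᶠ[𝓝 y] fun _ => 1 := by
      filter_upwards [Iio_mem_nhds (show y < -1 by linarith)] with x hx
      exact cutoff_of_le (le_of_lt hx)
    rw [this.deriv_eq, deriv_const]

lemma exists_abs_deriv_cutoff_mul_le : ∃ C, 0 ≤ C ∧ ∀ y, |deriv cutoff y * y| ≤ C := by
  have hc : Continuous (deriv cutoff) := contDiff_cutoff.continuous_deriv le_rfl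
  obtain ⟨C, hC⟩ := (isCompact_Icc (a := (-1 : ℝ)) (b := 1)).exists_bound_of_continuousOn
    (hc.mul continuous_id).continuousOn
  refine ⟨C, (norm_nonneg _).trans (hC 0 (by simp)), fun y => ?_⟩
  rcases lt_or_ge 1 |y| with hy | hy
  · rw [deriv_cutoff_of_lt_abs hy, zero_mul, abs_zero]
    exact (norm_nonneg _).trans (hC 0 (by simp))
  · exact hC y (_root_.abs_le.1 hy)

lemma tendsto_nat_mul_abs_atTop {y : ℝ} (hy : y ≠ 0) :
    Tendsto (fun n : ℕ => (n : ℝ) * |y|) atTop atTop :=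
  tendsto_natCast_atTop_atTop.atTop_mul_const (abs_pos.2 hy)

lemma tendsto_cutoff_mul (y : ℝ) :
    Tendsto (fun n : ℕ => cutoff (n * y)) atTop (𝓝 ((Iio 0).indicator (fun _ => 1) y)) := by
  rcases lt_or_ge y 0 with hy | hy
  · rw [indicator_of_mem (mem_Iio.2 hy)]
    refine tendsto_const_nhds.congr' ?_
    filter_upwards [(tendsto_nat_mul_abs_atTop hy.ne).eventually_ge_atTop 1] with n hn
    rw [abs_of_neg hy] at hn
    exact (cutoff_of_le (by linarith)).symm
  · rw [indicator_of_notMem (by simpa using hy)]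
    refine tendsto_const_nhds.congr fun n => ?_
    exact (cutoff_of_nonneg (by positivity)).symm

lemma tendsto_deriv_cutoff_mul (y : ℝ) :
    Tendsto (fun n : ℕ => deriv cutoff (n * y) * (n * y)) atTop (𝓝 0) := by
  by_cases hy : y = 0
  · simp [hy]
  · refine tendsto_const_nhds.congr' ?_
    filter_upwards [(tendsto_nat_mul_abs_atTop hy).eventually_gt_atTop 1] with n hn
    rw [deriv_cutoff_of_lt_abs, zero_mul]
    rwa [abs_mul, Nat.abs_cast]

/-- Integration by parts against the weight `τ - t`. -/
lemma integral_mul_sub_eq_integral_primitive {f : ℝ → ℝ} {τ : ℝ}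
    (hf : IntervalIntegrable f volume 0 τ) :
    ∫ t in (0 : ℝ)..τ, f t * (τ - t) = ∫ t in (0 : ℝ)..τ, ∫ s in (0 : ℝ)..t, f s := by
  have h1 : AbsolutelyContinuousOnInterval (fun t => τ - t) 0 τ :=
    ContDiffOn.absolutelyContinuousOnInterval (by fun_prop)
  have h2 := hf.absolutelyContinuousOnInterval_intervalIntegral (c := 0) left_mem_uIcc
  have h3 := h1.integral_mul_deriv_eq_deriv_mul h2
  have h4 : ∀ t, deriv (fun t => τ - t) t = -1 := fun t => by simp
  simp only [h4, sub_self, zero_mul, intervalIntegral.integral_same, mul_zero, neg_mul, one_mul,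
    intervalIntegral.integral_neg, sub_neg_eq_add, zero_add] at h3
  rw [← h3]
  refine intervalIntegral.integral_congr_ae ?_
  filter_upwards [hf.ae_hasDerivAt_integral] with t ht htm
  rw [(ht (uIoc_subset_uIcc htm) 0 left_mem_uIcc).deriv, mul_comm]

/-- A continuous function on `[0,τ]` all of whose integrals from the left end point vanish is `0` at
the right end point, which is the derivative of the integral there. -/
lemma eq_zero_of_integral_eq_zero {q : ℝ → ℝ} {τ : ℝ} (hτ : 0 < τ)
    (hq : ContinuousOn q (Icc 0 τ)) (hint : ∀ σ ∈ Icc 0 τ, ∫ t in (0 : ℝ)..σ, q t = 0) :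
    q τ = 0 := by
  have hmem : Icc 0 τ ∈ 𝓝[≤] τ := Icc_mem_nhdsLE hτ
  have h1 : HasDerivWithinAt (fun σ => ∫ t in (0 : ℝ)..σ, q t) (q τ) (Iic τ) τ := by
    refine intervalIntegral.integral_hasDerivWithinAt_right (t := Iic τ)
      (hq.intervalIntegrable_of_Icc hτ.le) ⟨Icc 0 τ, hmem, ?_⟩
      ((hq τ (right_mem_Icc.2 hτ.le)).mono_of_mem_nhdsWithin hmem)
    exact hq.aestronglyMeasurable measurableSet_Icc
  have h2 : HasDerivWithinAt (fun σ => ∫ t in (0 : ℝ)..σ, q t) 0 (Iic τ) τ := by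
    refine (hasDerivWithinAt_const τ (Iic τ) (0 : ℝ)).congr_of_eventuallyEq ?_
      (hint τ (right_mem_Icc.2 hτ.le))
    filter_upwards [hmem] with σ hσ using hint σ hσ
  exact (uniqueDiffWithinAt_Iic τ).eq_deriv _ h1 h2

/-- The mass of a weak solution to the left of a continuous curve is a continuous function. -/
lemma continuousOn_integral_indicator_Iio {T : ℝ} {ρ : ℝ → ℝ → ℝ}
    (hρ : ContinuousIntoLp 1 T 1 ρ) {ξ : ℝ → ℝ} (hξ : Continuous ξ) :
    ContinuousOn (fun t => ∫ x in Ioo (0 : ℝ) 1, (Iio (ξ t)).indicator (ρ t) x) (Icc 0 T) := by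
  intro t₀ ht₀
  have hint : ∀ t ∈ Icc 0 T, Integrable (ρ t) (volume.restrict (Ioo 0 1)) := fun t ht =>
    memLp_one_iff_integrable.1 (hρ.1 t ht)
  have h1 : Tendsto (fun t => ∫ x in Ioo (0 : ℝ) 1, (Iio (ξ t)).indicator (ρ t₀) x)
      (𝓝[Icc 0 T] t₀) (𝓝 (∫ x in Ioo (0 : ℝ) 1, (Iio (ξ t₀)).indicator (ρ t₀) x)) := by
    refine tendsto_integral_filter_of_dominated_convergence (fun x => |ρ t₀ x|) ?_ ?_
      (hint t₀ ht₀).abs ?_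
    · exact Eventually.of_forall fun t => (hint t₀ ht₀).1.indicator measurableSet_Iio
    · exact Eventually.of_forall fun t => ae_of_all _ fun x => norm_indicator_le_norm_self _ _
    · have hne : ∀ᵐ x ∂(volume.restrict (Ioo (0 : ℝ) 1)), x ≠ ξ t₀ :=
        ae_restrict_of_ae (by simp [ae_iff])
      filter_upwards [hne] with x hx
      have hc : Tendsto ξ (𝓝[Icc 0 T] t₀) (𝓝 (ξ t₀)) := hξ.continuousAt.continuousWithinAt
      refine tendsto_const_nhds.congr' ?_
      rcases lt_or_gt_of_ne hx with h | h
      · filter_upwards [hc.eventually_const_lt h] with t ht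
        rw [indicator_of_mem (mem_Iio.2 h), indicator_of_mem (mem_Iio.2 ht)]
      · filter_upwards [hc.eventually_lt_const h] with t ht
        rw [indicator_of_notMem (by simpa using h.le), indicator_of_notMem (by simpa using ht.le)]
  have h2 : Tendsto
      (fun t => ∫ x in Ioo (0 : ℝ) 1, (Iio (ξ t)).indicator (fun x => ρ t x - ρ t₀ x) x)
      (𝓝[Icc 0 T] t₀) (𝓝 0) := by
    have h3 : Tendsto (fun t => (eLpNorm (fun x => ρ t x - ρ t₀ x) 1
        (volume.restrict (Ioo 0 1))).toReal) (𝓝[Icc 0 T] t₀) (𝓝 (0 : ENNReal).toReal) := by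
      exact (ENNReal.tendsto_toReal ENNReal.zero_ne_top).comp (hρ.2 t₀ ht₀)
    refine squeeze_zero_norm' ?_ h3
    filter_upwards [self_mem_nhdsWithin] with t ht
    have hi : Integrable (fun x => ρ t x - ρ t₀ x) (volume.restrict (Ioo 0 1)) :=
      (hint t ht).sub (hint t₀ ht₀)
    rw [eLpNorm_one_eq_lintegral_enorm, ← integral_norm_eq_lintegral_enorm hi.1]
    refine (norm_integral_le_integral_norm _).trans ?_
    exact integral_mono (hi.indicator measurableSet_Iio).norm hi.norm
      fun x => norm_indicator_le_norm_self _ _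
  have h4 := h1.add h2
  rw [add_zero] at h4
  refine h4.congr' ?_
  filter_upwards [self_mem_nhdsWithin] with t ht
  have hi : Integrable (fun x => ρ t x - ρ t₀ x) (volume.restrict (Ioo 0 1)) :=
    (hint t ht).sub (hint t₀ ht₀)
  rw [← integral_add ((hint t₀ ht₀).indicator measurableSet_Iio) (hi.indicator measurableSet_Iio)]
  congr 1 with x
  by_cases hx : x ∈ Iio (ξ t)
  · simp [indicator_of_mem hx]
  · simp [indicator_of_notMem hx]

namespace IsWeakSolution

variable {vel a : ℝ → ℝ → ℝ} {m Λ K T B L : ℝ} {ρ₀ u W : ℝ → ℝ} {ρ : ℝ → ℝ → ℝ}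

lemma integrableOn (hρ : IsWeakSolution vel T ρ₀ u ρ) :
    IntegrableOn (Function.uncurry ρ) (Ioo 0 T ×ˢ Ioo 0 1) := by
  have : IsFiniteMeasure ((volume : Measure (ℝ × ℝ)).restrict (Ioo 0 T ×ˢ Ioo 0 1)) := by
    refine ⟨?_⟩
    rw [Measure.restrict_apply_univ, Measure.volume_eq_prod, Measure.prod_prod]
    exact ENNReal.mul_lt_top measure_Ioo_lt_top measure_Ioo_lt_top
  exact memLp_one_iff_integrable.1 (hρ.bounded.mono_exponent le_top)

lemma integrable_of_mem (hρ : IsWeakSolution vel T ρ₀ u ρ) {t : ℝ} (ht : t ∈ Icc 0 T) :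
    Integrable (ρ t) (volume.restrict (Ioo 0 1)) :=
  memLp_one_iff_integrable.1 (hρ.continuous_L1.1 t ht)

/-- Testing with `(τ - t) χ(n (x - ξ(t)))`, where `χ` is a smooth step and `ξ` a characteristic, and
letting `n → ∞`: the derivative of the step contributes a term of size `O(1)` that is supported in a
strip of width `O(1/n)`, because the speed is Lipschitz and `ξ` moves with it. -/
lemma integral_mass_left_of_flow (hρ : IsWeakSolution vel T ρ₀ u ρ) (hρ₀ : IsData 1 B ρ₀)
    (hu : IsData T L u) (h : IsSpeed a m Λ K) (hW : Continuous W)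
    (hva : ∀ t ∈ Icc 0 T, ∀ x ∈ Icc (0 : ℝ) 1, vel x (mass ρ t) = a x (W t))
    {τ z : ℝ} (hτ : τ ∈ Icc 0 T) (hz : flow a W τ z ≤ 1) :
    ∫ t in (0 : ℝ)..τ, ∫ x in Ioo (0 : ℝ) 1, (Iio (flow a W t z)).indicator (ρ t) x =
      (∫ t in (0 : ℝ)..τ, (Ioi 0).indicator (fun _ => u t) (flow a W t z) * (τ - t)) +
        τ * ∫ x in (0 : ℝ)..1, (Iio z).indicator ρ₀ x := by
  set ξ : ℝ → ℝ := fun t => flow a W t z with hξ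
  have hξd : ∀ t, HasDerivAt ξ (a (ξ t) (W t)) t := fun t => h.hasDerivAt_flow hW t z
  have hξc : Continuous ξ := h.continuous_flow_left hW z
  have hξC : ContDiff ℝ 1 ξ := by
    refine contDiff_one_iff_deriv.2 ⟨fun t => (hξd t).differentiableAt, ?_⟩
    rw [show deriv ξ = fun t => a (ξ t) (W t) from funext fun t => (hξd t).deriv]
    exact h.continuous_comp hξc hW
  have hk := contDiff_cutoff
  have hkc : Continuous cutoff := hk.continuous
  have hk'c : Continuous (deriv cutoff) := hk.continuous_deriv le_rfl
  obtain ⟨C, hC0, hC⟩ := exists_abs_deriv_cutoff_mul_le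
  -- the action of the transport operator on the test function
  set G : ℕ → ℝ × ℝ → ℝ := fun n q => -cutoff (n * (q.2 - ξ q.1)) +
    (τ - q.1) * (deriv cutoff (n * (q.2 - ξ q.1)) * n * (a q.2 (W q.1) - a (ξ q.1) (W q.1)))
    with hG
  have hGc : ∀ n, Continuous (G n) := fun n => by
    have h1 : Continuous fun q : ℝ × ℝ => a q.2 (W q.1) :=
      h.continuous_comp continuous_snd (hW.comp continuous_fst)
    have h2 : Continuous fun q : ℝ × ℝ => a (ξ q.1) (W q.1) :=
      h.continuous_comp (hξc.comp continuous_fst) (hW.comp continuous_fst)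
    exact Continuous.add (by fun_prop) (Continuous.mul (by fun_prop)
      (Continuous.mul (by fun_prop) (h1.sub h2)))
  have herr : ∀ (n : ℕ) (q : ℝ × ℝ),
      |deriv cutoff (n * (q.2 - ξ q.1)) * n * (a q.2 (W q.1) - a (ξ q.1) (W q.1))| ≤
        K * |deriv cutoff (n * (q.2 - ξ q.1)) * (n * (q.2 - ξ q.1))| := fun n q => by
    rw [abs_mul, abs_mul, abs_mul, abs_mul]
    have := h.lip_left q.2 (ξ q.1) (W q.1)
    calc _ ≤ |deriv cutoff (n * (q.2 - ξ q.1))| * |(n : ℝ)| * (K * |q.2 - ξ q.1|) := by gcongr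
      _ = _ := by ring
  have hGb : ∀ n, ∀ q ∈ Ioo 0 τ ×ˢ Ioo (0 : ℝ) 1, |G n q| ≤ 1 + T * (K * C) := fun n q hq => by
    refine (abs_add_le _ _).trans (add_le_add ?_ ?_)
    · rw [abs_neg]
      exact abs_cutoff_le _
    · rw [abs_mul]
      have h1 : |τ - q.1| ≤ T := by
        rw [abs_of_nonneg (by linarith [hq.1.2])]
        linarith [hq.1.1, hτ.2]
      exact mul_le_mul h1 ((herr n q).trans (mul_le_mul_of_nonneg_left (hC _) h.K_pos.le))
        (abs_nonneg _) (hτ.1.trans hτ.2)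
  have hGlim : ∀ q : ℝ × ℝ, Tendsto (fun n => G n q) atTop
      (𝓝 (-(Iio 0).indicator (fun _ => 1) (q.2 - ξ q.1))) := fun q => by
    have h1 : Tendsto (fun n : ℕ => deriv cutoff (n * (q.2 - ξ q.1)) * n *
        (a q.2 (W q.1) - a (ξ q.1) (W q.1))) atTop (𝓝 0) := by
      refine squeeze_zero_norm (fun n => herr n q) ?_
      simpa using (tendsto_deriv_cutoff_mul (q.2 - ξ q.1)).abs.const_mul K
    simpa using (tendsto_cutoff_mul (q.2 - ξ q.1)).neg.add (h1.const_mul (τ - q.1))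
  have hsub : Ioo 0 τ ×ˢ Ioo (0 : ℝ) 1 ⊆ Ioo 0 T ×ˢ Ioo (0 : ℝ) 1 :=
    prod_mono (Ioo_subset_Ioo_right hτ.2) le_rfl
  have hint : IntegrableOn (Function.uncurry ρ) (Ioo 0 τ ×ˢ Ioo 0 1) :=
    hρ.integrableOn.mono_set hsub
  have hms : MeasurableSet (Ioo 0 τ ×ˢ Ioo (0 : ℝ) 1) := measurableSet_Ioo.prod measurableSet_Ioo
  have hintG : ∀ n, IntegrableOn (fun q => Function.uncurry ρ q * G n q) (Ioo 0 τ ×ˢ Ioo 0 1) :=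
    fun n => hint.mul_bdd (c := 1 + T * (K * C)) (hGc n).aestronglyMeasurable
      ((ae_restrict_mem hms).mono fun q hq => hGb n q hq)
  -- the weak formulation for the test functions
  have hweak : ∀ n : ℕ, (∫ q in Ioo 0 τ ×ˢ Ioo (0 : ℝ) 1, Function.uncurry ρ q * G n q) +
      (∫ t in (0 : ℝ)..τ, u t * ((τ - t) * cutoff (n * (0 - ξ t)))) +
      (∫ x in (0 : ℝ)..1, ρ₀ x * ((τ - 0) * cutoff (n * (x - ξ 0)))) = 0 := by
    intro n
    have hw := hρ.weak τ hτ (fun t x => (τ - t) * cutoff (n * (x - ξ t))) ?_ ?_ ?_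
    · refine (congrArg₂ _ (congrArg₂ _ ?_ rfl) rfl).trans hw
      refine (integral_integral_eq_setIntegral_prod (F := fun t x => ρ t x * G n (t, x)) hτ.1
        zero_le_one (hintG n)).symm.trans ?_
      refine intervalIntegral.integral_congr fun t ht => ?_
      refine intervalIntegral.integral_congr fun x hx => ?_
      rw [uIcc_of_le hτ.1] at ht
      rw [uIcc_of_le zero_le_one] at hx
      congr 1
      have h1 : HasDerivAt (fun s => (τ - s) * cutoff (n * (x - ξ s)))
          (-cutoff (n * (x - ξ t)) + (τ - t) *
            (deriv cutoff (n * (x - ξ t)) * (n * -a (ξ t) (W t)))) t := by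
        have h2 := (hasDerivAt_cutoff (n * (x - ξ t))).comp t
          (((hξd t).const_sub x).const_mul (n : ℝ))
        refine (((hasDerivAt_id t).const_sub τ).mul h2).congr_deriv ?_
        simp
      have h3 : HasDerivAt (fun y => (τ - t) * cutoff (n * (y - ξ t)))
          ((τ - t) * (deriv cutoff (n * (x - ξ t)) * n)) x := by
        have h4 := (hasDerivAt_cutoff (n * (x - ξ t))).comp x
          (((hasDerivAt_id x).sub_const (ξ t)).const_mul (n : ℝ))
        refine (h4.const_mul (τ - t)).congr_deriv ?_
        simp
      rw [h1.deriv, h3.deriv, hva t ⟨ht.1, ht.2.trans hτ.2⟩ x hx]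
      simp only [hG]
      ring
    · refine ContDiff.contDiffOn ?_
      have h1 : ContDiff ℝ 1 fun q : ℝ × ℝ => (n : ℝ) * (q.2 - ξ q.1) := by fun_prop
      exact ContDiff.mul (by fun_prop) (hk.comp h1)
    · intro x _
      simp
    · intro t ht
      have h1 : ξ t ≤ 1 := ((h.strictMono_flow_left hW z).monotone ht.2).trans hz
      rw [cutoff_of_nonneg (mul_nonneg n.cast_nonneg (by linarith)), mul_zero]
  -- the limits of the three terms
  have hl1 : Tendsto (fun n => ∫ q in Ioo 0 τ ×ˢ Ioo (0 : ℝ) 1, Function.uncurry ρ q * G n q) atTop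
      (𝓝 (∫ q in Ioo 0 τ ×ˢ Ioo (0 : ℝ) 1,
        Function.uncurry ρ q * -(Iio 0).indicator (fun _ => 1) (q.2 - ξ q.1))) := by
    refine tendsto_integral_of_dominated_convergence
      (fun q => ‖Function.uncurry ρ q‖ * (1 + T * (K * C))) (fun n => (hintG n).1)
      (hint.norm.mul_const _) (fun n => ?_) (ae_of_all _ fun q => (hGlim q).const_mul _)
    filter_upwards [ae_restrict_mem hms] with q hq
    rw [norm_mul]
    exact mul_le_mul_of_nonneg_left (hGb n q hq) (norm_nonneg _)
  have hl2 : Tendsto (fun n : ℕ => ∫ t in (0 : ℝ)..τ, u t * ((τ - t) * cutoff (n * (0 - ξ t))))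
      atTop (𝓝 (∫ t in (0 : ℝ)..τ,
        u t * ((τ - t) * (Iio 0).indicator (fun _ => 1) (0 - ξ t)))) := by
    refine intervalIntegral.tendsto_integral_filter_of_dominated_convergence
      (fun t => ‖u t‖ * ‖τ - t‖) (Eventually.of_forall fun n => ?_)
      (Eventually.of_forall fun n => ae_of_all _ fun t _ => ?_) ?_ (ae_of_all _ fun t _ => ?_)
    · exact (hu.measurable.mul (by fun_prop : Continuous fun t =>
        (τ - t) * cutoff (n * (0 - ξ t))).measurable).aestronglyMeasurable
    · rw [norm_mul, norm_mul, ← mul_assoc]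
      exact mul_le_of_le_one_right (by positivity) (abs_cutoff_le _)
    · exact (hu.intervalIntegrable 0 τ).norm.mul_continuousOn (by fun_prop)
    · exact ((tendsto_cutoff_mul _).const_mul _).const_mul _
  have hl3 : Tendsto (fun n : ℕ => ∫ x in (0 : ℝ)..1,
      ρ₀ x * ((τ - 0) * cutoff (n * (x - ξ 0)))) atTop (𝓝 (∫ x in (0 : ℝ)..1,
        ρ₀ x * ((τ - 0) * (Iio 0).indicator (fun _ => 1) (x - ξ 0)))) := by
    refine intervalIntegral.tendsto_integral_filter_of_dominated_convergence
      (fun x => ‖ρ₀ x‖ * ‖τ - 0‖) (Eventually.of_forall fun n => ?_)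
      (Eventually.of_forall fun n => ae_of_all _ fun t _ => ?_) ?_ (ae_of_all _ fun t _ => ?_)
    · exact (hρ₀.measurable.mul (by fun_prop : Continuous fun x =>
        (τ - 0) * cutoff (n * (x - ξ 0))).measurable).aestronglyMeasurable
    · rw [norm_mul, norm_mul, ← mul_assoc]
      exact mul_le_of_le_one_right (by positivity) (abs_cutoff_le _)
    · exact (hρ₀.intervalIntegrable 0 1).norm.mul_const _
    · exact ((tendsto_cutoff_mul _).const_mul _).const_mul _
  have hsum := tendsto_nhds_unique (((hl1.add hl2).add hl3).congr hweak) tendsto_const_nhds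
  have e1 : (∫ q in Ioo 0 τ ×ˢ Ioo (0 : ℝ) 1,
        Function.uncurry ρ q * -(Iio 0).indicator (fun _ => 1) (q.2 - ξ q.1)) =
      -∫ t in (0 : ℝ)..τ, ∫ x in Ioo (0 : ℝ) 1, (Iio (ξ t)).indicator (ρ t) x := by
    have hi : IntegrableOn (fun q : ℝ × ℝ => Function.uncurry ρ q *
        -(Iio 0).indicator (fun _ => 1) (q.2 - ξ q.1)) (Ioo 0 τ ×ˢ Ioo 0 1) := by
      refine hint.mul_bdd (c := 1) ?_ (ae_of_all _ fun q => ?_)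
      · have h1 : Measurable fun q : ℝ × ℝ => q.2 - ξ q.1 := by
          have : Continuous fun q : ℝ × ℝ => q.2 - ξ q.1 := by fun_prop
          exact this.measurable
        exact ((measurable_const.indicator measurableSet_Iio).comp h1).neg.aestronglyMeasurable
      · rw [norm_neg]
        exact (norm_indicator_le_norm_self _ _).trans (by simp)
    refine (integral_integral_eq_setIntegral_prod (F := fun t x => ρ t x *
        -(Iio 0).indicator (fun _ => 1) (x - ξ t)) hτ.1 zero_le_one hi).symm.trans ?_
    rw [← intervalIntegral.integral_neg]
    refine intervalIntegral.integral_congr fun t _ => ?_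
    rw [intervalIntegral.integral_of_le zero_le_one, integral_Ioc_eq_integral_Ioo, ← integral_neg]
    congr 1 with x
    by_cases hx : x < ξ t
    · rw [indicator_of_mem (show x - ξ t ∈ Iio 0 from sub_neg.2 hx),
        indicator_of_mem (mem_Iio.2 hx)]
      ring
    · rw [indicator_of_notMem (show x - ξ t ∉ Iio 0 by simpa using hx),
        indicator_of_notMem (by simpa using hx)]
      ring
  have e2 : (∫ t in (0 : ℝ)..τ, u t * ((τ - t) * (Iio 0).indicator (fun _ => 1) (0 - ξ t))) =
      ∫ t in (0 : ℝ)..τ, (Ioi 0).indicator (fun _ => u t) (ξ t) * (τ - t) := by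
    refine intervalIntegral.integral_congr fun t _ => ?_
    by_cases hx : 0 < ξ t
    · rw [indicator_of_mem (show 0 - ξ t ∈ Iio 0 by simpa using hx),
        indicator_of_mem (mem_Ioi.2 hx)]
      ring
    · rw [indicator_of_notMem (show 0 - ξ t ∉ Iio 0 by simpa using hx),
        indicator_of_notMem (by simpa using hx)]
      ring
  have e3 : (∫ x in (0 : ℝ)..1, ρ₀ x * ((τ - 0) * (Iio 0).indicator (fun _ => 1) (x - ξ 0))) =
      τ * ∫ x in (0 : ℝ)..1, (Iio z).indicator ρ₀ x := by
    rw [← intervalIntegral.integral_const_mul]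
    refine intervalIntegral.integral_congr fun x _ => ?_
    have h0 : ξ 0 = z := h.flow_zero hW z
    by_cases hx : x < z
    · rw [h0, indicator_of_mem (show x - z ∈ Iio 0 from sub_neg.2 hx),
        indicator_of_mem (mem_Iio.2 hx)]
      ring
    · rw [h0, indicator_of_notMem (show x - z ∉ Iio 0 by simpa using hx),
        indicator_of_notMem (by simpa using hx)]
      ring
  rw [e1, e2, e3] at hsum
  linarith

end IsWeakSolution

/-- The integral over `(0,1)` of a function restricted to the left of `c ≤ 1`. -/
lemma setIntegral_indicator_Iio (f : ℝ → ℝ) {c : ℝ} (hc : c ≤ 1) :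
    ∫ x in Ioo (0 : ℝ) 1, (Iio c).indicator f x = ∫ x in (0 : ℝ)..max c 0, f x := by
  rw [setIntegral_indicator measurableSet_Iio, intervalIntegral.integral_of_le (le_max_right _ _),
    integral_Ioc_eq_integral_Ioo]
  congr 2
  ext x
  simp only [mem_inter_iff, mem_Ioo, mem_Iio, lt_max_iff]
  constructor
  · rintro ⟨⟨h1, -⟩, h3⟩
    exact ⟨h1, Or.inl h3⟩
  · rintro ⟨h1, h2 | h2⟩
    · exact ⟨⟨h1, by linarith⟩, h2⟩
    · linarith

namespace IsWeakSolution

variable {vel a : ℝ → ℝ → ℝ} {m Λ K T B L : ℝ} {ρ₀ u W : ℝ → ℝ} {ρ : ℝ → ℝ → ℝ}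

lemma measurable_indicator_flow (hu : IsData T L u) (h : IsSpeed a m Λ K) (hW : Continuous W)
    (z : ℝ) : Measurable fun t => (Ioi 0).indicator (fun _ => u t) (flow a W t z) := by
  have h1 : MeasurableSet {t | 0 < flow a W t z} :=
    measurableSet_lt measurable_const (h.continuous_flow_left hW z).measurable
  exact hu.measurable.indicator h1

/-- The mass of a weak solution to the left of a characteristic is the initial mass to the left of
its label plus the in-flux after its entry time. -/
lemma integral_left_of_flow (hρ : IsWeakSolution vel T ρ₀ u ρ) (hρ₀ : IsData 1 B ρ₀)
    (hu : IsData T L u) (h : IsSpeed a m Λ K) (hW : Continuous W)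
    (hva : ∀ t ∈ Icc 0 T, ∀ x ∈ Icc (0 : ℝ) 1, vel x (mass ρ t) = a x (W t))
    {τ z : ℝ} (hτ0 : 0 < τ) (hτ : τ ≤ T) (hz : flow a W τ z ≤ 1) :
    ∫ x in Ioo (0 : ℝ) 1, (Iio (flow a W τ z)).indicator (ρ τ) x =
      (∫ t in (0 : ℝ)..τ, (Ioi 0).indicator (fun _ => u t) (flow a W t z)) +
        ∫ x in (0 : ℝ)..1, (Iio z).indicator ρ₀ x := by
  set f : ℝ → ℝ := fun t => (Ioi 0).indicator (fun _ => u t) (flow a W t z) with hf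
  have hfi : ∀ s t, IntervalIntegrable f volume s t := fun s t =>
    (intervalIntegrable_const (c := L)).mono_fun'
      (measurable_indicator_flow hu h hW z).aestronglyMeasurable
      (ae_of_all _ fun x => (norm_indicator_le_norm_self _ _).trans (hu.abs_le x))
  have hm := continuousOn_integral_indicator_Iio hρ.continuous_L1 (h.continuous_flow_left hW z)
  have hm' := hm.mono (Icc_subset_Icc_right hτ)
  have hp : Continuous fun t => ∫ s in (0 : ℝ)..t, f s :=
    intervalIntegral.continuous_primitive hfi 0
  have key := eq_zero_of_integral_eq_zero (q := fun t =>
    (∫ x in Ioo (0 : ℝ) 1, (Iio (flow a W t z)).indicator (ρ t) x) -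
      ((∫ s in (0 : ℝ)..t, f s) + ∫ x in (0 : ℝ)..1, (Iio z).indicator ρ₀ x)) hτ0
    (hm'.sub (hp.add continuous_const).continuousOn) fun σ hσ => ?_
  · linarith
  · have hσT : σ ∈ Icc 0 T := ⟨hσ.1, hσ.2.trans hτ⟩
    have hzσ : flow a W σ z ≤ 1 := ((h.strictMono_flow_left hW z).monotone hσ.2).trans hz
    rw [intervalIntegral.integral_sub, intervalIntegral.integral_add,
      hρ.integral_mass_left_of_flow hρ₀ hu h hW hva hσT hzσ,
      integral_mul_sub_eq_integral_primitive (hfi 0 σ), intervalIntegral.integral_const,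
      sub_zero, smul_eq_mul, sub_self]
    · exact hp.intervalIntegrable _ _
    · exact intervalIntegrable_const
    · exact (hm.mono (Icc_subset_Icc_right hσT.2)).intervalIntegrable_of_Icc hσ.1
    · exact (hp.add continuous_const).intervalIntegrable _ _

/-- The distribution function of a weak solution is determined by its mass: the flow driven by the
mass transports the distribution function of the data. -/
lemma integral_eq (hρ : IsWeakSolution vel T ρ₀ u ρ) (hρ₀ : IsData 1 B ρ₀)
    (hu : IsData T L u) (h : IsSpeed a m Λ K) (hW : Continuous W)
    (hva : ∀ t ∈ Icc 0 T, ∀ x ∈ Icc (0 : ℝ) 1, vel x (mass ρ t) = a x (W t))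
    {τ x : ℝ} (hτ0 : 0 < τ) (hτ : τ ≤ T) (hx : x ∈ Icc (0 : ℝ) 1) :
    ∫ y in (0 : ℝ)..x, ρ τ y =
      (∫ s in (0 : ℝ)..τ, u s) - (∫ s in (0 : ℝ)..entryTime a W (label a W τ x), u s) +
        ∫ y in (0 : ℝ)..max (label a W τ x) 0, ρ₀ y := by
  set z := label a W τ x with hz
  have hfz : flow a W τ z = x := h.flow_label hW τ x
  have hzx : z ≤ x := by
    have := (h.strictMono_flow_left hW z).monotone hτ0.le
    simp only [h.flow_zero hW, hfz] at this
    exact this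
  have h1 := hρ.integral_left_of_flow hρ₀ hu h hW hva hτ0 hτ (hfz.le.trans hx.2)
  rw [hfz, setIntegral_indicator_Iio _ hx.2, max_eq_left hx.1,
    intervalIntegral.integral_of_le zero_le_one, integral_Ioc_eq_integral_Ioo,
    setIntegral_indicator_Iio _ (hzx.trans hx.2)] at h1
  rw [h1]
  congr 1
  have hS := h.entryTime_label_one_mem hW hx.1 hτ0.le
  rw [intervalIntegral.integral_interval_sub_left (hu.intervalIntegrable _ _)
    (hu.intervalIntegrable _ _), intervalIntegral.integral_of_le hτ0.le,
    intervalIntegral.integral_of_le hS.2]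
  have h2 : ∀ t ∈ Ioc 0 τ, (Ioi 0).indicator (fun _ => u t) (flow a W t z) =
      (Ioi (entryTime a W z)).indicator u t := fun t ht => by
    by_cases hp : 0 < flow a W t z
    · rw [indicator_of_mem (mem_Ioi.2 hp),
        indicator_of_mem (mem_Ioi.2 ((h.entryTime_lt_iff hW ht.1).2 hp))]
    · rw [indicator_of_notMem (by simpa using hp), indicator_of_notMem]
      exact fun hm => hp ((h.entryTime_lt_iff hW ht.1).1 hm)
  rw [setIntegral_congr_fun measurableSet_Ioc h2, setIntegral_indicator measurableSet_Ioi]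
  congr 2
  ext t
  simp only [mem_inter_iff, mem_Ioc, mem_Ioi]
  exact ⟨fun h => ⟨h.2, h.1.2⟩, fun h => ⟨⟨hS.1.trans_lt h.1, h.2⟩, h.1⟩⟩

lemma continuousOn_mass {ρ : ℝ → ℝ → ℝ} (hρ : ContinuousIntoLp 1 T 1 ρ) :
    ContinuousOn (mass ρ) (Icc 0 T) := by
  refine (continuousOn_integral_indicator_Iio hρ (continuous_const (y := (1 : ℝ)))).congr
    fun t _ => ?_
  simp only
  rw [setIntegral_indicator_Iio _ le_rfl, max_eq_left zero_le_one, mass]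

/-- The mass of a weak solution solves the fixed point equation. -/
lemma mass_eq_massMap (hρ : IsWeakSolution vel T ρ₀ u ρ) (hρ₀ : IsData 1 B ρ₀)
    (hu : IsData T L u) (h : IsSpeed a m Λ K) (hW : Continuous W) (hT : 0 < T)
    (hva : ∀ t ∈ Icc 0 T, ∀ x ∈ Icc (0 : ℝ) 1, vel x (mass ρ t) = a x (W t))
    {t : ℝ} (ht : t ∈ Icc 0 T) :
    mass ρ t = massMap a (fun t => ∫ s in (0 : ℝ)..t, u s) (fun x => ∫ y in (0 : ℝ)..x, ρ₀ y)
      W t := by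
  have hc := h.continuous_massMap hW (continuous_of_abs_sub_le hu.bound_nonneg
    hu.abs_primitive_sub_le) (continuous_of_abs_sub_le hρ₀.bound_nonneg hρ₀.abs_primitive_sub_le)
  have h1 : EqOn (mass ρ) (massMap a (fun t => ∫ s in (0 : ℝ)..t, u s)
      (fun x => ∫ y in (0 : ℝ)..x, ρ₀ y) W) (Ioc 0 T) := fun t ht =>
    hρ.integral_eq hρ₀ hu h hW hva ht.1 ht.2 (right_mem_Icc.2 zero_le_one)
  refine h1.of_subset_closure (continuousOn_mass hρ.continuous_L1) hc.continuousOn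
    Ioc_subset_Icc_self ?_ ht
  rw [closure_Ioc hT.ne]

/-! ### Uniqueness -/

/-- Two integrable functions on `(0,1)` with the same distribution function agree. -/
lemma _root_.ae_eq_of_forall_integral_eq {f g : ℝ → ℝ}
    (hf : Integrable f (volume.restrict (Ioo 0 1))) (hg : Integrable g (volume.restrict (Ioo 0 1)))
    (hfg : ∀ x ∈ Icc (0 : ℝ) 1, ∫ y in (0 : ℝ)..x, f y = ∫ y in (0 : ℝ)..x, g y) :
    f =ᵐ[volume.restrict (Ioo 0 1)] g := by
  have hii : ∀ {k : ℝ → ℝ}, Integrable k (volume.restrict (Ioo 0 1)) →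
      IntervalIntegrable k volume 0 1 := fun hk =>
    (intervalIntegrable_iff_integrableOn_Ioo_of_le zero_le_one).2 hk
  have h1 := (hii hf).ae_hasDerivAt_integral
  have h2 := (hii hg).ae_hasDerivAt_integral
  rw [Filter.EventuallyEq, ae_restrict_iff' measurableSet_Ioo]
  filter_upwards [h1, h2] with x hx1 hx2 hx
  have hxu : x ∈ uIcc (0 : ℝ) 1 := by
    rw [uIcc_of_le zero_le_one]
    exact Ioo_subset_Icc_self hx
  have h3 : (fun x => ∫ y in (0 : ℝ)..x, f y) =ᶠ[𝓝 x] fun x => ∫ y in (0 : ℝ)..x, g y := by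
    filter_upwards [Icc_mem_nhds hx.1 hx.2] with y hy using hfg y hy
  exact ((hx1 hxu 0 left_mem_uIcc).congr_of_eventuallyEq h3.symm).unique (hx2 hxu 0 left_mem_uIcc)

/-- Two curves in `L¹(0,1)` that agree for `t > 0` also agree at `t = 0`. -/
lemma _root_.NonlocalConservationLaw.ContinuousIntoLp.ae_eq_zero {ρ ρ' : ℝ → ℝ → ℝ} (hT : 0 < T)
    (hρ : ContinuousIntoLp 1 T 1 ρ) (hρ' : ContinuousIntoLp 1 T 1 ρ')
    (heq : ∀ t ∈ Ioc 0 T, ρ' t =ᵐ[volume.restrict (Ioo 0 1)] ρ t) :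
    ρ' 0 =ᵐ[volume.restrict (Ioo 0 1)] ρ 0 := by
  have h0 : (0 : ℝ) ∈ Icc 0 T := left_mem_Icc.2 hT.le
  have hsub : 𝓝[Ioc 0 T] (0 : ℝ) ≤ 𝓝[Icc 0 T] 0 := nhdsWithin_mono _ Ioc_subset_Icc_self
  have hne : (𝓝[Ioc 0 T] (0 : ℝ)).NeBot := by
    rw [← mem_closure_iff_nhdsWithin_neBot, closure_Ioc hT.ne]
    exact h0
  have hlim := ((hρ.2 0 h0).mono_left hsub).add ((hρ'.2 0 h0).mono_left hsub)
  rw [add_zero] at hlim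
  have hle : eLpNorm (fun x => ρ' 0 x - ρ 0 x) 1 (volume.restrict (Ioo 0 1)) ≤ 0 := by
    refine ge_of_tendsto hlim ?_
    filter_upwards [self_mem_nhdsWithin] with t ht
    have hm1 := ((hρ.1 t (Ioc_subset_Icc_self ht)).sub (hρ.1 0 h0)).1
    have hm2 := ((hρ'.1 t (Ioc_subset_Icc_self ht)).sub (hρ'.1 0 h0)).1
    have h1 : eLpNorm (fun x => ρ' 0 x - ρ 0 x) 1 (volume.restrict (Ioo 0 1)) =
        eLpNorm ((ρ t - ρ 0) - (ρ' t - ρ' 0)) 1 (volume.restrict (Ioo 0 1)) := by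
      refine eLpNorm_congr_ae ?_
      filter_upwards [heq t ht] with x hx
      simp only [Pi.sub_apply, hx]
      ring
    rw [h1]
    exact eLpNorm_sub_le hm1 hm2 le_rfl
  have h2 := (eLpNorm_eq_zero_iff ((hρ'.1 0 h0).sub (hρ.1 0 h0)).1 one_ne_zero).1
    (le_antisymm hle zero_le)
  filter_upwards [h2] with x hx
  simpa [sub_eq_zero] using hx

/-- Weak solutions are unique: their masses solve the same Volterra equation, and the mass
determines the characteristics and thereby the solution. -/
lemma unique (hvel : ContDiffOn ℝ 1 (Function.uncurry vel) (Icc 0 1 ×ˢ Ici 0))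
    (hpos : ∀ x ∈ Icc (0 : ℝ) 1, ∀ W ∈ Ici (0 : ℝ), 0 < vel x W) (hT : 0 < T)
    (hρ₀ : IsData 1 B ρ₀) (hu : IsData T L u) {ρ' : ℝ → ℝ → ℝ}
    (hρ : IsWeakSolution vel T ρ₀ u ρ) (hρ' : IsWeakSolution vel T ρ₀ u ρ') :
    ∀ t ∈ Icc 0 T, ρ' t =ᵐ[volume.restrict (Ioo 0 1)] ρ t := by
  have hc := continuousOn_mass hρ.continuous_L1
  have hc' := continuousOn_mass hρ'.continuous_L1
  obtain ⟨M, hM⟩ := isCompact_Icc.exists_bound_of_continuousOn hc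
  obtain ⟨M', hM'⟩ := isCompact_Icc.exists_bound_of_continuousOn hc'
  have h0 : (0 : ℝ) ∈ Icc 0 T := left_mem_Icc.2 hT.le
  have hMM : 0 ≤ max M M' := le_max_of_le_left ((norm_nonneg _).trans (hM 0 h0))
  obtain ⟨m, Λ, K, h⟩ := exists_isSpeed_clampSpeed hvel hpos hMM
  set W : ℝ → ℝ := IccExtend hT.le (domRestrict (Icc 0 T) (mass ρ)) with hWdef
  set W' : ℝ → ℝ := IccExtend hT.le (domRestrict (Icc 0 T) (mass ρ')) with hWdef'
  have hW : Continuous W := hc.domRestrict.Icc_extend'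
  have hW' : Continuous W' := hc'.domRestrict.Icc_extend'
  have hWt : ∀ t ∈ Icc 0 T, W t = mass ρ t := fun t ht => IccExtend_of_mem hT.le _ ht
  have hWt' : ∀ t ∈ Icc 0 T, W' t = mass ρ' t := fun t ht => IccExtend_of_mem hT.le _ ht
  have hva : ∀ t ∈ Icc 0 T, ∀ x ∈ Icc (0 : ℝ) 1,
      vel x (mass ρ t) = clampSpeed vel (max M M') x (W t) := fun t ht x hx => by
    rw [hWt t ht, clampSpeed_of_mem vel hx ⟨hρ.mass_nonneg t ht,
      (le_of_abs_le (hM t ht)).trans (le_max_left _ _)⟩]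
  have hva' : ∀ t ∈ Icc 0 T, ∀ x ∈ Icc (0 : ℝ) 1,
      vel x (mass ρ' t) = clampSpeed vel (max M M') x (W' t) := fun t ht x hx => by
    rw [hWt' t ht, clampSpeed_of_mem vel hx ⟨hρ'.mass_nonneg t ht,
      (le_of_abs_le (hM' t ht)).trans (le_max_right _ _)⟩]
  have hWW : ∀ t ∈ Icc 0 T, |W' t - W t| ≤ 0 := fun t ht => by
    have := h.abs_sub_le_of_massMap_fixed hW' hW hu.bound_nonneg hρ₀.bound_nonneg (ε := 0)
      hu.abs_primitive_sub_le hρ₀.abs_primitive_sub_le (U' := fun t => ∫ s in (0 : ℝ)..t, u s)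
      (fun t _ => by simp)
      (fun t ht => by rw [hWt' t ht]; exact hρ'.mass_eq_massMap hρ₀ hu h hW' hT hva' ht)
      (fun t ht => by rw [hWt t ht]; exact hρ.mass_eq_massMap hρ₀ hu h hW hT hva ht) t ht
    simpa using this
  have hva'' : ∀ t ∈ Icc 0 T, ∀ x ∈ Icc (0 : ℝ) 1,
      vel x (mass ρ' t) = clampSpeed vel (max M M') x (W t) := fun t ht x hx => by
    rw [hva' t ht x hx, sub_eq_zero.1 (abs_nonpos_iff.1 (hWW t ht))]
  have hpos : ∀ t ∈ Ioc 0 T, ρ' t =ᵐ[volume.restrict (Ioo 0 1)] ρ t := fun t ht => by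
    refine ae_eq_of_forall_integral_eq (hρ'.integrable_of_mem (Ioc_subset_Icc_self ht))
      (hρ.integrable_of_mem (Ioc_subset_Icc_self ht)) fun x hx => ?_
    rw [hρ'.integral_eq hρ₀ hu h hW hva'' ht.1 ht.2 hx,
      hρ.integral_eq hρ₀ hu h hW hva ht.1 ht.2 hx]
  intro t ht
  rcases ht.1.eq_or_lt with rfl | h1
  · exact ContinuousIntoLp.ae_eq_zero hT hρ.continuous_L1 hρ'.continuous_L1 hpos
  · exact hpos t ⟨h1, ht.2⟩

end IsWeakSolution

/-! ### Continuity in `L^p` of families of compositions -/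

/-- A map that contracts distances on `I` by at most the factor `c` pushes Lebesgue measure on `I`
forward to a measure that is at most `c` times Lebesgue measure. -/
lemma map_restrict_le_smul {Z : ℝ → ℝ} (hZ : Continuous Z) {I : Set ℝ} {c : ℝ} (hc : 0 ≤ c)
    (hI : MeasurableSet I) (hanti : ∀ x ∈ I, ∀ y ∈ I, |x - y| ≤ c * |Z x - Z y|) :
    (volume.restrict I).map Z ≤ ENNReal.ofReal c • (volume : Measure ℝ) := by
  refine Measure.le_iff.2 fun s hs => ?_
  rw [Measure.map_apply hZ.measurable hs, Measure.restrict_apply (hZ.measurable hs),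
    Measure.smul_apply, smul_eq_mul]
  have hinj : InjOn Z I := fun x hx y hy he => by
    have := hanti x hx y hy
    rw [he, sub_self, abs_zero, mul_zero] at this
    exact sub_eq_zero.1 (abs_nonpos_iff.1 this)
  rcases I.eq_empty_or_nonempty with rfl | hne
  · simp
  have hinv : ∀ x ∈ I, Function.invFunOn Z I (Z x) = x := fun x hx => hinj.leftInvOn_invFunOn hx
  have hlip : LipschitzOnWith c.toNNReal (Function.invFunOn Z I) (Z '' (Z ⁻¹' s ∩ I)) := by
    refine LipschitzOnWith.of_dist_le_mul ?_
    rintro _ ⟨x, hx, rfl⟩ _ ⟨y, hy, rfl⟩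
    rw [hinv x hx.2, hinv y hy.2, Real.coe_toNNReal _ hc]
    exact hanti x hx.2 y hy.2
  have h1 := hlip.hausdorffMeasure_image_le (d := 1) zero_le_one
  rw [hausdorffMeasure_real] at h1
  have h2 : Function.invFunOn Z I '' (Z '' (Z ⁻¹' s ∩ I)) = Z ⁻¹' s ∩ I := by
    rw [image_image]
    ext x
    constructor
    · rintro ⟨y, hy, rfl⟩
      simpa only [hinv y hy.2] using hy
    · exact fun hx => ⟨x, hx, hinv x hx.2⟩
  rw [h2] at h1
  simp only [ENNReal.rpow_one] at h1
  refine h1.trans (mul_le_mul_right (measure_mono ?_) _)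
  rintro _ ⟨x, hx, rfl⟩
  exact hx.1

lemma eLpNorm_comp_le {Z f : ℝ → ℝ} (hZ : Continuous Z) {I : Set ℝ} {c : ℝ} (hc : 0 ≤ c)
    (hI : MeasurableSet I) (hanti : ∀ x ∈ I, ∀ y ∈ I, |x - y| ≤ c * |Z x - Z y|)
    (hf : Measurable f) {p : ENNReal} (hp : p ≠ ⊤) :
    eLpNorm (fun x => f (Z x)) p (volume.restrict I) ≤
      ENNReal.ofReal c ^ (1 / p).toReal * eLpNorm f p volume := by
  have h1 := eLpNorm_map_measure (μ := volume.restrict I) (p := p) (g := f) (f := Z)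
    hf.aestronglyMeasurable hZ.aemeasurable
  rw [Function.comp_def] at h1
  rw [← h1]
  refine (eLpNorm_mono_measure f (map_restrict_le_smul hZ hc hI hanti)).trans (le_of_eq ?_)
  rw [eLpNorm_smul_measure_of_ne_top hp, smul_eq_mul]

/-- Continuous functions of two variables give continuous curves in `L^p`. -/
lemma tendsto_eLpNorm_sub_of_continuous {k : ℝ → ℝ → ℝ} (hk : Continuous (Function.uncurry k))
    (a₀ B : ℝ) {p : ENNReal} :
    Tendsto (fun a => eLpNorm (fun b => k a b - k a₀ b) p (volume.restrict (Ioo 0 B)))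
      (𝓝 a₀) (𝓝 0) := by
  refine ENNReal.tendsto_nhds_zero.2 fun ε hε => ?_
  set V := (volume.restrict (Ioo 0 B)) univ ^ p.toReal⁻¹ with hV
  have hVtop : V ≠ ⊤ := ENNReal.rpow_ne_top_of_nonneg (by positivity) (measure_ne_top _ _)
  obtain ⟨η, hη0, hη⟩ : ∃ η : ℝ, 0 < η ∧ V * ENNReal.ofReal η ≤ ε := by
    have h1 : Tendsto (fun η : ℝ => V * ENNReal.ofReal η) (𝓝[>] 0) (𝓝 (V * ENNReal.ofReal 0)) :=
      ENNReal.Tendsto.const_mul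
        ((ENNReal.continuous_ofReal.tendsto 0).mono_left nhdsWithin_le_nhds) (Or.inr hVtop)
    rw [ENNReal.ofReal_zero, mul_zero] at h1
    obtain ⟨η, h2, h3⟩ := ((h1.eventually (Iic_mem_nhds hε)).and self_mem_nhdsWithin).exists
    exact ⟨η, h3, h2⟩
  have hev : ∀ᶠ a in 𝓝 a₀, ∀ b ∈ Icc 0 B, |k a b - k a₀ b| < η := by
    refine isCompact_Icc.eventually_forall_of_forall_eventually
      (P := fun a b => |k a b - k a₀ b| < η) fun b _ => ?_
    have h1 : Continuous fun q : ℝ × ℝ => |k q.1 q.2 - k a₀ q.2| :=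
      (hk.sub (hk.comp (continuous_const.prodMk continuous_snd))).abs
    have h2 := h1.tendsto (a₀, b)
    simp only [sub_self, abs_zero] at h2
    exact h2.eventually (Iio_mem_nhds hη0)
  filter_upwards [hev] with a ha
  refine (eLpNorm_le_of_ae_bound (C := η) ?_).trans hη
  filter_upwards [ae_restrict_mem measurableSet_Ioo] with b hb
  exact (ha b (Ioo_subset_Icc_self hb)).le

/-- If the maps `Zf a` expand distances uniformly, then `a ↦ (g ∘ Zf a) J a` is a continuous curve
in `L^p(0,B)` for every `g ∈ L^p`: approximate `g` by continuous functions. -/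
lemma continuousIntoLp_comp_mul {Zf J : ℝ → ℝ → ℝ} (hZf : Continuous (Function.uncurry Zf))
    (hJ : Continuous (Function.uncurry J)) {A B c : ℝ} (hc : 0 ≤ c)
    (hanti : ∀ a ∈ Icc 0 A, ∀ b ∈ Icc 0 B, ∀ b' ∈ Icc 0 B, |b - b'| ≤ c * |Zf a b - Zf a b'|)
    {g : ℝ → ℝ} (hg : Measurable g) {p : ENNReal} (hp : 1 ≤ p) (hp' : p ≠ ⊤)
    (hgp : MemLp g p volume) :
    ContinuousIntoLp p A B fun a b => g (Zf a b) * J a b := by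
  obtain ⟨CJ, hCJ⟩ := ((isCompact_Icc (a := (0 : ℝ)) (b := A)).prod
    (isCompact_Icc (a := (0 : ℝ)) (b := B))).exists_bound_of_continuousOn hJ.continuousOn
  have hZa : ∀ a, Continuous (Zf a) := fun a => hZf.comp (continuous_const.prodMk continuous_id)
  have hJa : ∀ a, Continuous (J a) := fun a => hJ.comp (continuous_const.prodMk continuous_id)
  set D : ENNReal := ENNReal.ofReal CJ * ENNReal.ofReal c ^ (1 / p).toReal with hD
  have hDtop : D ≠ ⊤ := ENNReal.mul_ne_top ENNReal.ofReal_ne_top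
    (ENNReal.rpow_ne_top_of_nonneg ENNReal.toReal_nonneg ENNReal.ofReal_ne_top)
  have hcomp : ∀ a ∈ Icc 0 A, ∀ f : ℝ → ℝ, Measurable f →
      eLpNorm (fun b => f (Zf a b) * J a b) p (volume.restrict (Ioo 0 B)) ≤
        D * eLpNorm f p volume := fun a ha f hf => by
    have h1 : ∀ᵐ b ∂(volume.restrict (Ioo 0 B)), ‖f (Zf a b) * J a b‖ ≤ CJ * ‖f (Zf a b)‖ := by
      filter_upwards [ae_restrict_mem measurableSet_Ioo] with b hb
      rw [norm_mul, mul_comm]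
      exact mul_le_mul_of_nonneg_right (hCJ (a, b) ⟨ha, Ioo_subset_Icc_self hb⟩) (norm_nonneg _)
    refine (eLpNorm_le_mul_eLpNorm_of_ae_le_mul h1 p).trans ?_
    rw [hD, mul_assoc]
    exact mul_le_mul_right (eLpNorm_comp_le (hZa a) hc measurableSet_Ioo (fun x hx y hy =>
      hanti a ha x (Ioo_subset_Icc_self hx) y (Ioo_subset_Icc_self hy)) hf hp') _
  refine ⟨fun a ha => ⟨?_, ?_⟩, fun a₀ ha₀ => ?_⟩
  · exact ((hg.comp (hZa a).measurable).mul (hJa a).measurable).aestronglyMeasurable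
  · exact (hcomp a ha g hg).trans_lt (ENNReal.mul_lt_top hDtop.lt_top hgp.2)
  refine ENNReal.tendsto_nhds_zero.2 fun ε hε => ?_
  rcases eq_or_ne ε ⊤ with rfl | hεtop
  · exact Eventually.of_forall fun _ => le_top
  have h3 : ε / 3 ≠ 0 := (ENNReal.div_pos hε.ne' (by norm_num)).ne'
  have hD1 : D + 1 ≠ ⊤ := ENNReal.add_ne_top.2 ⟨hDtop, ENNReal.one_ne_top⟩
  obtain ⟨f, -, hf, hfc, -⟩ := hgp.exists_hasCompactSupport_eLpNorm_sub_le hp'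
    (ε := ε / 3 / (D + 1)) (ENNReal.div_pos h3 hD1).ne'
  have hsmall : ∀ a ∈ Icc 0 A, eLpNorm (fun b => (g - f) (Zf a b) * J a b) p
      (volume.restrict (Ioo 0 B)) ≤ ε / 3 := fun a ha => by
    refine (hcomp a ha (g - f) (hg.sub hfc.measurable)).trans ?_
    calc D * eLpNorm (g - f) p volume ≤ (D + 1) * (ε / 3 / (D + 1)) :=
          mul_le_mul' le_self_add hf
      _ = ε / 3 := ENNReal.mul_div_cancel (by simp) hD1
  have hk := (tendsto_eLpNorm_sub_of_continuous (k := fun a b => f (Zf a b) * J a b)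
    (p := p) ((hfc.comp hZf).mul hJ) a₀ B).mono_left (nhdsWithin_le_nhds (s := Icc 0 A))
  filter_upwards [hk.eventually (Iic_mem_nhds (pos_iff_ne_zero.2 h3)), self_mem_nhdsWithin]
    with a ha haA
  have hm : ∀ a, AEStronglyMeasurable (fun b => (g - f) (Zf a b) * J a b)
      (volume.restrict (Ioo 0 B)) := fun a =>
    (((hg.sub hfc.measurable).comp (hZa a).measurable).mul
      (hJa a).measurable).aestronglyMeasurable
  have hm' : AEStronglyMeasurable (fun b => f (Zf a b) * J a b - f (Zf a₀ b) * J a₀ b)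
      (volume.restrict (Ioo 0 B)) :=
    (((hfc.comp (hZa a)).mul (hJa a)).sub
      ((hfc.comp (hZa a₀)).mul (hJa a₀))).aestronglyMeasurable
  have hsplit : (fun b => g (Zf a b) * J a b - g (Zf a₀ b) * J a₀ b) =
      ((fun b => (g - f) (Zf a b) * J a b) + fun b => f (Zf a b) * J a b - f (Zf a₀ b) * J a₀ b) -
        fun b => (g - f) (Zf a₀ b) * J a₀ b := by
    ext b
    simp only [Pi.sub_apply, Pi.add_apply]
    ring
  rw [hsplit]
  calc _ ≤ _ := eLpNorm_sub_le ((hm a).add hm') (hm a₀) hp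
    _ ≤ (ε / 3 + ε / 3) + ε / 3 := add_le_add ((eLpNorm_add_le (hm a) hm' hp).trans
        (add_le_add (hsmall a haA) ha)) (hsmall a₀ ha₀)
    _ = ε := ENNReal.add_thirds ε

/-! ### The solution transported by a given mass -/

/-- The density of the data in label coordinates: the initial density for positive labels, and the
density of the in-flux, changed from entry time to label, for the other ones. -/
noncomputable def labelDensity (a : ℝ → ℝ → ℝ) (ρ₀ u W : ℝ → ℝ) (z : ℝ) : ℝ :=
  if 0 < z then ρ₀ z else u (entryTime a W z) * (a 0 (W (entryTime a W z)))⁻¹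

/-- The density at time `t` of the push-forward of `labelDensity` under the flow. -/
noncomputable def transported (a : ℝ → ℝ → ℝ) (ρ₀ u W : ℝ → ℝ) (t x : ℝ) : ℝ :=
  labelDensity a ρ₀ u W (label a W t x) * (flowDeriv a W t (label a W t x))⁻¹

namespace IsSpeed

variable {a : ℝ → ℝ → ℝ} {m Λ K T B L : ℝ} {ρ₀ u W : ℝ → ℝ}

lemma measurable_labelDensity (h : IsSpeed a m Λ K) (hW : Continuous W) (hρ₀ : IsData 1 B ρ₀)
    (hu : IsData T L u) : Measurable (labelDensity a ρ₀ u W) := by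
  have hS := h.continuous_entryTime hW
  refine Measurable.ite (measurableSet_lt measurable_const measurable_id) hρ₀.measurable ?_
  exact (hu.measurable.comp hS.measurable).mul
    (h.continuous_comp continuous_const (hW.comp hS)).measurable.inv

lemma labelDensity_nonneg (h : IsSpeed a m Λ K) (hρ₀ : IsData 1 B ρ₀) (hu : IsData T L u) (z : ℝ) :
    0 ≤ labelDensity a ρ₀ u W z := by
  unfold labelDensity
  split_ifs
  · exact hρ₀.nonneg _
  · exact mul_nonneg (hu.nonneg _) (inv_nonneg.2 (h.pos _ _).le)

lemma labelDensity_le (h : IsSpeed a m Λ K) (hρ₀ : IsData 1 B ρ₀) (hu : IsData T L u) (z : ℝ) :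
    labelDensity a ρ₀ u W z ≤ B + L * m⁻¹ := by
  have hL := hu.bound_nonneg
  have hm := h.m_pos
  unfold labelDensity
  split_ifs
  · have := hρ₀.le_bound z
    have : 0 ≤ L * m⁻¹ := by positivity
    linarith
  · have h1 : u (entryTime a W z) * (a 0 (W (entryTime a W z)))⁻¹ ≤ L * m⁻¹ :=
      mul_le_mul (hu.le_bound _) (inv_anti₀ hm (h.lower _ _)) (inv_nonneg.2 (h.pos _ _).le) hL
    linarith [hρ₀.bound_nonneg]

lemma abs_labelDensity_le (h : IsSpeed a m Λ K) (hρ₀ : IsData 1 B ρ₀) (hu : IsData T L u) (z : ℝ) :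
    |labelDensity a ρ₀ u W z| ≤ B + L * m⁻¹ := by
  rw [abs_of_nonneg (h.labelDensity_nonneg hρ₀ hu z)]
  exact h.labelDensity_le hρ₀ hu z

lemma labelDensity_eq_zero (h : IsSpeed a m Λ K) (hW : Continuous W) (hρ₀ : IsData 1 B ρ₀)
    (hu : IsData T L u) (hT : 0 ≤ T) {z : ℝ} (hz : z ∉ Icc (-inflowShift a W T) 1) :
    labelDensity a ρ₀ u W z = 0 := by
  unfold labelDensity
  split_ifs with h0
  · refine hρ₀.eq_zero z fun hm => hz ⟨?_, hm.2.le⟩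
    linarith [h.inflowShift_nonneg hW hT]
  · rw [hu.eq_zero, zero_mul]
    intro hm
    refine hz ⟨?_, by linarith⟩
    have h1 := h.strictMono_inflowShift hW hm.2
    rw [h.inflowShift_entryTime hW] at h1
    linarith [le_max_left (-z) 0]


lemma memLp_labelDensity (h : IsSpeed a m Λ K) (hW : Continuous W) (hρ₀ : IsData 1 B ρ₀)
    (hu : IsData T L u) (hT : 0 ≤ T) (p : ENNReal) :
    MemLp (labelDensity a ρ₀ u W) p volume := by
  have h1 : MemLp (labelDensity a ρ₀ u W) p (volume.restrict (Icc (-inflowShift a W T) 1)) :=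
    MemLp.of_bound (h.measurable_labelDensity hW hρ₀ hu).aestronglyMeasurable (B + L * m⁻¹)
      (ae_of_all _ fun z => h.abs_labelDensity_le hρ₀ hu z)
  refine ((memLp_indicator_iff_restrict measurableSet_Icc).2 h1).congr_norm
    (h.measurable_labelDensity hW hρ₀ hu).aestronglyMeasurable (ae_of_all _ fun z => ?_)
  by_cases hz : z ∈ Icc (-inflowShift a W T) 1
  · rw [indicator_of_mem hz]
  · rw [indicator_of_notMem hz, h.labelDensity_eq_zero hW hρ₀ hu hT hz]

/-- Change of variables from entry time to label. -/
lemma setIntegral_labelDensity_neg (h : IsSpeed a m Λ K) (hW : Continuous W) {t : ℝ} (ht : 0 ≤ t)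
    (Ψ : ℝ → ℝ) :
    ∫ z in Ioo (-inflowShift a W t) 0, labelDensity a ρ₀ u W z * Ψ z =
      ∫ s in (0 : ℝ)..t, u s * Ψ (-inflowShift a W s) := by
  have himage : (fun s => -inflowShift a W s) '' Ioo 0 t = Ioo (-inflowShift a W t) 0 := by
    have hmono := h.strictMono_inflowShift hW
    ext z
    constructor
    · rintro ⟨s, hs, rfl⟩
      have h1 := hmono hs.1
      have h2 := hmono hs.2
      rw [inflowShift_zero] at h1
      constructor <;> simp only <;> linarith
    · rintro ⟨h1, h2⟩
      obtain ⟨s, hs⟩ := h.surjective_inflowShift hW (-z)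
      refine ⟨s, ⟨?_, ?_⟩, by simp [hs]⟩
      · rw [← hmono.lt_iff_lt, inflowShift_zero]
        linarith
      · rw [← hmono.lt_iff_lt]
        linarith
  rw [← himage, integral_image_eq_integral_abs_deriv_smul
    (f := fun s => -inflowShift a W s) (f' := fun s => -a 0 (W s))
    measurableSet_Ioo (fun s _ => (h.hasDerivAt_inflowShift hW s).neg.hasDerivWithinAt)
    (fun s _ s' _ he => (h.strictMono_inflowShift hW).injective (neg_injective he)),
    intervalIntegral.integral_of_le ht, integral_Ioc_eq_integral_Ioo]
  refine setIntegral_congr_fun measurableSet_Ioo fun s hs => ?_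
  have hA := h.inflowShift_nonneg hW hs.1.le
  have ha := (h.pos 0 (W s)).ne'
  simp only [labelDensity, smul_eq_mul]
  rw [if_neg (by linarith), h.entryTime_neg_inflowShift hW hs.1.le, abs_neg,
    abs_of_pos (h.pos _ _)]
  field_simp

lemma setIntegral_labelDensity_pos (Ψ : ℝ → ℝ) {z : ℝ} (hz : 0 ≤ z) :
    ∫ y in Ioo 0 z, labelDensity a ρ₀ u W y * Ψ y = ∫ y in (0 : ℝ)..z, ρ₀ y * Ψ y := by
  rw [intervalIntegral.integral_of_le hz, integral_Ioc_eq_integral_Ioo]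
  refine setIntegral_congr_fun measurableSet_Ioo fun y hy => ?_
  simp only [labelDensity]
  rw [if_pos hy.1]

lemma intervalIntegrable_labelDensity (h : IsSpeed a m Λ K) (hW : Continuous W)
    (hρ₀ : IsData 1 B ρ₀) (hu : IsData T L u) (x y : ℝ) :
    IntervalIntegrable (labelDensity a ρ₀ u W) volume x y :=
  (intervalIntegrable_const (c := B + L * m⁻¹)).mono_fun'
    (h.measurable_labelDensity hW hρ₀ hu).aestronglyMeasurable
    (ae_of_all _ fun z => h.abs_labelDensity_le hρ₀ hu z)

/-- The primitive of the label density, in terms of the primitives of the data. -/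
lemma integral_labelDensity (h : IsSpeed a m Λ K) (hW : Continuous W) (z : ℝ) :
    ∫ y in (0 : ℝ)..z, labelDensity a ρ₀ u W y =
      (∫ y in (0 : ℝ)..max z 0, ρ₀ y) - ∫ s in (0 : ℝ)..entryTime a W z, u s := by
  rcases le_total 0 z with hz | hz
  · have h1 := setIntegral_labelDensity_pos (a := a) (ρ₀ := ρ₀) (u := u) (W := W) (fun _ => 1) hz
    simp only [mul_one] at h1
    rw [max_eq_left hz, h.entryTime_of_nonneg hW hz, intervalIntegral.integral_same, sub_zero, ← h1,
      intervalIntegral.integral_of_le hz, integral_Ioc_eq_integral_Ioo]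
  · have h1 := h.setIntegral_labelDensity_neg (ρ₀ := ρ₀) (u := u) hW (h.entryTime_nonneg hW z)
      (fun _ => 1)
    simp only [mul_one] at h1
    rw [max_eq_right hz, intervalIntegral.integral_same, ← h1, h.inflowShift_entryTime hW,
      max_eq_left (by linarith), neg_neg, intervalIntegral.integral_symm,
      intervalIntegral.integral_of_le hz, integral_Ioc_eq_integral_Ioo, zero_sub]

/-- Change of variables from position to label. -/
lemma setIntegral_transported (h : IsSpeed a m Λ K) (hW : Continuous W) (t x y : ℝ)
    (ψ : ℝ → ℝ) :
    ∫ r in Ioo x y, transported a ρ₀ u W t r * ψ r =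
      ∫ z in Ioo (label a W t x) (label a W t y),
        labelDensity a ρ₀ u W z * ψ (flow a W t z) := by
  have himage : flow a W t '' Ioo (label a W t x) (label a W t y) = Ioo x y := by
    ext r
    constructor
    · rintro ⟨z, hz, rfl⟩
      exact ⟨(h.label_lt_iff hW).1 hz.1, (h.lt_label_iff hW).1 hz.2⟩
    · intro hr
      exact ⟨label a W t r, ⟨h.strictMono_label hW t hr.1, h.strictMono_label hW t hr.2⟩,
        h.flow_label hW t r⟩
  rw [← himage, integral_image_eq_integral_abs_deriv_smul measurableSet_Ioo
    (fun z _ => (h.hasDerivAt_flow_right hW t z).hasDerivWithinAt)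
    ((h.strictMono_flow hW t).injective.injOn)]
  refine setIntegral_congr_fun measurableSet_Ioo fun z _ => ?_
  have := (flowDeriv_pos (a := a) (W := W) t z).ne'
  simp only [transported, smul_eq_mul]
  rw [h.label_flow hW, abs_of_pos (flowDeriv_pos _ _)]
  field_simp

lemma integral_transported (h : IsSpeed a m Λ K) (hW : Continuous W) (hρ₀ : IsData 1 B ρ₀)
    (hu : IsData T L u) {t x : ℝ} (ht : 0 ≤ t) (hx : 0 ≤ x) :
    ∫ y in (0 : ℝ)..x, transported a ρ₀ u W t y =
      (∫ s in (0 : ℝ)..t, u s) - (∫ s in (0 : ℝ)..entryTime a W (label a W t x), u s) +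
        ∫ y in (0 : ℝ)..max (label a W t x) 0, ρ₀ y := by
  have h1 := h.setIntegral_transported (ρ₀ := ρ₀) (u := u) hW t 0 x (fun _ => 1)
  simp only [mul_one] at h1
  rw [intervalIntegral.integral_of_le hx, integral_Ioc_eq_integral_Ioo, h1,
    ← integral_Ioc_eq_integral_Ioo,
    ← intervalIntegral.integral_of_le ((h.strictMono_label hW t).monotone hx),
    ← intervalIntegral.integral_interval_sub_left
      (h.intervalIntegrable_labelDensity hW hρ₀ hu 0 _)
      (h.intervalIntegrable_labelDensity hW hρ₀ hu 0 _),
    h.integral_labelDensity hW, h.integral_labelDensity hW, h.label_zero_right hW ht,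
    h.entryTime_neg_inflowShift hW ht,
    max_eq_right (by linarith [h.inflowShift_nonneg hW ht] : -inflowShift a W t ≤ 0),
    intervalIntegral.integral_same]
  ring

lemma mass_transported (h : IsSpeed a m Λ K) (hW : Continuous W) (hρ₀ : IsData 1 B ρ₀)
    (hu : IsData T L u) {t : ℝ} (ht : 0 ≤ t) :
    mass (transported a ρ₀ u W) t = massMap a (fun t => ∫ s in (0 : ℝ)..t, u s)
      (fun x => ∫ y in (0 : ℝ)..x, ρ₀ y) W t :=
  h.integral_transported hW hρ₀ hu ht zero_le_one

lemma continuous_inv_flowDeriv_label (h : IsSpeed a m Λ K) (hW : Continuous W) :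
    Continuous fun q : ℝ × ℝ => (flowDeriv a W q.1 (label a W q.1 q.2))⁻¹ :=
  (h.continuous_flowDeriv_comp hW continuous_fst (h.continuous_label hW)).inv₀
    fun _ => (flowDeriv_pos _ _).ne'

lemma measurable_transported (h : IsSpeed a m Λ K) (hW : Continuous W) (hρ₀ : IsData 1 B ρ₀)
    (hu : IsData T L u) : Measurable (Function.uncurry (transported a ρ₀ u W)) :=
  ((h.measurable_labelDensity hW hρ₀ hu).comp (h.continuous_label hW).measurable).mul
    (h.continuous_inv_flowDeriv_label hW).measurable

lemma transported_nonneg (h : IsSpeed a m Λ K) (hρ₀ : IsData 1 B ρ₀) (hu : IsData T L u)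
    (t x : ℝ) : 0 ≤ transported a ρ₀ u W t x :=
  mul_nonneg (h.labelDensity_nonneg hρ₀ hu _) (inv_nonneg.2 (flowDeriv_pos _ _).le)

lemma abs_transported_le (h : IsSpeed a m Λ K) (hρ₀ : IsData 1 B ρ₀) (hu : IsData T L u)
    {t : ℝ} (ht : t ∈ Icc 0 T) (x : ℝ) :
    |transported a ρ₀ u W t x| ≤ (B + L * m⁻¹) * Real.exp (K * T) := by
  rw [transported, abs_mul, abs_of_pos (inv_pos.2 (flowDeriv_pos _ _))]
  refine mul_le_mul (h.abs_labelDensity_le hρ₀ hu _) ?_ (inv_pos.2 (flowDeriv_pos _ _)).le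
    ((abs_nonneg _).trans (h.abs_labelDensity_le (W := W) hρ₀ hu 0))
  rw [inv_le_comm₀ (flowDeriv_pos _ _) (Real.exp_pos _), ← Real.exp_neg]
  refine le_trans (Real.exp_le_exp.2 ?_) (h.exp_neg_le_flowDeriv _ _)
  rw [abs_of_nonneg ht.1]
  exact neg_le_neg (mul_le_mul_of_nonneg_left ht.2 h.K_pos.le)

lemma continuousIntoLp_transported (h : IsSpeed a m Λ K) (hW : Continuous W) (hρ₀ : IsData 1 B ρ₀)
    (hu : IsData T L u) (hT : 0 ≤ T) {p : ENNReal} (hp : 1 ≤ p) (hp' : p ≠ ⊤) :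
    ContinuousIntoLp p T 1 (transported a ρ₀ u W) := by
  refine continuousIntoLp_comp_mul (c := Real.exp (K * T)) (Zf := label a W)
    (J := fun t x => (flowDeriv a W t (label a W t x))⁻¹) (h.continuous_label hW)
    (h.continuous_inv_flowDeriv_label hW) (Real.exp_pos _).le (fun t ht x _ y _ => ?_)
    (h.measurable_labelDensity hW hρ₀ hu) hp hp' (h.memLp_labelDensity hW hρ₀ hu hT p)
  refine (h.abs_sub_le_label hW t x y).trans ?_
  rw [abs_of_nonneg ht.1]
  have := h.K_pos
  gcongr
  exact ht.2

/-- The transported density has traces in `L^p` at every position. -/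
lemma continuousIntoLp_transported_swap (h : IsSpeed a m Λ K) (hW : Continuous W)
    (hρ₀ : IsData 1 B ρ₀) (hu : IsData T L u) (hT : 0 ≤ T) {p : ENNReal} (hp : 1 ≤ p)
    (hp' : p ≠ ⊤) :
    ContinuousIntoLp p 1 T fun x t => transported a ρ₀ u W t x := by
  have hm := h.m_pos
  refine continuousIntoLp_comp_mul (c := m⁻¹ * Real.exp (K * T)) (Zf := fun x t => label a W t x)
    (J := fun x t => (flowDeriv a W t (label a W t x))⁻¹)
    ((h.continuous_label hW).comp continuous_swap)
    ((h.continuous_inv_flowDeriv_label hW).comp continuous_swap) (by positivity)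
    (fun x _ t ht t' ht' => ?_)
    (h.measurable_labelDensity hW hρ₀ hu) hp hp' (h.memLp_labelDensity hW hρ₀ hu hT p)
  rw [mul_assoc, le_inv_mul_iff₀ hm]
  exact h.abs_sub_time_le_label hW x ht ht'

end IsSpeed

/-! ### The weak formulation for the transported density -/

/-- The partial derivatives of a `C¹` function on a closed rectangle extend continuously. -/
lemma exists_continuous_partials {φ : ℝ → ℝ → ℝ} {τ : ℝ} (hτ : 0 < τ)
    (hφ : ContDiffOn ℝ 1 (Function.uncurry φ) (Icc 0 τ ×ˢ Icc 0 1)) :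
    ∃ D : ℝ × ℝ → (ℝ × ℝ →L[ℝ] ℝ), Continuous D ∧
      (∀ t ∈ Ioo 0 τ, ∀ x ∈ Ioo (0 : ℝ) 1, HasFDerivAt (Function.uncurry φ) (D (t, x)) (t, x)) ∧
      (∀ t ∈ Ioo 0 τ, ∀ x ∈ Ioo (0 : ℝ) 1, deriv (fun s => φ s x) t = D (t, x) (1, 0)) ∧
      ∀ t ∈ Ioo 0 τ, ∀ x ∈ Ioo (0 : ℝ) 1, deriv (fun y => φ t y) x = D (t, x) (0, 1) := by
  set R : Set (ℝ × ℝ) := Icc 0 τ ×ˢ Icc 0 1 with hR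
  have hu : UniqueDiffOn ℝ R := (uniqueDiffOn_Icc hτ).prod (uniqueDiffOn_Icc one_pos)
  have hc := hφ.continuousOn_fderivWithin hu le_rfl
  set P : ℝ × ℝ → ℝ × ℝ := fun q => (max 0 (min τ q.1), max 0 (min 1 q.2)) with hP
  have hPc : Continuous P := by fun_prop
  have hPm : ∀ q, P q ∈ R := fun q =>
    ⟨⟨le_max_left _ _, max_le hτ.le (min_le_left _ _)⟩,
      ⟨le_max_left _ _, max_le zero_le_one (min_le_left _ _)⟩⟩
  have hd : ∀ t ∈ Ioo 0 τ, ∀ x ∈ Ioo (0 : ℝ) 1, HasFDerivAt (Function.uncurry φ)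
      (fderivWithin ℝ (Function.uncurry φ) R (P (t, x))) (t, x) := fun t ht x hx => by
    have hPq : P (t, x) = (t, x) := by
      simp only [hP]
      rw [min_eq_right ht.2.le, max_eq_right ht.1.le, min_eq_right hx.2.le, max_eq_right hx.1.le]
    have hn : R ∈ 𝓝 (t, x) := prod_mem_nhds (Icc_mem_nhds ht.1 ht.2) (Icc_mem_nhds hx.1 hx.2)
    rw [hPq]
    exact ((hφ.differentiableOn one_ne_zero) (t, x)
      (mem_of_mem_nhds hn)).hasFDerivWithinAt.hasFDerivAt hn
  refine ⟨fun q => fderivWithin ℝ (Function.uncurry φ) R (P q),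
    hc.comp_continuous hPc hPm, hd, fun t ht x hx => ?_, fun t ht x hx => ?_⟩
  · have h1 := (hd t ht x hx).comp_hasDerivAt t
      ((hasDerivAt_id t).prodMk (hasDerivAt_const t x))
    exact h1.deriv
  · have h1 := (hd t ht x hx).comp_hasDerivAt x
      ((hasDerivAt_const x t).prodMk (hasDerivAt_id x))
    exact h1.deriv

namespace IsSpeed

variable {a : ℝ → ℝ → ℝ} {m Λ K T B L : ℝ} {ρ₀ u W : ℝ → ℝ}

/-- The integral of the derivative of a test function along the part of a characteristic that lies
in the domain: the test function vanishes where the characteristic leaves. -/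
lemma integral_along_flow (h : IsSpeed a m Λ K) (hW : Continuous W) {φ : ℝ → ℝ → ℝ} {τ : ℝ}
    (hφ : ContDiffOn ℝ 1 (Function.uncurry φ) (Icc 0 τ ×ˢ Icc 0 1))
    (hφτ : ∀ x ∈ Icc (0 : ℝ) 1, φ τ x = 0) (hφ1 : ∀ t ∈ Icc 0 τ, φ t 1 = 0)
    {D : ℝ × ℝ → (ℝ × ℝ →L[ℝ] ℝ)} (hDc : Continuous D)
    (hD : ∀ t ∈ Ioo 0 τ, ∀ x ∈ Ioo (0 : ℝ) 1, HasFDerivAt (Function.uncurry φ) (D (t, x)) (t, x))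
    (hτ : 0 < τ) {z : ℝ} (hz : z ∈ Ioo (-inflowShift a W τ) 1) :
    ∫ t in Ioo 0 τ, {t | flow a W t z ∈ Ioo 0 1}.indicator
        (fun t => D (t, flow a W t z) (1, a (flow a W t z) (W t))) t =
      -φ (entryTime a W z) (max z 0) := by
  set S := entryTime a W z with hS
  have hmono := h.strictMono_flow_left hW z
  have hS0 : 0 ≤ S := h.entryTime_nonneg hW z
  have hSτ : S < τ := by
    rw [h.entryTime_lt_iff hW hτ, ← h.label_lt_iff hW, h.label_zero_right hW hτ.le]
    exact hz.1
  have hfS : flow a W S z = max z 0 := h.flow_entryTime hW z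
  have hfS1 : flow a W S z < 1 := by
    rw [hfS]
    exact max_lt hz.2 one_pos
  obtain ⟨e, hSe, heτ, he1, hφe, hein⟩ : ∃ e, S < e ∧ e ≤ τ ∧ flow a W e z ≤ 1 ∧
      φ e (flow a W e z) = 0 ∧ ∀ t ∈ Ioo 0 τ, flow a W t z < 1 → t < e := by
    rcases le_or_gt (flow a W τ z) 1 with hle | hlt
    · refine ⟨τ, hSτ, le_rfl, hle, hφτ _ ⟨?_, hle⟩, fun t ht _ => ht.2⟩
      have h1 := hmono hSτ
      simp only [hfS] at h1
      linarith [le_max_right z 0]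
    · obtain ⟨e, he, hee⟩ := intermediate_value_Icc hSτ.le
        (h.continuous_flow_left hW z).continuousOn ⟨hfS1.le, hlt.le⟩
      simp only at hee
      refine ⟨e, ?_, he.2, hee.le, ?_, fun t _ ht => ?_⟩
      · refine he.1.lt_of_ne fun hse => ?_
        rw [← hse] at hee
        linarith
      · rw [hee]
        exact hφ1 e ⟨hS0.trans he.1, he.2⟩
      · rw [← hee] at ht
        exact hmono.lt_iff_lt.1 ht
  have hset : Ioo 0 τ ∩ {t | flow a W t z ∈ Ioo 0 1} = Ioo S e := by
    ext t
    constructor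
    · rintro ⟨ht, hft⟩
      exact ⟨(h.entryTime_lt_iff hW ht.1).2 hft.1, hein t ht hft.2⟩
    · intro ht
      have ht0 : 0 < t := hS0.trans_lt ht.1
      have h1 := hmono ht.2
      simp only at h1
      exact ⟨⟨ht0, ht.2.trans_le heτ⟩, (h.entryTime_lt_iff hW ht0).1 ht.1, h1.trans_le he1⟩
  have hmeas : MeasurableSet {t | flow a W t z ∈ Ioo (0 : ℝ) 1} :=
    (h.continuous_flow_left hW z).measurable measurableSet_Ioo
  rw [setIntegral_indicator hmeas, hset, ← integral_Ioc_eq_integral_Ioo,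
    ← intervalIntegral.integral_of_le hSe.le]
  have hcont : Continuous fun t => D (t, flow a W t z) (1, a (flow a W t z) (W t)) := by
    have h1 := h.continuous_flow_left hW z
    exact (hDc.comp (continuous_id.prodMk h1)).clm_apply
      (continuous_const.prodMk (h.continuous_comp h1 hW))
  rw [intervalIntegral.integral_eq_sub_of_hasDerivAt_of_le hSe.le
    (f := fun t => φ t (flow a W t z)) ?_ ?_ (hcont.intervalIntegrable _ _), hφe, hfS, zero_sub]
  · refine hφ.continuousOn.comp (f := fun t => (t, flow a W t z))
      (continuous_id.prodMk (h.continuous_flow_left hW z)).continuousOn fun t ht => ?_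
    have h1 := hmono.monotone ht.1
    have h2 := hmono.monotone ht.2
    simp only [hfS] at h1 h2
    exact ⟨⟨hS0.trans ht.1, ht.2.trans heτ⟩, (le_max_right _ _).trans h1, h2.trans he1⟩
  · intro t ht
    have htm : t ∈ Ioo 0 τ ∩ {t | flow a W t z ∈ Ioo 0 1} := by rw [hset]; exact ht
    exact (hD t htm.1 _ htm.2).comp_hasDerivAt t
      ((hasDerivAt_id t).prodMk (h.hasDerivAt_flow hW t z))

/-- The transported density satisfies the weak formulation with speed `a(x, W(t))`: in label
coordinates the transport operator is the derivative along characteristics. -/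
lemma weak_transported (h : IsSpeed a m Λ K) (hW : Continuous W) (hρ₀ : IsData 1 B ρ₀)
    (hu : IsData T L u) {τ : ℝ} (hτ : 0 ≤ τ) (φ : ℝ → ℝ → ℝ)
    (hφ : ContDiffOn ℝ 1 (Function.uncurry φ) (Icc 0 τ ×ˢ Icc 0 1))
    (hφτ : ∀ x ∈ Icc (0 : ℝ) 1, φ τ x = 0) (hφ1 : ∀ t ∈ Icc 0 τ, φ t 1 = 0) :
    (∫ t in (0 : ℝ)..τ, ∫ x in (0 : ℝ)..1, transported a ρ₀ u W t x *
        (deriv (fun s => φ s x) t + a x (W t) * deriv (fun y => φ t y) x)) +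
      (∫ t in (0 : ℝ)..τ, u t * φ t 0) + (∫ x in (0 : ℝ)..1, ρ₀ x * φ 0 x) = 0 := by
  rcases hτ.eq_or_lt with rfl | hτ
  · have : ∫ x in (0 : ℝ)..1, ρ₀ x * φ 0 x = ∫ x in (0 : ℝ)..1, (0 : ℝ) :=
      intervalIntegral.integral_congr fun x hx => by
        rw [uIcc_of_le zero_le_one] at hx
        rw [hφτ x hx, mul_zero]
    simp [this]
  obtain ⟨D, hDc, hD, hDt, hDx⟩ := exists_continuous_partials hτ hφ
  set A := inflowShift a W τ with hA
  have hA0 : 0 ≤ A := h.inflowShift_nonneg hW hτ.le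
  set g := labelDensity a ρ₀ u W with hg
  have hgm : Measurable g := h.measurable_labelDensity hW hρ₀ hu
  set ψ : ℝ × ℝ → ℝ := fun q => D q (1, a q.2 (W q.1)) with hψ
  have hψc : Continuous ψ := hDc.clm_apply
    (continuous_const.prodMk (h.continuous_comp continuous_snd (hW.comp continuous_fst)))
  obtain ⟨C, hC⟩ := ((isCompact_Icc (a := (0 : ℝ)) (b := τ)).prod
    (isCompact_Icc (a := (0 : ℝ)) (b := 1))).exists_bound_of_continuousOn hψc.continuousOn
  -- the integrand in label coordinates
  set Q : Set (ℝ × ℝ) := {q | flow a W q.1 q.2 ∈ Ioo 0 1} with hQ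
  have hQm : MeasurableSet Q := (h.continuous_flow hW).measurable measurableSet_Ioo
  set H : ℝ × ℝ → ℝ := fun q => g q.2 * Q.indicator (fun q => ψ (q.1, flow a W q.1 q.2)) q with hH
  have hHm : Measurable H := by
    refine (hgm.comp measurable_snd).mul (Measurable.indicator ?_ hQm)
    exact (hψc.comp (continuous_fst.prodMk (h.continuous_flow hW))).measurable
  have hHint : Integrable H ((volume.restrict (Ioo 0 τ)).prod (volume.restrict (Ioo (-A) 1))) := by
    rw [Measure.prod_restrict]
    have : IsFiniteMeasure (((volume : Measure ℝ).prod (volume : Measure ℝ)).restrict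
        (Ioo 0 τ ×ˢ Ioo (-A) 1)) := by
      refine ⟨?_⟩
      rw [Measure.restrict_apply_univ, Measure.prod_prod]
      exact ENNReal.mul_lt_top measure_Ioo_lt_top measure_Ioo_lt_top
    refine Integrable.of_bound hHm.aestronglyMeasurable ((B + L * m⁻¹) * C) ?_
    filter_upwards [ae_restrict_mem (measurableSet_Ioo.prod measurableSet_Ioo)] with q hq
    rw [hH, norm_mul]
    refine mul_le_mul (h.abs_labelDensity_le hρ₀ hu _) ?_ (norm_nonneg _)
      ((abs_nonneg _).trans (h.abs_labelDensity_le (W := W) hρ₀ hu 0))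
    by_cases hqQ : q ∈ Q
    · rw [indicator_of_mem hqQ]
      exact hC _ ⟨Ioo_subset_Icc_self hq.1, Ioo_subset_Icc_self hqQ⟩
    · rw [indicator_of_notMem hqQ, norm_zero]
      exact (norm_nonneg _).trans (hC (0, 0) ⟨left_mem_Icc.2 hτ.le, by simp⟩)
  have e1 : (∫ t in (0 : ℝ)..τ, ∫ x in (0 : ℝ)..1, transported a ρ₀ u W t x *
        (deriv (fun s => φ s x) t + a x (W t) * deriv (fun y => φ t y) x)) =
      ∫ t in Ioo 0 τ, ∫ z in Ioo (-A) 1, H (t, z) := by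
    rw [intervalIntegral.integral_of_le hτ.le, integral_Ioc_eq_integral_Ioo]
    refine setIntegral_congr_fun measurableSet_Ioo fun t ht => ?_
    rw [intervalIntegral.integral_of_le zero_le_one, integral_Ioc_eq_integral_Ioo]
    have h1 : ∀ x ∈ Ioo (0 : ℝ) 1, transported a ρ₀ u W t x *
        (deriv (fun s => φ s x) t + a x (W t) * deriv (fun y => φ t y) x) =
        transported a ρ₀ u W t x * ψ (t, x) := fun x hx => by
      rw [hDt t ht x hx, hDx t ht x hx, hψ]
      simp only
      congr 1
      rw [show ((1 : ℝ), a x (W t)) = (1, 0) + a x (W t) • (0, 1) by simp, map_add, map_smul,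
        smul_eq_mul]
    rw [setIntegral_congr_fun measurableSet_Ioo h1,
      h.setIntegral_transported hW t 0 1 (fun x => ψ (t, x))]
    have h2 : ∀ z, H (t, z) = {z | flow a W t z ∈ Ioo 0 1}.indicator
        (fun z => g z * ψ (t, flow a W t z)) z := fun z => by
      by_cases hz : flow a W t z ∈ Ioo (0 : ℝ) 1
      · rw [indicator_of_mem (show z ∈ {z | flow a W t z ∈ Ioo (0 : ℝ) 1} from hz)]
        simp only [hH]
        rw [indicator_of_mem (show (t, z) ∈ Q from hz)]
      · rw [indicator_of_notMem (show z ∉ {z | flow a W t z ∈ Ioo (0 : ℝ) 1} from hz)]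
        simp only [hH]
        rw [indicator_of_notMem (show (t, z) ∉ Q from hz), mul_zero]
    simp only [h2]
    have hm : MeasurableSet {z | flow a W t z ∈ Ioo (0 : ℝ) 1} :=
      (h.continuous_flow_right hW t).measurable measurableSet_Ioo
    rw [setIntegral_indicator hm]
    congr 2
    ext z
    simp only [mem_inter_iff, mem_Ioo, mem_ofPred_eq, h.label_lt_iff hW, h.lt_label_iff hW]
    refine ⟨fun hz => ⟨⟨?_, ?_⟩, hz⟩, fun hz => hz.2⟩
    · have h3 := hz.1
      rw [← h.label_lt_iff hW, h.label_zero_right hW ht.1.le] at h3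
      linarith [h.strictMono_inflowShift hW ht.2]
    · have h3 := h.strictMono_flow_left hW z ht.1
      simp only [h.flow_zero hW] at h3
      linarith [hz.2]
  have e2 : ∫ t in Ioo 0 τ, ∫ z in Ioo (-A) 1, H (t, z) =
      ∫ z in Ioo (-A) 1, -(g z * φ (entryTime a W z) (max z 0)) := by
    rw [integral_integral_swap (f := fun t z => H (t, z)) hHint]
    refine setIntegral_congr_fun measurableSet_Ioo fun z hz => ?_
    simp only [hH]
    rw [integral_const_mul, ← mul_neg,
      ← h.integral_along_flow hW hφ hφτ hφ1 hDc hD hτ hz]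
    rfl
  -- integrability of the boundary values on the labels
  have hint : IntegrableOn (fun z => g z * φ (entryTime a W z) (max z 0)) (Icc (-A) 1) := by
    have h1 : ContinuousOn (fun z => φ (entryTime a W z) (max z 0)) (Icc (-A) 1) := by
      refine hφ.continuousOn.comp (f := fun z => (entryTime a W z, max z 0))
        ((h.continuous_entryTime hW).prodMk (by fun_prop)).continuousOn fun z hz => ?_
      refine ⟨⟨h.entryTime_nonneg hW z, h.entryTime_le_of_flow_nonneg hW hτ.le ?_⟩,
        le_max_right _ _, max_le hz.2 zero_le_one⟩
      rw [← h.flow_neg_inflowShift hW hτ.le]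
      exact (h.strictMono_flow hW τ).monotone hz.1
    exact h1.integrableOn_Icc.bdd_mul hgm.aestronglyMeasurable
      (ae_of_all _ fun z => h.abs_labelDensity_le hρ₀ hu z)
  have e3 : ∫ z in Ioo (-A) 1, g z * φ (entryTime a W z) (max z 0) =
      (∫ t in (0 : ℝ)..τ, u t * φ t 0) + ∫ x in (0 : ℝ)..1, ρ₀ x * φ 0 x := by
    have h1 := h.setIntegral_labelDensity_neg (ρ₀ := ρ₀) (u := u) hW hτ.le
      (fun z => φ (entryTime a W z) (max z 0))
    have h2 := setIntegral_labelDensity_pos (a := a) (ρ₀ := ρ₀) (u := u) (W := W)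
      (fun z => φ (entryTime a W z) (max z 0)) zero_le_one
    have h3 : ∫ s in (0 : ℝ)..τ, u s * φ (entryTime a W (-inflowShift a W s))
        (max (-inflowShift a W s) 0) = ∫ t in (0 : ℝ)..τ, u t * φ t 0 := by
      refine intervalIntegral.integral_congr fun s hs => ?_
      rw [uIcc_of_le hτ.le] at hs
      rw [h.entryTime_neg_inflowShift hW hs.1,
        max_eq_right (by linarith [h.inflowShift_nonneg hW hs.1])]
    have h4 : ∫ x in (0 : ℝ)..1, ρ₀ x * φ (entryTime a W x) (max x 0) =
        ∫ x in (0 : ℝ)..1, ρ₀ x * φ 0 x := by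
      refine intervalIntegral.integral_congr fun x hx => ?_
      rw [uIcc_of_le zero_le_one] at hx
      rw [h.entryTime_of_nonneg hW hx.1, max_eq_left hx.1]
    rw [← h3, ← h4, ← h1, ← h2, ← integral_Ioc_eq_integral_Ioo, ← integral_Ioc_eq_integral_Ioo,
      ← integral_Ioc_eq_integral_Ioo, ← intervalIntegral.integral_of_le (by linarith),
      ← intervalIntegral.integral_of_le (by linarith),
      ← intervalIntegral.integral_of_le zero_le_one,
      intervalIntegral.integral_add_adjacent_intervals]
    · exact (intervalIntegrable_iff_integrableOn_Icc_of_le (by linarith)).2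
        (hint.mono_set (Icc_subset_Icc_right zero_le_one))
    · exact (intervalIntegrable_iff_integrableOn_Icc_of_le zero_le_one).2
        (hint.mono_set (Icc_subset_Icc_left (by linarith)))
  rw [e1, e2, integral_neg, e3]
  ring

end IsSpeed

/-- A fixed point of the mass equation gives a weak solution, as soon as the truncation of the speed
does not affect masses up to the total mass of the data. -/
lemma isWeakSolution_transported {vel : ℝ → ℝ → ℝ} {m Λ K T B L M : ℝ} {ρ₀ u W : ℝ → ℝ}
    (h : IsSpeed (clampSpeed vel M) m Λ K) (hW : Continuous W) (hρ₀ : IsData 1 B ρ₀)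
    (hu : IsData T L u) (hT : 0 < T)
    (hM : (∫ s in (0 : ℝ)..T, u s) + ∫ y in (0 : ℝ)..1, ρ₀ y ≤ M)
    (hfix : ∀ t ∈ Icc 0 T, W t = massMap (clampSpeed vel M) (fun t => ∫ s in (0 : ℝ)..t, u s)
      (fun x => ∫ y in (0 : ℝ)..x, ρ₀ y) W t) :
    (∀ t ∈ Icc 0 T, mass (transported (clampSpeed vel M) ρ₀ u W) t = W t) ∧
    (∀ t ∈ Icc 0 T, W t ∈ Icc 0 M) ∧
    IsWeakSolution vel T ρ₀ u (transported (clampSpeed vel M) ρ₀ u W) := by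
  have hmass : ∀ t ∈ Icc 0 T, mass (transported (clampSpeed vel M) ρ₀ u W) t = W t :=
    fun t ht => by rw [hfix t ht, h.mass_transported hW hρ₀ hu ht.1]
  have hnonneg : ∀ t, 0 ≤ mass (transported (clampSpeed vel M) ρ₀ u W) t := fun t =>
    intervalIntegral.integral_nonneg zero_le_one fun x _ => h.transported_nonneg hρ₀ hu t x
  have hWM : ∀ t ∈ Icc 0 T, W t ∈ Icc 0 M := fun t ht => by
    refine ⟨by rw [← hmass t ht]; exact hnonneg t, ?_⟩
    rw [hfix t ht]
    refine le_trans ?_ hM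
    have hl : label (clampSpeed vel M) W t 1 ≤ 1 := by
      have := (h.strictAnti_label hW 1).antitone ht.1
      simpa only [h.label_zero hW] using this
    have h1 := hu.primitive_mono ht.2
    have h2 := hρ₀.primitive_mono (max_le hl zero_le_one)
    have h3 := hu.primitive_nonneg
      (h.entryTime_nonneg hW (label (clampSpeed vel M) W t 1))
    simp only [massMap]
    linarith
  refine ⟨hmass, hWM, h.continuousIntoLp_transported hW hρ₀ hu hT.le le_rfl ENNReal.one_ne_top,
    ?_, fun t _ => hnonneg t, fun τ hτ φ hφ hφτ hφ1 => ?_⟩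
  · refine memLp_top_of_bound (h.measurable_transported hW hρ₀ hu).aestronglyMeasurable
      ((B + L * m⁻¹) * Real.exp (K * T)) ?_
    filter_upwards [ae_restrict_mem (measurableSet_Ioo.prod measurableSet_Ioo)] with q hq
    exact h.abs_transported_le hρ₀ hu (Ioo_subset_Icc_self hq.1) q.2
  · refine (congrArg₂ _ (congrArg₂ _ ?_ rfl) rfl).trans
      (h.weak_transported hW hρ₀ hu hτ.1 φ hφ hφτ hφ1)
    refine intervalIntegral.integral_congr fun t ht => ?_
    refine intervalIntegral.integral_congr fun x hx => ?_
    rw [uIcc_of_le hτ.1] at ht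
    rw [uIcc_of_le zero_le_one] at hx
    have htT : t ∈ Icc 0 T := ⟨ht.1, ht.2.trans hτ.2⟩
    rw [hmass t htT, clampSpeed_of_mem vel hx (hWM t htT)]

/-! ### The out-flux -/

lemma isOutflux_transported {vel a : ℝ → ℝ → ℝ} {m Λ K T B L : ℝ} {ρ₀ u W : ℝ → ℝ}
    (h : IsSpeed a m Λ K) (hW : Continuous W) (hρ₀ : IsData 1 B ρ₀)
    (hu : IsData T L u) (hT : 0 ≤ T) :
    IsOutflux vel T (transported a ρ₀ u W) fun t =>
      transported a ρ₀ u W t 1 * vel 1 (mass (transported a ρ₀ u W) t) :=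
  ⟨transported a ρ₀ u W, EventuallyEq.rfl,
    fun _ hp hp' => h.continuousIntoLp_transported_swap hW hρ₀ hu hT hp hp', EventuallyEq.rfl⟩

/-- The accumulated out-flux is what was there or flowed in and is not there any more. -/
lemma IsSpeed.integral_outflux {a : ℝ → ℝ → ℝ} {m Λ K T B L : ℝ} {ρ₀ u W : ℝ → ℝ}
    (h : IsSpeed a m Λ K) (hW : Continuous W) (hρ₀ : IsData 1 B ρ₀)
    (hu : IsData T L u) {t : ℝ} (ht : 0 ≤ t) :
    ∫ s in (0 : ℝ)..t, transported a ρ₀ u W s 1 * a 1 (W s) =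
      (∫ y in (0 : ℝ)..1, ρ₀ y) + (∫ s in (0 : ℝ)..t, u s) -
        massMap a (fun t => ∫ s in (0 : ℝ)..t, u s) (fun x => ∫ y in (0 : ℝ)..x, ρ₀ y) W t := by
  have hanti := h.strictAnti_label hW 1
  have hcont : Continuous fun s => label a W s 1 :=
    h.continuous_label_comp hW continuous_id continuous_const
  have himage : (fun s => label a W s 1) '' Ioo 0 t = Ioo (label a W t 1) 1 := by
    ext z
    constructor
    · rintro ⟨s, hs, rfl⟩
      have h1 := hanti hs.1
      simp only [h.label_zero hW] at h1
      exact ⟨hanti hs.2, h1⟩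
    · intro hz
      obtain ⟨s, hs, hsz⟩ := intermediate_value_Icc' ht hcont.continuousOn
        ⟨hz.1.le, by simpa only [h.label_zero hW] using hz.2.le⟩
      refine ⟨s, ⟨hs.1.lt_of_ne ?_, hs.2.lt_of_ne ?_⟩, hsz⟩
      · rintro rfl
        simp only [h.label_zero hW] at hsz
        exact hz.2.ne hsz.symm
      · rintro rfl
        exact hz.1.ne hsz
  have h1 := integral_image_eq_integral_abs_deriv_smul (f := fun s => label a W s 1)
    (s := Ioo 0 t) measurableSet_Ioo
    (fun s _ => (h.hasDerivAt_label_left hW s 1).hasDerivWithinAt) hanti.injective.injOn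
    (labelDensity a ρ₀ u W)
  have hl : label a W t 1 ≤ 1 := by
    simpa only [h.label_zero hW] using hanti.antitone ht
  rw [himage, ← integral_Ioc_eq_integral_Ioo, ← intervalIntegral.integral_of_le hl,
    ← intervalIntegral.integral_interval_sub_left
      (h.intervalIntegrable_labelDensity hW hρ₀ hu 0 _)
      (h.intervalIntegrable_labelDensity hW hρ₀ hu 0 _),
    h.integral_labelDensity hW, h.integral_labelDensity hW,
    h.entryTime_of_nonneg hW zero_le_one, intervalIntegral.integral_same,
    max_eq_left zero_le_one] at h1
  have h2 : ∫ s in (0 : ℝ)..t, transported a ρ₀ u W s 1 * a 1 (W s) =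
      ∫ s in Ioo 0 t, |-(a 1 (W s) / flowDeriv a W s (label a W s 1))| •
        labelDensity a ρ₀ u W (label a W s 1) := by
    rw [intervalIntegral.integral_of_le ht, integral_Ioc_eq_integral_Ioo]
    refine setIntegral_congr_fun measurableSet_Ioo fun s _ => ?_
    simp only [transported, smul_eq_mul]
    rw [abs_neg, abs_of_pos (div_pos (h.pos _ _) (flowDeriv_pos _ _))]
    ring
  rw [h2, ← h1, massMap]
  ring

/-- The trace at `x = 1`, and with it the out-flux, is determined up to null sets. -/
lemma IsOutflux.unique {vel : ℝ → ℝ → ℝ} {T : ℝ} {ρ ρ' : ℝ → ℝ → ℝ} {y y' : ℝ → ℝ}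
    (hρ : Function.uncurry ρ' =ᵐ[volume.restrict (Ioo 0 T ×ˢ Ioo 0 1)] Function.uncurry ρ)
    (hmass : ∀ t ∈ Icc 0 T, mass ρ' t = mass ρ t)
    (hy : IsOutflux vel T ρ y) (hy' : IsOutflux vel T ρ' y') :
    y' =ᵐ[volume.restrict (Ioo 0 T)] y := by
  obtain ⟨r, hr, hrc, hry⟩ := hy
  obtain ⟨r', hr', hrc', hry'⟩ := hy'
  have hrr : Function.uncurry r' =ᵐ[volume.restrict (Ioo 0 T ×ˢ Ioo 0 1)] Function.uncurry r :=
    hr'.trans (hρ.trans hr.symm)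
  rw [Measure.volume_eq_prod, ← Measure.prod_restrict] at hrr
  have hsw : ∀ᵐ q ∂((volume.restrict (Ioo (0 : ℝ) 1)).prod (volume.restrict (Ioo 0 T))),
      r' q.2 q.1 = r q.2 q.1 :=
    Measure.measurePreserving_swap.quasiMeasurePreserving.ae hrr
  have hae := Measure.ae_ae_of_ae_prod hsw
  rw [ae_restrict_iff' measurableSet_Ioo] at hae
  have h1c := hrc 1 le_rfl ENNReal.one_ne_top
  have h1c' := hrc' 1 le_rfl ENNReal.one_ne_top
  have h1 : (1 : ℝ) ∈ Icc (0 : ℝ) 1 := right_mem_Icc.2 zero_le_one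
  -- the positions where the representatives agree accumulate at `1`, where both are continuous
  set S : Set ℝ := Ioo 0 1 ∩ {x | x ∈ Ioo (0 : ℝ) 1 →
    ∀ᵐ t ∂(volume.restrict (Ioo 0 T)), r' t x = r t x} with hS
  have hne : (𝓝[S] (1 : ℝ)).NeBot := by
    rw [← mem_closure_iff_nhdsWithin_neBot]
    have hd := (Measure.dense_of_ae hae).open_subset_closure_inter
      (isOpen_Ioo (a := (0 : ℝ)) (b := 1))
    have := closure_minimal hd isClosed_closure
    rw [closure_Ioo zero_ne_one] at this
    exact this h1
  have hSI : S ⊆ Icc 0 1 := fun x hx => Ioo_subset_Icc_self hx.1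
  have hsub : 𝓝[S] (1 : ℝ) ≤ 𝓝[Icc 0 1] 1 := nhdsWithin_mono _ hSI
  have hlim := ((h1c.2 1 h1).mono_left hsub).add ((h1c'.2 1 h1).mono_left hsub)
  rw [add_zero] at hlim
  have hle : eLpNorm (fun t => r' t 1 - r t 1) 1 (volume.restrict (Ioo 0 T)) ≤ 0 := by
    refine ge_of_tendsto hlim ?_
    filter_upwards [self_mem_nhdsWithin] with x hx
    have hm1 := ((h1c.1 x (hSI hx)).sub (h1c.1 1 h1)).1
    have hm2 := ((h1c'.1 x (hSI hx)).sub (h1c'.1 1 h1)).1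
    have he : eLpNorm (fun t => r' t 1 - r t 1) 1 (volume.restrict (Ioo 0 T)) =
        eLpNorm (((fun t => r t x) - fun t => r t 1) - ((fun t => r' t x) - fun t => r' t 1)) 1
          (volume.restrict (Ioo 0 T)) := by
      refine eLpNorm_congr_ae ?_
      filter_upwards [hx.2 hx.1] with t ht
      simp only [Pi.sub_apply, ht]
      ring
    rw [he]
    exact eLpNorm_sub_le hm1 hm2 le_rfl
  have h2 := (eLpNorm_eq_zero_iff ((h1c'.1 1 h1).sub (h1c.1 1 h1)).1 one_ne_zero).1
    (le_antisymm hle zero_le)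
  filter_upwards [h2, hry, hry', ae_restrict_mem measurableSet_Ioo] with t ht hyt hyt' htm
  have ht' : r' t 1 = r t 1 := sub_eq_zero.1 ht
  rw [hyt, hyt', ht', hmass t (Ioo_subset_Icc_self htm)]

/-- Weak solutions that agree at each time agree on the space-time domain and have equal masses. -/
lemma IsWeakSolution.ae_eq_prod {vel : ℝ → ℝ → ℝ} {T : ℝ} {ρ₀ u : ℝ → ℝ} {ρ ρ' : ℝ → ℝ → ℝ}
    (hρ : IsWeakSolution vel T ρ₀ u ρ) (hρ' : IsWeakSolution vel T ρ₀ u ρ')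
    (heq : ∀ t ∈ Icc 0 T, ρ' t =ᵐ[volume.restrict (Ioo 0 1)] ρ t) :
    Function.uncurry ρ' =ᵐ[volume.restrict (Ioo 0 T ×ˢ Ioo 0 1)] Function.uncurry ρ ∧
      ∀ t ∈ Icc 0 T, mass ρ' t = mass ρ t := by
  constructor
  · have hi : IntegrableOn (fun q => ‖Function.uncurry ρ' q - Function.uncurry ρ q‖)
        (Ioo 0 T ×ˢ Ioo 0 1) := (hρ'.integrableOn.sub hρ.integrableOn).norm
    have h0 : ∫ q in Ioo 0 T ×ˢ Ioo (0 : ℝ) 1,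
        ‖Function.uncurry ρ' q - Function.uncurry ρ q‖ = 0 := by
      rw [Measure.volume_eq_prod, setIntegral_prod _ hi]
      refine setIntegral_eq_zero_of_forall_eq_zero fun t ht => ?_
      refine integral_eq_zero_of_ae ?_
      filter_upwards [heq t (Ioo_subset_Icc_self ht)] with x hx
      simp [Function.uncurry, hx]
    have h1 := (integral_eq_zero_iff_of_nonneg (fun _ => norm_nonneg _) hi).1 h0
    filter_upwards [h1] with q hq
    simpa [sub_eq_zero] using hq
  · intro t ht
    rw [mass, mass, intervalIntegral.integral_of_le zero_le_one,
      intervalIntegral.integral_of_le zero_le_one, integral_Ioc_eq_integral_Ioo,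
      integral_Ioc_eq_integral_Ioo]
    exact integral_congr_ae (heq t ht)

/-! ### Weak convergence and lower semicontinuity of the norm -/

/-- A bounded sequence whose primitives tend to zero tends weakly to zero. -/
lemma tendsto_integral_mul_of_tendsto_setIntegral_Iio {μ : Measure ℝ} [IsFiniteMeasure μ]
    {d : ℕ → ℝ → ℝ} {C : ℝ} (hd : ∀ n, AEStronglyMeasurable (d n) μ)
    (hC : ∀ n, ∀ᵐ x ∂μ, |d n x| ≤ C)
    (huniv : Tendsto (fun n => ∫ x, d n x ∂μ) atTop (𝓝 0))
    (hIio : ∀ t, Tendsto (fun n => ∫ x in Iio t, d n x ∂μ) atTop (𝓝 0))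
    {g : ℝ → ℝ} (hg : Integrable g μ) :
    Tendsto (fun n => ∫ x, g x * d n x ∂μ) atTop (𝓝 0) := by
  have hint : ∀ n, Integrable (d n) μ := fun n => Integrable.of_bound (hd n) C (hC n)
  have hmul : ∀ {g : ℝ → ℝ}, Integrable g μ → ∀ n, Integrable (fun x => g x * d n x) μ :=
    fun hg n => hg.mul_bdd (c := C) (hd n) (hC n)
  have hset : ∀ s, MeasurableSet s →
      Tendsto (fun n => ∫ x in s, d n x ∂μ) atTop (𝓝 0) := by
    refine MeasurableSpace.induction_on_inter (borel_eq_generateFrom_Iio ℝ) isPiSystem_Iio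
      ?_ ?_ ?_ ?_
    · simp
    · rintro _ ⟨t, rfl⟩
      exact hIio t
    · intro s hs h
      have h1 := huniv.sub h
      rw [sub_zero] at h1
      refine h1.congr fun n => ?_
      rw [← integral_add_compl hs (hint n)]
      ring
    · intro s hdis hs h
      have h1 : ∀ n, ∫ x in ⋃ i, s i, d n x ∂μ = ∑' i, ∫ x in s i, d n x ∂μ := fun n =>
        integral_iUnion hs hdis (hint n).integrableOn
      simp only [h1]
      have h2 : Summable fun i => C * μ.real (s i) := by
        refine Summable.mul_left C ?_
        refine ENNReal.summable_toReal ?_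
        rw [← measure_iUnion hdis hs]
        exact measure_ne_top _ _
      have h3 := tendsto_tsum_of_dominated_convergence (𝓕 := atTop)
        (f := fun n i => ∫ x in s i, d n x ∂μ) (g := fun _ => (0 : ℝ)) h2 h
        (Eventually.of_forall fun n i => ?_)
      · simpa using h3
      · exact norm_setIntegral_le_of_norm_le_const_ae (measure_lt_top _ _)
          (ae_restrict_of_ae (hC n))
  -- the functions `g` for which the claim holds are closed in `L¹`, as `d` is bounded
  refine Integrable.induction
    (P := fun g : ℝ → ℝ => Tendsto (fun n => ∫ x, g x * d n x ∂μ) atTop (𝓝 0))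
    ?_ ?_ ?_ ?_ hg
  · intro c s hs _
    have h1 := (hset s hs).const_mul c
    rw [mul_zero] at h1
    refine h1.congr fun n => ?_
    rw [← integral_const_mul, ← integral_indicator hs]
    refine integral_congr_ae (ae_of_all _ fun x => ?_)
    by_cases hx : x ∈ s <;> simp [hx]
  · intro f g _ hf hg hf1 hg1
    have h1 := hf1.add hg1
    rw [add_zero] at h1
    refine h1.congr fun n => ?_
    rw [← integral_add (hmul hf n) (hmul hg n)]
    simp only [Pi.add_apply, add_mul]
  · refine isClosed_of_closure_subset fun f hf => ?_
    rw [mem_ofPred_eq, Metric.tendsto_atTop]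
    intro ε hε
    have hC1 : 0 < |C| + 1 := by positivity
    obtain ⟨f', hf', hff'⟩ := Metric.mem_closure_iff.1 hf (ε / 2 / (|C| + 1)) (by positivity)
    obtain ⟨N, hN⟩ := Metric.tendsto_atTop.1 hf' (ε / 2) (by positivity)
    refine ⟨N, fun n hn => ?_⟩
    have h1 := hN n hn
    rw [dist_zero_right] at h1 ⊢
    have h2 : ‖∫ x, (f x - f' x) * d n x ∂μ‖ ≤ dist f f' * (|C| + 1) := by
      rw [L1.dist_eq_integral_dist, ← integral_mul_const]
      refine norm_integral_le_of_norm_le (((L1.integrable_coeFn f).sub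
        (L1.integrable_coeFn f')).norm.mul_const _) ?_
      filter_upwards [hC n] with x hx
      rw [norm_mul]
      refine mul_le_mul_of_nonneg_left ?_ (norm_nonneg _)
      rw [Real.norm_eq_abs]
      linarith [le_abs_self C]
    have h3 : ∫ x, f x * d n x ∂μ =
        ∫ x, (f x - f' x) * d n x ∂μ + ∫ x, f' x * d n x ∂μ := by
      have hsub : Integrable (fun x => f x - f' x) μ :=
        (L1.integrable_coeFn f).sub (L1.integrable_coeFn f')
      rw [← integral_add (hmul hsub n) (hmul (L1.integrable_coeFn f') n)]
      refine integral_congr_ae (ae_of_all _ fun x => ?_)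
      ring
    rw [h3]
    have h4 : dist f f' * (|C| + 1) < ε / 2 := by rwa [lt_div_iff₀ hC1] at hff'
    linarith [norm_add_le (∫ x, (f x - f' x) * d n x ∂μ) (∫ x, f' x * d n x ∂μ)]
  · intro f g hfg _ hf
    refine hf.congr fun n => integral_congr_ae ?_
    filter_upwards [hfg] with x hx
    rw [hx]

/-- The graph of `|·| ^ q` lies above its tangents. -/
lemma abs_rpow_tangent_le {q : ℝ} (hq : 1 ≤ q) (a b : ℝ) :
    |a| ^ q + q * (|a| ^ (q - 1) * SignType.sign a) * (b - a) ≤ |b| ^ q := by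
  rcases eq_or_ne a 0 with rfl | ha
  · simp [Real.zero_rpow (by linarith : q ≠ 0)]
    positivity
  have ha' : 0 < |a| := abs_pos.2 ha
  have h1 := one_add_mul_self_le_rpow_one_add (s := |b| / |a| - 1)
    (by linarith [div_nonneg (abs_nonneg b) ha'.le]) hq
  rw [add_sub_cancel, Real.div_rpow (abs_nonneg b) ha'.le, le_div_iff₀ (by positivity)] at h1
  have h2 : |a| ^ q = |a| ^ (q - 1) * |a| := by
    rw [Real.rpow_sub_one ha'.ne']
    field_simp
  have h3 : (SignType.sign a : ℝ) * b ≤ |b| := by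
    refine (le_abs_self _).trans ?_
    rw [abs_mul]
    exact mul_le_of_le_one_left (abs_nonneg b) (by
      rcases ha.lt_or_gt with h | h <;> simp [h])
  have h4 : (SignType.sign a : ℝ) * a = |a| := sign_mul_self a
  refine le_trans ?_ h1
  have h5 : (1 + q * (|b| / |a| - 1)) * |a| ^ q = |a| ^ q + q * |a| ^ (q - 1) * (|b| - |a|) := by
    rw [h2]
    field_simp
  rw [h5]
  have h6 : 0 ≤ q * |a| ^ (q - 1) := by positivity
  nlinarith [mul_le_mul_of_nonneg_left h3 h6]

/-- Along bounded sequences that converge weakly the `L^p` norm is lower semicontinuous. -/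
lemma eLpNorm_le_of_tendsto_integral_mul {μ : Measure ℝ} [IsFiniteMeasure μ]
    {f : ℕ → ℝ → ℝ} {g : ℝ → ℝ} {p : ENNReal} (hp : 1 ≤ p) (hp' : p ≠ ⊤)
    (hf : ∀ n, MemLp (f n) ⊤ μ) (hg : MemLp g ⊤ μ)
    (h : ∀ w : ℝ → ℝ, Integrable w μ →
      Tendsto (fun n => ∫ x, w x * (f n x - g x) ∂μ) atTop (𝓝 0))
    {c : ℝ} (hc : Tendsto (fun n => (eLpNorm (f n) p μ).toReal) atTop (𝓝 c)) :
    (eLpNorm g p μ).toReal ≤ c := by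
  have hp0 : p ≠ 0 := (zero_lt_one.trans_le hp).ne'
  have hq : 1 ≤ p.toReal := by
    rw [← ENNReal.toReal_one]
    exact ENNReal.toReal_mono hp' hp
  set q := p.toReal with hqdef
  have hq0 : q ≠ 0 := by linarith
  have hpow : ∀ {k : ℝ → ℝ}, MemLp k ⊤ μ →
      (eLpNorm k p μ).toReal ^ q = ∫ x, |k x| ^ q ∂μ := fun {k} hk => by
    have hnn : 0 ≤ ∫ x, |k x| ^ q ∂μ := integral_nonneg fun x => by positivity
    rw [(hk.mono_exponent le_top).eLpNorm_eq_integral_rpow_norm hp0 hp',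
      ENNReal.toReal_ofReal (by positivity)]
    simp only [Real.norm_eq_abs, ← hqdef]
    exact Real.rpow_inv_rpow hnn hq0
  have hint : ∀ {k : ℝ → ℝ}, MemLp k ⊤ μ → Integrable (fun x => |k x| ^ q) μ := fun {k} hk => by
    have h1 : MemLp k p μ := hk.mono_exponent le_top
    simpa only [Real.norm_eq_abs] using h1.integrable_norm_rpow hp0 hp'
  -- the slope of the tangent at the limit
  set w : ℝ → ℝ := fun x => q * (|g x| ^ (q - 1) * SignType.sign (g x)) with hw
  obtain ⟨C, hC⟩ : ∃ C, ∀ᵐ x ∂μ, |g x| ≤ C := by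
    refine ⟨(eLpNorm g ⊤ μ).toReal, ?_⟩
    filter_upwards [ae_le_eLpNormEssSup (f := g) (μ := μ)] with x hx
    rw [← eLpNorm_exponent_top] at hx
    have := ENNReal.toReal_mono hg.2.ne hx
    simpa using this
  have hwm : AEStronglyMeasurable w μ := by
    have hgm : AEMeasurable g μ := hg.1.aemeasurable
    have hs : Measurable fun x : ℝ => q * (|x| ^ (q - 1) * (SignType.sign x : ℝ)) := by
      have : Measurable fun x : ℝ => (SignType.sign x : ℝ) := by
        have he : (fun x : ℝ => (SignType.sign x : ℝ)) =
            fun x => if 0 < x then 1 else if x < 0 then -1 else 0 := by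
          ext x
          rcases lt_trichotomy x 0 with h | h | h <;> simp [h, h.le, not_lt.2]
        rw [he]
        exact Measurable.ite measurableSet_Ioi measurable_const
          (Measurable.ite measurableSet_Iio measurable_const measurable_const)
      fun_prop
    exact (hs.comp_aemeasurable hgm).aestronglyMeasurable
  have hwi : Integrable w μ := by
    refine Integrable.of_bound hwm (q * C ^ (q - 1)) ?_
    filter_upwards [hC] with x hx
    rw [hw, norm_mul, norm_mul, Real.norm_eq_abs, abs_of_pos (by linarith),
      Real.norm_of_nonneg (by positivity)]
    refine mul_le_mul_of_nonneg_left ?_ (by linarith)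
    have h1 : |g x| ^ (q - 1) ≤ C ^ (q - 1) :=
      Real.rpow_le_rpow (abs_nonneg _) hx (by linarith)
    refine le_trans (mul_le_of_le_one_right (by positivity) ?_) h1
    rcases lt_trichotomy (g x) 0 with h | h | h <;> simp [h]
  have hle : ∀ n, (∫ x, |g x| ^ q ∂μ) + ∫ x, w x * (f n x - g x) ∂μ ≤
      (eLpNorm (f n) p μ).toReal ^ q := fun n => by
    have hwi' : Integrable (fun x => w x * (f n x - g x)) μ := by
      refine (MemLp.integrable_mul (p := 1) (q := ⊤) (memLp_one_iff_integrable.2 hwi)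
        ((hf n).sub hg))
    rw [hpow (hf n), ← integral_add (hint hg) hwi']
    exact integral_mono ((hint hg).add hwi') (hint (hf n)) fun x =>
      abs_rpow_tangent_le hq (g x) (f n x)
  have hc0 : 0 ≤ c := ge_of_tendsto' hc fun _ => ENNReal.toReal_nonneg
  have hlim := le_of_tendsto_of_tendsto' ((h w hwi).const_add (∫ x, |g x| ^ q ∂μ))
    (hc.rpow_const (Or.inr (by linarith : 0 ≤ q))) hle
  rw [add_zero, ← hpow hg] at hlim
  exact (Real.rpow_le_rpow_iff ENNReal.toReal_nonneg hc0 (by linarith)).1 hlim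

/-! ### Compactness of bounded controls -/

/-- On `[0,T]` a nondecreasing Lipschitz function that starts from `0` is the primitive of a datum,
namely of its almost everywhere defined derivative. -/
lemma exists_isData_primitive_eq {T ℓ : ℝ} (hℓ : 0 ≤ ℓ) {V : ℝ → ℝ}
    (hlip : ∀ s t, |V s - V t| ≤ ℓ * |s - t|) (hmono : Monotone V) (h0 : V 0 = 0) :
    ∃ v, IsData T ℓ v ∧ ∀ t ∈ Icc 0 T, ∫ s in (0 : ℝ)..t, v s = V t := by
  have hL : LipschitzWith ⟨ℓ, hℓ⟩ V := LipschitzWith.of_dist_le_mul fun s t => hlip s t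
  have hle : ∀ x, deriv V x ≤ ℓ := fun x =>
    (le_abs_self _).trans (norm_deriv_le_of_lipschitz hL)
  refine ⟨(Ioo 0 T).indicator (deriv V), ⟨(measurable_deriv V).indicator measurableSet_Ioo,
    fun x => indicator_nonneg (fun x _ => hmono.deriv_nonneg) x,
    fun x => indicator_le' (fun x _ => hle x) (fun _ _ => hℓ) x,
    fun x hx => indicator_of_notMem hx _⟩, fun t ht => ?_⟩
  have h1 :=
    (hL.lipschitzOnWith (s := uIcc 0 t)).absolutelyContinuousOnInterval.integral_deriv_eq_sub
  rw [h0, sub_zero] at h1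
  rw [← h1, intervalIntegral.integral_of_le ht.1, intervalIntegral.integral_of_le ht.1,
    integral_Ioc_eq_integral_Ioo, integral_Ioc_eq_integral_Ioo]
  exact setIntegral_congr_fun measurableSet_Ioo fun s hs =>
    indicator_of_mem (show s ∈ Ioo 0 T from ⟨hs.1, hs.2.trans_le ht.2⟩) _

/-- The primitives of a sequence of data whose bounds converge have a subsequence that converges
uniformly to the primitive of a datum satisfying the limit bound. -/
lemma exists_subseq_tendsto_primitive {T ℓ : ℝ} (hT : 0 ≤ T) {u : ℕ → ℝ → ℝ} {N : ℕ → ℝ}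
    (hu : ∀ n, IsData T (N n) (u n)) (hN : Tendsto N atTop (𝓝 ℓ)) :
    ∃ (v : ℝ → ℝ) (k : ℕ → ℕ), StrictMono k ∧ IsData T ℓ v ∧
      ∀ ε > 0, ∀ᶠ n in atTop, ∀ t ∈ Icc 0 T,
        |(∫ s in (0 : ℝ)..t, v s) - ∫ s in (0 : ℝ)..t, u (k n) s| ≤ ε := by
  obtain ⟨L, hL⟩ := hN.bddAbove_range
  have hNL : ∀ n, N n ≤ L := fun n => hL ⟨n, rfl⟩
  have hL0 : 0 ≤ L := (hu 0).bound_nonneg.trans (hNL 0)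
  have hlip : ∀ n s t, |(∫ r in (0 : ℝ)..s, u n r) - ∫ r in (0 : ℝ)..t, u n r| ≤ L * |s - t| :=
    fun n s t => ((hu n).abs_primitive_sub_le s t).trans
      (mul_le_mul_of_nonneg_right (hNL n) (abs_nonneg _))
  -- the Arzelà–Ascoli theorem for the primitives, restricted to `[0,T]`
  let F : ℕ → BoundedContinuousFunction (Icc 0 T) ℝ := fun n =>
    BoundedContinuousFunction.mkOfCompact ⟨fun t => ∫ r in (0 : ℝ)..t, u n r,
      (continuous_of_abs_sub_le hL0 (hlip n)).comp continuous_subtype_val⟩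
  have hF : ∀ n t, F n t = ∫ r in (0 : ℝ)..t, u n r := fun _ _ => rfl
  have hcomp : IsCompact (closure (range F)) := by
    refine BoundedContinuousFunction.arzela_ascoli (Icc 0 (L * T)) isCompact_Icc _ ?_ ?_
    · rintro _ t ⟨n, rfl⟩
      refine ⟨(hu n).primitive_nonneg t.2.1, ?_⟩
      have h1 := hlip n t 0
      rw [intervalIntegral.integral_same, sub_zero, sub_zero, abs_of_nonneg t.2.1] at h1
      exact (le_abs_self _).trans (h1.trans (mul_le_mul_of_nonneg_left t.2.2 hL0))
    · refine Metric.equicontinuous_of_continuity_modulus (fun x => L * x) ?_ _ ?_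
      · have : Tendsto (fun x : ℝ => L * x) (𝓝 0) (𝓝 (L * 0)) := tendsto_id.const_mul L
        rwa [mul_zero] at this
      · rintro s t ⟨_, n, rfl⟩
        exact hlip n s t
  obtain ⟨G, -, k, hk, hG⟩ := hcomp.tendsto_subseq fun n => subset_closure (mem_range_self n)
  have hunif := BoundedContinuousFunction.tendsto_iff_tendstoUniformly.1 hG
  have hpt : ∀ t, Tendsto (fun n => F (k n) t) atTop (𝓝 (G t)) := fun t => hunif.tendsto_at t
  have hNk := hN.comp hk.tendsto_atTop
  have hℓ : 0 ≤ ℓ := ge_of_tendsto' hN fun n => (hu n).bound_nonneg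
  obtain ⟨v, hv, hvG⟩ := exists_isData_primitive_eq (V := fun t => G (projIcc 0 T hT t)) hℓ
    (fun s t => by
      refine le_of_tendsto_of_tendsto' ((hpt (projIcc 0 T hT s)).sub (hpt (projIcc 0 T hT t))).abs
        (hNk.mul_const |s - t|) fun n => ?_
      refine ((hu (k n)).abs_primitive_sub_le _ _).trans
        (mul_le_mul_of_nonneg_left ?_ (hu (k n)).bound_nonneg)
      exact abs_projIcc_sub_projIcc hT)
    (fun s t hst => le_of_tendsto_of_tendsto' (hpt _) (hpt _) fun n =>
      (hu (k n)).primitive_mono (monotone_projIcc hT hst))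
    (tendsto_nhds_unique (hpt _) (by simp [hF]))
  refine ⟨v, k, hk, hv, fun ε hε => ?_⟩
  filter_upwards [Metric.tendstoUniformly_iff.1 hunif ε hε] with n hn t ht
  rw [hvG t ht, projIcc_of_mem hT ht]
  exact (hn ⟨t, ht⟩).le

/-! ### Existence of an optimal control -/

/-- The response of the system to the control `u`: the mass `W` solves the mass equation, and the
out-flux `y` is bounded by `C` and accounts for all the mass that is no longer present. -/
structure IsResponse (a : ℝ → ℝ → ℝ) (T C : ℝ) (ρ₀ u W y : ℝ → ℝ) : Prop where
  continuous_mass : Continuous W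
  mass_eq : ∀ t ∈ Icc 0 T, W t = massMap a (fun t => ∫ s in (0 : ℝ)..t, u s)
    (fun x => ∫ y in (0 : ℝ)..x, ρ₀ y) W t
  measurable : Measurable y
  bound : ∀ t ∈ Icc 0 T, |y t| ≤ C
  integral_eq : ∀ t ∈ Icc 0 T, ∫ s in (0 : ℝ)..t, y s =
    (∫ x in (0 : ℝ)..1, ρ₀ x) + (∫ s in (0 : ℝ)..t, u s) - W t

/-- Every control has a response, with a bound that depends on the control only through its norm. -/
lemma exists_isResponse {vel : ℝ → ℝ → ℝ} {m Λ K T B L M : ℝ} {ρ₀ u : ℝ → ℝ}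
    (h : IsSpeed (clampSpeed vel M) m Λ K) (hT : 0 < T) (hρ₀ : IsData 1 B ρ₀)
    (hu : IsData T L u) (hM : L * T + ∫ x in (0 : ℝ)..1, ρ₀ x ≤ M) :
    ∃ (W : ℝ → ℝ) (ρ : ℝ → ℝ → ℝ) (y : ℝ → ℝ),
      IsResponse (clampSpeed vel M) T ((B + L * m⁻¹) * Real.exp (K * T) * Λ) ρ₀ u W y ∧
      IsWeakSolution vel T ρ₀ u ρ ∧ IsOutflux vel T ρ y := by
  obtain ⟨W, hW, hfix⟩ := h.exists_massMap_fixed hT.le hu.bound_nonneg hρ₀.bound_nonneg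
    hu.abs_primitive_sub_le hρ₀.abs_primitive_sub_le
  have hUT : ∫ s in (0 : ℝ)..T, u s ≤ L * T := by
    have h1 := hu.abs_primitive_sub_le T 0
    rw [intervalIntegral.integral_same, sub_zero, sub_zero, abs_of_pos hT] at h1
    exact (le_abs_self _).trans h1
  obtain ⟨hmass, hWM, hweak⟩ := isWeakSolution_transported h hW hρ₀ hu hT (by linarith) hfix
  have h11 : (1 : ℝ) ∈ Icc (0 : ℝ) 1 := right_mem_Icc.2 zero_le_one
  refine ⟨W, _, fun t => transported (clampSpeed vel M) ρ₀ u W t 1 * clampSpeed vel M 1 (W t),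
    ⟨hW, hfix, ?_, fun t ht => ?_, fun t ht => ?_⟩, hweak, ?_⟩
  · exact ((h.measurable_transported hW hρ₀ hu).comp
      (measurable_id.prodMk measurable_const)).mul
        (h.continuous_comp continuous_const hW).measurable
  · rw [abs_mul, abs_of_pos (h.pos 1 (W t))]
    exact mul_le_mul (h.abs_transported_le hρ₀ hu ht 1) (h.upper _ _) (h.pos _ _).le
      ((abs_nonneg _).trans (h.abs_transported_le (W := W) hρ₀ hu ht 1))
  · rw [h.integral_outflux hW hρ₀ hu ht.1, ← hfix t ht]
  · obtain ⟨r, hr, hrc, hry⟩ := isOutflux_transported (vel := vel) h hW hρ₀ hu hT.le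
    refine ⟨r, hr, hrc, EventuallyEq.trans ?_ hry⟩
    filter_upwards [ae_restrict_mem measurableSet_Ioo] with t ht
    have ht' := Ioo_subset_Icc_self ht
    rw [hmass t ht', clampSpeed_of_mem vel h11 (hWM t ht')]

namespace IsResponse

variable {a : ℝ → ℝ → ℝ} {T C : ℝ} {ρ₀ v V z : ℝ → ℝ}

lemma intervalIntegrable (h : IsResponse a T C ρ₀ v V z) {t : ℝ} (ht : t ∈ Icc 0 T) :
    IntervalIntegrable z volume 0 t := by
  refine (intervalIntegrable_const (c := C)).mono_fun' h.measurable.aestronglyMeasurable ?_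
  filter_upwards [ae_restrict_mem measurableSet_uIoc] with s hs
  rw [uIoc_of_le ht.1] at hs
  exact h.bound s ⟨hs.1.le, hs.2.trans ht.2⟩

lemma ae_bound (h : IsResponse a T C ρ₀ v V z) :
    ∀ᵐ t ∂(volume.restrict (Ioo 0 T)), |z t| ≤ C := by
  filter_upwards [ae_restrict_mem measurableSet_Ioo] with t ht
  exact h.bound t (Ioo_subset_Icc_self ht)

lemma memLp_top (h : IsResponse a T C ρ₀ v V z) : MemLp z ⊤ (volume.restrict (Ioo 0 T)) :=
  memLp_top_of_bound h.measurable.aestronglyMeasurable C h.ae_bound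

/-- If the primitives of the controls converge uniformly, then so do the masses, hence the
primitives of the out-fluxes. -/
lemma tendsto_integral_sub {m Λ K B L : ℝ} {w W y : ℕ → ℝ → ℝ} (h : IsSpeed a m Λ K)
    (hρ₀ : IsData 1 B ρ₀) (hv : IsData T L v)
    (hconv : ∀ ε > 0, ∀ᶠ n in atTop, ∀ t ∈ Icc 0 T,
      |(∫ s in (0 : ℝ)..t, v s) - ∫ s in (0 : ℝ)..t, w n s| ≤ ε)
    (hy : ∀ n, IsResponse a T C ρ₀ (w n) (W n) (y n)) (hz : IsResponse a T C ρ₀ v V z)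
    {t : ℝ} (ht : t ∈ Icc 0 T) :
    Tendsto (fun n => ∫ s in (0 : ℝ)..t, (y n s - z s)) atTop (𝓝 0) := by
  rw [Metric.tendsto_atTop]
  intro ε hε
  set D := 1 + 2 * Real.exp (massConst m K T L B * t) with hD
  have hD0 : 0 < D := by positivity
  obtain ⟨n₀, hn₀⟩ := eventually_atTop.1 (hconv (ε / 2 / D) (by positivity))
  refine ⟨n₀, fun n hn => ?_⟩
  have h1 := hn₀ n hn
  have h2 := h.abs_sub_le_of_massMap_fixed hz.continuous_mass (hy n).continuous_mass
    hv.bound_nonneg hρ₀.bound_nonneg hv.abs_primitive_sub_le hρ₀.abs_primitive_sub_le h1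
    hz.mass_eq (hy n).mass_eq t ht
  rw [intervalIntegral.integral_sub ((hy n).intervalIntegrable ht) (hz.intervalIntegrable ht),
    (hy n).integral_eq t ht, hz.integral_eq t ht, dist_zero_right, Real.norm_eq_abs]
  have h3 := abs_add_le (V t - W n t)
    ((∫ s in (0 : ℝ)..t, w n s) - ∫ s in (0 : ℝ)..t, v s)
  have h4 := h1 t ht
  rw [abs_sub_comm] at h4
  have h5 : ε / 2 / D * D = ε / 2 := div_mul_cancel₀ _ hD0.ne'
  have h6 : (∫ x in (0 : ℝ)..1, ρ₀ x) + (∫ s in (0 : ℝ)..t, w n s) - W n t -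
      ((∫ x in (0 : ℝ)..1, ρ₀ x) + (∫ s in (0 : ℝ)..t, v s) - V t) = (V t - W n t) +
      ((∫ s in (0 : ℝ)..t, w n s) - ∫ s in (0 : ℝ)..t, v s) := by ring
  rw [h6]
  have h7 : ε / 2 / D * D = ε / 2 / D +
      2 * (ε / 2 / D) * Real.exp (massConst m K T L B * t) := by rw [hD]; ring
  linarith

/-- If the primitives of the controls converge uniformly, then the out-fluxes converge weakly. -/
lemma tendsto_integral_mul_sub {m Λ K B L : ℝ} {w W y : ℕ → ℝ → ℝ} (h : IsSpeed a m Λ K)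
    (hT : 0 ≤ T) (hρ₀ : IsData 1 B ρ₀) (hv : IsData T L v)
    (hconv : ∀ ε > 0, ∀ᶠ n in atTop, ∀ t ∈ Icc 0 T,
      |(∫ s in (0 : ℝ)..t, v s) - ∫ s in (0 : ℝ)..t, w n s| ≤ ε)
    (hy : ∀ n, IsResponse a T C ρ₀ (w n) (W n) (y n)) (hz : IsResponse a T C ρ₀ v V z)
    {g : ℝ → ℝ} (hg : Integrable g (volume.restrict (Ioo 0 T))) :
    Tendsto (fun n => ∫ t in Ioo 0 T, g t * (y n t - z t)) atTop (𝓝 0) := by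
  have hprim := fun t (ht : t ∈ Icc 0 T) => tendsto_integral_sub h hρ₀ hv hconv hy hz ht
  refine tendsto_integral_mul_of_tendsto_setIntegral_Iio (d := fun n t => y n t - z t)
    (C := 2 * C) (fun n => ((hy n).measurable.sub hz.measurable).aestronglyMeasurable)
    (fun n => ?_) ?_ (fun t => ?_) hg
  · filter_upwards [(hy n).ae_bound, hz.ae_bound] with t h1 h2
    linarith [abs_sub (y n t) (z t)]
  · refine (hprim T (right_mem_Icc.2 hT)).congr fun n => ?_
    rw [intervalIntegral.integral_of_le hT, integral_Ioc_eq_integral_Ioo]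
  · have ht : max 0 (min T t) ∈ Icc 0 T := ⟨le_max_left _ _, max_le hT (min_le_left _ _)⟩
    refine (hprim _ ht).congr fun n => ?_
    rw [intervalIntegral.integral_of_le ht.1, integral_Ioc_eq_integral_Ioo,
      Measure.restrict_restrict measurableSet_Iio]
    congr 2
    ext s
    simp only [mem_inter_iff, mem_Iio, mem_Ioo, lt_max_iff, lt_min_iff]
    constructor
    · rintro ⟨h1, h2 | h2⟩
      · exact absurd h1 h2.not_gt
      · exact ⟨h2.2, h1, h2.1⟩
    · rintro ⟨h1, h2, h3⟩
      exact ⟨h2, Or.inr ⟨h3, h1⟩⟩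

end IsResponse

/-- The out-flux chosen in `outflux` agrees with that of any weak solution. -/
lemma outflux_ae_eq {vel : ℝ → ℝ → ℝ} {T B L : ℝ} {ρ₀ ρ₀' u u' : ℝ → ℝ}
    (hvel : ContDiffOn ℝ 1 (Function.uncurry vel) (Icc 0 1 ×ˢ Ici 0))
    (hpos : ∀ x ∈ Icc (0 : ℝ) 1, ∀ W ∈ Ici (0 : ℝ), 0 < vel x W) (hT : 0 < T)
    (hρ₀ : IsData 1 B ρ₀') (hu : IsData T L u')
    (hρ₀' : ρ₀' =ᵐ[volume.restrict (Ioo 0 1)] ρ₀) (hu' : u' =ᵐ[volume.restrict (Ioo 0 T)] u)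
    {ρ : ℝ → ℝ → ℝ} {y : ℝ → ℝ} (hρ : IsWeakSolution vel T ρ₀' u' ρ)
    (hy : IsOutflux vel T ρ y) : outflux vel T ρ₀ u =ᵐ[volume.restrict (Ioo 0 T)] y := by
  obtain ⟨ρ', hρ', hy'⟩ := Classical.epsilon_spec
    (p := fun y => ∃ ρ, IsWeakSolution vel T ρ₀ u ρ ∧ IsOutflux vel T ρ y)
    ⟨y, ρ, hρ.congr_data hρ₀' hu', hy⟩
  have h1 := hρ'.congr_data hρ₀'.symm hu'.symm
  have h2 := hρ.ae_eq_prod h1 (IsWeakSolution.unique hvel hpos hT hρ₀ hu hρ h1)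
  exact IsOutflux.unique h2.1 h2.2 hy hy'

lemma IsData.mono {L B B' : ℝ} {f : ℝ → ℝ} (h : IsData L B f) (hB : B ≤ B') : IsData L B' f :=
  ⟨h.measurable, h.nonneg, fun x => (h.le_bound x).trans hB, h.eq_zero⟩

lemma IsData.mem_LInftyPos {L B : ℝ} {f : ℝ → ℝ} (h : IsData L B f) : f ∈ LInftyPos L :=
  ⟨memLp_top_of_bound h.measurable.aestronglyMeasurable B (ae_of_all _ h.abs_le),
    ae_of_all _ h.nonneg⟩

lemma IsData.eLpNorm_top_le {L B : ℝ} {f : ℝ → ℝ} (h : IsData L B f) :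
    (eLpNorm f ⊤ (volume.restrict (Ioo 0 L))).toReal ≤ B := by
  refine ENNReal.toReal_le_of_le_ofReal h.bound_nonneg ?_
  rw [eLpNorm_exponent_top]
  refine eLpNormEssSup_le_of_ae_bound (ae_of_all _ h.abs_le)

/-- The tracking error is lower semicontinuous along controls with convergent primitives. -/
lemma eLpNorm_outflux_sub_le {vel : ℝ → ℝ → ℝ}
    (hvel : ContDiffOn ℝ 1 (Function.uncurry vel) (Icc 0 1 ×ˢ Ici 0))
    (hpos : ∀ x ∈ Icc (0 : ℝ) 1, ∀ W ∈ Ici (0 : ℝ), 0 < vel x W) {T : ℝ} (hT : 0 < T)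
    {p : ENNReal} (hp : 1 ≤ p) (hp' : p ≠ ⊤) {yd : ℝ → ℝ}
    (hyd : MemLp yd ⊤ (volume.restrict (Ioo 0 T))) {ρ₀ : ℝ → ℝ} (hρ₀ : ρ₀ ∈ LInftyPos 1)
    {L : ℝ} {u w : ℕ → ℝ → ℝ} {v : ℝ → ℝ} (hw : ∀ n, IsData T L (w n))
    (hwu : ∀ n, w n =ᵐ[volume.restrict (Ioo 0 T)] u n) (hv : IsData T L v)
    (hconv : ∀ ε > 0, ∀ᶠ n in atTop, ∀ t ∈ Icc 0 T,
      |(∫ s in (0 : ℝ)..t, v s) - ∫ s in (0 : ℝ)..t, w n s| ≤ ε) {c : ℝ}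
    (hc : Tendsto (fun n => (eLpNorm (fun t => outflux vel T ρ₀ (u n) t - yd t) p
      (volume.restrict (Ioo 0 T))).toReal) atTop (𝓝 c)) :
    (eLpNorm (fun t => outflux vel T ρ₀ v t - yd t) p (volume.restrict (Ioo 0 T))).toReal ≤ c := by
  obtain ⟨r, hr, hrρ⟩ := exists_isData hρ₀ le_rfl
  have hL0 := hv.bound_nonneg
  have hR0 : 0 ≤ ∫ x in (0 : ℝ)..1, r x := hr.primitive_nonneg zero_le_one
  -- one truncation of the speed, and one bound of the out-fluxes, for all the controls
  obtain ⟨m, Λ, K, h⟩ := exists_isSpeed_clampSpeed hvel hpos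
    (add_nonneg (mul_nonneg hL0 hT.le) hR0)
  choose W ρ y hW hρ hy using fun n => exists_isResponse h hT hr (hw n) le_rfl
  obtain ⟨V, σ, z, hV, hσ, hz⟩ := exists_isResponse h hT hr hv le_rfl
  have h1 : eLpNorm (fun t => outflux vel T ρ₀ v t - yd t) p (volume.restrict (Ioo 0 T)) =
      eLpNorm (fun t => z t - yd t) p (volume.restrict (Ioo 0 T)) := by
    refine eLpNorm_congr_ae ?_
    filter_upwards [outflux_ae_eq hvel hpos hT hr hv hrρ EventuallyEq.rfl hσ hz] with t ht
    rw [ht]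
  have h2 : ∀ n, eLpNorm (fun t => outflux vel T ρ₀ (u n) t - yd t) p
      (volume.restrict (Ioo 0 T)) =
      eLpNorm (fun t => y n t - yd t) p (volume.restrict (Ioo 0 T)) := fun n => by
    refine eLpNorm_congr_ae ?_
    filter_upwards [outflux_ae_eq hvel hpos hT hr (hw n) hrρ (hwu n) (hρ n) (hy n)] with t ht
    rw [ht]
  simp only [h2] at hc
  rw [h1]
  refine eLpNorm_le_of_tendsto_integral_mul hp hp' (f := fun n t => y n t - yd t)
    (g := fun t => z t - yd t) (fun n => (hW n).memLp_top.sub hyd) (hV.memLp_top.sub hyd)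
    (fun g hg => ?_) hc
  simpa only [sub_sub_sub_cancel_right] using
    IsResponse.tendsto_integral_mul_sub h hT.le hr hv hconv hW hV hg

/-- The direct method: the norms of a minimizing sequence converge along a subsequence, and neither
term of the cost is larger at the limit control than the limit of the corresponding terms. -/
theorem exists_isLeast_cost {vel : ℝ → ℝ → ℝ}
    (hvel : ContDiffOn ℝ 1 (Function.uncurry vel) (Icc 0 1 ×ˢ Ici 0))
    (hpos : ∀ x ∈ Icc (0 : ℝ) 1, ∀ W ∈ Ici (0 : ℝ), 0 < vel x W) {T : ℝ} (hT : 0 < T)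
    {p : ENNReal} (hp : 1 ≤ p) (hp' : p ≠ ⊤) {yd : ℝ → ℝ}
    (hyd : MemLp yd ⊤ (volume.restrict (Ioo 0 T))) {ρ₀ : ℝ → ℝ} (hρ₀ : ρ₀ ∈ LInftyPos 1) :
    ∃ v ∈ LInftyPos T, IsLeast (cost vel T ρ₀ p yd '' LInftyPos T) (cost vel T ρ₀ p yd v) := by
  set μ := volume.restrict (Ioo 0 T)
  set J := cost vel T ρ₀ p yd
  set N : (ℝ → ℝ) → ℝ := fun u => (eLpNorm u ⊤ μ).toReal
  set E : (ℝ → ℝ) → ℝ := fun u =>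
    (eLpNorm (fun t => outflux vel T ρ₀ u t - yd t) p μ).toReal
  have hJNE : ∀ u, J u = N u ^ 2 + E u ^ 2 := fun _ => rfl
  have hbdd : BddBelow (J '' LInftyPos T) := ⟨0, by
    rintro _ ⟨u, -, rfl⟩
    rw [hJNE]
    positivity⟩
  have hne : (J '' LInftyPos T).Nonempty := by
    refine Set.Nonempty.image _ ⟨fun _ => 0, MemLp.zero, ae_of_all _ fun _ => le_rfl⟩
  -- a minimizing sequence, and a subsequence along which the norms of the controls converge
  obtain ⟨c, -, hcI, hc⟩ := exists_seq_tendsto_sInf hne hbdd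
  choose u₁ hu₁ hu₁c using hc
  obtain ⟨Q, hQ⟩ := hcI.bddAbove_range
  have hNQ : ∀ n, N (u₁ n) ∈ Icc 0 (Q + 1) := fun n => by
    refine ⟨ENNReal.toReal_nonneg, ?_⟩
    have h1 : c n ≤ Q := hQ ⟨n, rfl⟩
    rw [← hu₁c n, hJNE] at h1
    nlinarith [sq_nonneg (N (u₁ n) - 1), sq_nonneg (E (u₁ n))]
  obtain ⟨ℓ, -, k₁, hk₁, hNℓ⟩ := isCompact_Icc.tendsto_subseq hNQ
  choose u₂ hu₂ hu₂e using fun n => exists_isData (hu₁ (k₁ n)) (le_refl (N (u₁ (k₁ n))))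
  obtain ⟨v, k₂, hk₂, hv, hconv⟩ := exists_subseq_tendsto_primitive hT.le hu₂ hNℓ
  set k : ℕ → ℕ := k₁ ∘ k₂
  have hNk : Tendsto (fun n => N (u₁ (k n))) atTop (𝓝 ℓ) := hNℓ.comp hk₂.tendsto_atTop
  have hJk : Tendsto (fun n => J (u₁ (k n))) atTop (𝓝 (sInf (J '' LInftyPos T))) :=
    (hcI.comp (hk₁.comp hk₂).tendsto_atTop).congr fun n => (hu₁c _).symm
  have hEk : Tendsto (fun n => E (u₁ (k n))) atTop
      (𝓝 (Real.sqrt (sInf (J '' LInftyPos T) - ℓ ^ 2))) := by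
    refine ((hJk.sub (hNk.pow 2)).sqrt).congr fun n => ?_
    rw [hJNE, add_sub_cancel_left]
    exact Real.sqrt_sq ENNReal.toReal_nonneg
  obtain ⟨L, hL⟩ := hNk.bddAbove_range
  have hNL : ∀ n, N (u₁ (k n)) ≤ L := fun n => hL ⟨n, rfl⟩
  have hEv : E v ≤ Real.sqrt (sInf (J '' LInftyPos T) - ℓ ^ 2) :=
    eLpNorm_outflux_sub_le hvel hpos hT hp hp' hyd hρ₀ (fun n => (hu₂ (k₂ n)).mono (hNL n))
      (fun n => hu₂e (k₂ n)) (hv.mono (le_of_tendsto' hNk hNL)) hconv hEk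
  have hℓE : 0 ≤ sInf (J '' LInftyPos T) - ℓ ^ 2 := by
    refine ge_of_tendsto' (hJk.sub (hNk.pow 2)) fun n => ?_
    rw [hJNE, add_sub_cancel_left]
    positivity
  have hvmem := hv.mem_LInftyPos
  refine ⟨v, hvmem, ⟨v, hvmem, rfl⟩, fun j hj => ?_⟩
  refine le_trans ?_ (csInf_le hbdd hj)
  have h1 : N v ^ 2 ≤ ℓ ^ 2 := pow_le_pow_left₀ ENNReal.toReal_nonneg hv.eLpNorm_top_le 2
  have h2 : E v ^ 2 ≤ sInf (J '' LInftyPos T) - ℓ ^ 2 := by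
    rw [← Real.sq_sqrt hℓE]
    exact pow_le_pow_left₀ ENNReal.toReal_nonneg hEv 2
  change J v ≤ _
  rw [hJNE]
  linarith

theorem exists_unique_solution_outflux {vel : ℝ → ℝ → ℝ}
    (hvel : ContDiffOn ℝ 1 (Function.uncurry vel) (Icc 0 1 ×ˢ Ici 0))
    (hpos : ∀ x ∈ Icc (0 : ℝ) 1, ∀ W ∈ Ici (0 : ℝ), 0 < vel x W) {T : ℝ} (hT : 0 < T)
    {ρ₀ u : ℝ → ℝ} (hρ₀ : ρ₀ ∈ LInftyPos 1) (hu : u ∈ LInftyPos T) :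
    ∃ ρ : ℝ → ℝ → ℝ, IsWeakSolution vel T ρ₀ u ρ ∧
      (∀ ρ' : ℝ → ℝ → ℝ, IsWeakSolution vel T ρ₀ u ρ' →
        ∀ t ∈ Icc 0 T, ρ' t =ᵐ[volume.restrict (Ioo 0 1)] ρ t) ∧
      ∃ y : ℝ → ℝ, IsOutflux vel T ρ y ∧
        ∀ y' : ℝ → ℝ, IsOutflux vel T ρ y' → y' =ᵐ[volume.restrict (Ioo 0 T)] y := by
  obtain ⟨r, hr, hrρ⟩ := exists_isData hρ₀ le_rfl
  obtain ⟨v, hv, hvu⟩ := exists_isData hu le_rfl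
  have hL0 := hv.bound_nonneg
  have hR0 : 0 ≤ ∫ x in (0 : ℝ)..1, r x := hr.primitive_nonneg zero_le_one
  obtain ⟨m, Λ, K, h⟩ := exists_isSpeed_clampSpeed hvel hpos
    (add_nonneg (mul_nonneg hL0 hT.le) hR0)
  obtain ⟨-, ρ, y, -, hρ, hy⟩ := exists_isResponse h hT hr hv le_rfl
  exact ⟨ρ, hρ.congr_data hrρ hvu, fun ρ' hρ' => IsWeakSolution.unique hvel hpos hT hr hv hρ
    (hρ'.congr_data hrρ.symm hvu.symm), y, hy,
    fun y' hy' => IsOutflux.unique EventuallyEq.rfl (fun _ _ => rfl) hy hy'⟩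

end NonlocalConservationLaw

theorem mainTheorem4 (vel : ℝ → ℝ → ℝ)
    (hvel : ContDiffOn ℝ 1 (Function.uncurry vel) (Set.Icc 0 1 ×ˢ Set.Ici 0))
    (hpos : ∀ x ∈ Set.Icc (0 : ℝ) 1, ∀ W ∈ Set.Ici (0 : ℝ), 0 < vel x W)
    (T : ℝ) (hT : 0 < T)
    (p : ENNReal) (hp : 1 ≤ p) (hp' : p ≠ ⊤)
    (yd : ℝ → ℝ) (hyd : MeasureTheory.MemLp yd ⊤ (MeasureTheory.volume.restrict (Set.Ioo 0 T)))
    (ρ₀ : ℝ → ℝ) (hρ₀ : ρ₀ ∈ NonlocalConservationLaw.LInftyPos 1) :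
    -- the out-flux, hence the cost, is well defined on the set of controls
    (∀ u ∈ NonlocalConservationLaw.LInftyPos T,
      ∃ ρ : ℝ → ℝ → ℝ, NonlocalConservationLaw.IsWeakSolution vel T ρ₀ u ρ ∧
        (∀ ρ' : ℝ → ℝ → ℝ, NonlocalConservationLaw.IsWeakSolution vel T ρ₀ u ρ' →
          ∀ t ∈ Set.Icc 0 T,
            ρ' t =ᵐ[MeasureTheory.volume.restrict (Set.Ioo 0 1)] ρ t) ∧
        ∃ y : ℝ → ℝ, NonlocalConservationLaw.IsOutflux vel T ρ y ∧
          ∀ y' : ℝ → ℝ, NonlocalConservationLaw.IsOutflux vel T ρ y' →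
            y' =ᵐ[MeasureTheory.volume.restrict (Set.Ioo 0 T)] y) ∧
    -- the cost attains its infimum
    ∃ uInf ∈ NonlocalConservationLaw.LInftyPos T,
      IsLeast (NonlocalConservationLaw.cost vel T ρ₀ p yd '' NonlocalConservationLaw.LInftyPos T)
        (NonlocalConservationLaw.cost vel T ρ₀ p yd uInf) :=
  ⟨fun _ hu => NonlocalConservationLaw.exists_unique_solution_outflux hvel hpos hT hρ₀ hu,
    NonlocalConservationLaw.exists_isLeast_cost hvel hpos hT hp hp' hyd hρ₀⟩
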